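/- **Setup.** Let $S_d$ be the symmetric group on $\{1,\dots,d\}$, let $g\ge 0$ be an integer, let $\alpha,\beta$ be partitions of $d\geq 1$ with $l(\alpha)$, $l(\beta)$ parts, and put $r=l(\alpha)+l(\beta)+2g-2$. A *monotone factorization of type* $(g,\alpha,\beta)$ is a tuple $(\sigma_1,\tau_1,\dots,\tau_r,\sigma_2)$ in $S_d$ such that $\sigma_2\tau_r\cdots\tau_1\sigma_1=\mathrm{id}$, the permutations $\sigma_1,\sigma_2$ have cycle types $\alpha,\beta$, each $\tau_i=(a_i\,b_i)$ is a transposition with $a_i<b_i$, the subgroup generated by $\sigma_1,\sigma_2,\tau_1,\dots,\tau_r$ acts transitively on $\{1,\dots,d\}$, and $b_1\le b_2\le\dots\le b_r$. Let $\vec H^{\mathbb C}_g(\alpha,\beta)$ be the number of such tuples (the complex monotone double Hurwitz number). For a sequence of signs $S_1,\dots,S_r\in\{\pm1\}$, a *real monotone factorization of type* $(g,\alpha,\beta;S)$ is a tuple $(\gamma,\sigma_1,\tau_1,\dots,\tau_r,\sigma_2)$ in which $(\sigma_1,\tau_1,\dots,\tau_r,\sigma_2)$ is a monotone factorization of type $(g,\alpha,\beta)$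 and $\gamma\in S_d$ satisfies $\gamma^2=\mathrm{id}$, $\gamma\sigma_1\gamma=\sigma_1^{-1}$ and $$\gamma_i(\tau_i\cdots\tau_1\sigma_1)\gamma_i=(\tau_i\cdots\tau_1\sigma_1)^{-1}\qquad(1\le i\le r),$$ where $\gamma_1=\gamma$ if $S_1=+1$, $\gamma_1=\gamma\sigma_1$ if $S_1=-1$, and, for $1\le j<r$, $\gamma_{j+1}=\gamma_j$ if $S_{j+1}=S_j$ and $\gamma_{j+1}=\gamma_j\tau_j\cdots\tau_1\sigma_1$ if $S_{j+1}\ne S_j$. Let $\vec H^{\mathbb R}_g(\alpha,\beta;s)$ be the number of real monotone factorizations for the simple sequence of signs $S_1=\dots=S_s=+1$, $S_{s+1}=\dots=S_r=-1$, and let $$\vec H^{\mathbb R}_g(\alpha,\beta)=\min_{0\le s\le r}\vec H^{\mathbb R}_g(\alpha,\beta;s)$$ (the real monotone double Hurwitz number relative to simple splittings). Every partition $\lambda$ decomposes uniquely as $\lambda=(\lambda_e,\lambda_{o,o}^2,\lambda_o)$, where $\lambda_e$ consists of even parts, $\lambda_{o,o}$ of odd parts (each listed twice in $\lambda_{o,o}^2$),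 and $\lambda_o$ of pairwise distinct odd parts. Let $\lambda_e^{\max}$ be the largest even part of $\lambda$ (and $0$ if there is none), and let $l(\cdot)$ denote the number of parts. **Theorem.** Let $g\ge0$ and let $\lambda,\mu$ be two partitions with $|\lambda|=|\mu|$. Suppose that $\mu_{o,o}=\emptyset$, that $l(\lambda_{o,o})>1$ and that every part of $\lambda_{o,o}$ equals $1$. Suppose moreover that one of the following four conditions holds: 1. $l(\lambda_o)=l(\mu_o)=1$ and $\lambda_e^{\max}>|\mu_o|$, where $|\mu_o|$ is the only part of $\mu_o$; 2. $l(\lambda_o)=2$, $l(\mu_o)=0$ and $\mu_e^{\max}$ is larger than both parts of $\lambda_o$; 3. $l(\lambda_o)=0$, $l(\mu_o)=2$ and $\lambda_e^{\max}$ is larger than both parts of $\mu_o$; 4. $l(\lambda_o)=l(\mu_o)=0$. For $m\ge 0$ put $\vec h^{\mathbb R}(m)=\vec H^{\mathbb R}_g\big((\lambda,2,1^{2m}),(\mu,2,1^{2m})\big)$ and $\vec h^{\mathbb C}(m)=\vec H^{\mathbb C}_g\big((\lambda,2,1^{2m}),(\mu,2,1^{2m})\big)$. Then $$\log\vec h^{\mathbb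 R}(m)\;\sim\;2m\log m\;\sim\;\log\vec h^{\mathbb C}(m)\qquad(m\to\infty).$$ In particular the real monotone double Hurwitz numbers relative to simple splittings are logarithmically equivalent to the complex monotone double Hurwitz numbers. -/

import Mathlib

namespace RealMonotoneHurwitz

open Equiv

/-! ### Partitions and their tail decomposition

A multiset `p` of natural numbers decomposes uniquely as `p = p_e + 2 • p_{o,o} + p_o`, where `p_e`
consists of even numbers, `p_{o,o}` of odd numbers, and `p_o` of pairwise distinct odd numbers. -/

/-- The even parts `p_e`. -/
def evenParts (p : Multiset ℕ) : Multiset ℕ :=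
  p.filter (fun k => Even k)

/-- The multiset `p_{o,o}`: every odd `k` is listed `⌊(multiplicity of k in p) / 2⌋` times. -/
def pairedOddParts (p : Multiset ℕ) : Multiset ℕ :=
  ∑ k ∈ p.toFinset.filter (fun k => Odd k), Multiset.replicate (p.count k / 2) k

/-- The multiset `p_o`: the odd numbers of odd multiplicity in `p`, each listed once. -/
def unpairedOddParts (p : Multiset ℕ) : Multiset ℕ :=
  (p.toFinset.filter (fun k => Odd k ∧ Odd (p.count k))).val

theorem count_evenParts (p : Multiset ℕ) (k : ℕ) :
    (evenParts p).count k = if Even k then p.count k else 0 := by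
  unfold evenParts
  rw [Multiset.count_filter]

theorem count_pairedOddParts (p : Multiset ℕ) (k : ℕ) :
    (pairedOddParts p).count k = if Odd k then p.count k / 2 else 0 := by
  unfold pairedOddParts
  rw [Multiset.count_sum']
  simp only [Multiset.count_replicate]
  rw [Finset.sum_ite_eq' (p.toFinset.filter (fun k => Odd k)) k (fun j => p.count j / 2)]
  by_cases hk : k ∈ p
  · simp [hk]
  · simp [hk]

theorem count_unpairedOddParts (p : Multiset ℕ) (k : ℕ) :
    (unpairedOddParts p).count k = if Odd k then p.count k % 2 else 0 := by
  unfold unpairedOddParts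
  rw [Multiset.count_eq_of_nodup (Finset.nodup _)]
  by_cases hk : Odd k
  · by_cases hc : Odd (p.count k)
    · have hm : k ∈ p := by
        by_contra h
        rw [Multiset.count_eq_zero_of_notMem h] at hc
        simp at hc
      simp [hk, hc, hm, Nat.odd_iff.mp hc]
    · simp [hk, hc, Nat.even_iff.mp (Nat.not_odd_iff_even.mp hc)]
  · simp [hk]

/-- The tail decomposition. -/
theorem tail_decomposition (p : Multiset ℕ) :
    p = evenParts p + 2 • pairedOddParts p + unpairedOddParts p := by
  ext k
  rw [Multiset.count_add, Multiset.count_add, Multiset.count_nsmul, count_evenParts,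
    count_pairedOddParts, count_unpairedOddParts]
  rcases Nat.even_or_odd k with hk | hk
  · simp [hk, Nat.not_odd_iff_even.mpr hk]
  · simp [hk, Nat.not_even_iff_odd.mpr hk]
    omega

/-- The largest even part of `p` (`0` if there is none). -/
def maxEvenPart (p : Multiset ℕ) : ℕ :=
  (evenParts p).sup

/-- The partition `(lam, 2, 1^{2m})`. -/
def addTwoOnes {d : ℕ} (lam : d.Partition) (m : ℕ) : (d + 2 + 2 * m).Partition where
  parts := lam.parts + {2} + Multiset.replicate (2 * m) 1
  parts_pos := by
    intro i hi
    simp only [Multiset.mem_add, Multiset.mem_singleton] at hi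
    rcases hi with (h | h) | h
    · exact lam.parts_pos h
    · omega
    · have := Multiset.eq_of_mem_replicate h
      omega
  parts_sum := by
    simp [lam.parts_sum]

/-! ### Factorizations in the symmetric group -/

/-- The number `r = l(lam) + l(mu) + 2g - 2` of simple branch points (for `d ≥ 1` both lengths are
positive, so that the subtraction is the usual one). -/
def numSimple {d : ℕ} (g : ℕ) (lam mu : d.Partition) : ℕ :=
  Multiset.card lam.parts + Multiset.card mu.parts + 2 * g - 2

/-- The products `P_i = τ_i ∘ ⋯ ∘ τ_1 ∘ σ₁` for `0 ≤ i ≤ r`, so `P_0 = σ₁`; the transposition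
`τ_{i+1}` is `τ i` in the zero-based indexing by `Fin r`. -/
def partialProduct {d r : ℕ} (σ₁ : Perm (Fin d)) (τ : Fin r → Perm (Fin d)) :
    Fin (r + 1) → Perm (Fin d) :=
  Fin.induction σ₁ (fun i P => τ i * P)

/-- `(σ₁, τ_1, …, τ_r, σ₂)` is a factorization of type `(g, lam, mu)`. -/
structure IsFactorization {d : ℕ} (g : ℕ) (lam mu : d.Partition) (σ₁ : Perm (Fin d))
    (τ : Fin (numSimple g lam mu) → Perm (Fin d)) (σ₂ : Perm (Fin d)) : Prop where
  prod_eq_one : σ₂ * partialProduct σ₁ τ (Fin.last _) = 1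
  type_left : σ₁.partition.parts = lam.parts
  type_right : σ₂.partition.parts = mu.parts
  isSwap : ∀ i, (τ i).IsSwap
  transitive : MulAction.IsPretransitive
    (Subgroup.closure ({σ₁, σ₂} ∪ Set.range τ)) (Fin d)

/-- Monotonicity: `τ_i = (a_i b_i)` with `a_i < b_i` and `b_1 ≤ b_2 ≤ ⋯ ≤ b_r`. -/
def IsMonotoneSeq {d r : ℕ} (τ : Fin r → Perm (Fin d)) : Prop :=
  ∃ a b : Fin r → Fin d, (∀ i, a i < b i ∧ τ i = swap (a i) (b i)) ∧
    ∀ i j, i ≤ j → b i ≤ b j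

/-- The complex monotone double Hurwitz number: the number of monotone factorizations. -/
noncomputable def complexMonotone {d : ℕ} (g : ℕ) (lam mu : d.Partition) : ℕ :=
  Set.ncard {t : Perm (Fin d) × (Fin (numSimple g lam mu) → Perm (Fin d)) × Perm (Fin d) |
    IsFactorization g lam mu t.1 t.2.1 t.2.2 ∧ IsMonotoneSeq t.2.1}

/-! ### Real structures -/

/-- The permutations `γ_0 = γ, γ_1, …, γ_r` attached to a sequence of signs `S_1, …, S_r`. With the
convention `S_0 = +1`, one has `γ_{i+1} = γ_i` if `S_{i+1} = S_i`, and
`γ_{i+1} = γ_i ∘ (τ_i ∘ ⋯ ∘ τ_1 ∘ σ₁)` otherwise; in particular `γ_1 = γ` if `S_1 = +1` and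
`γ_1 = γ ∘ σ₁` if `S_1 = -1`. Here `Fin.cons 1 S` is the sequence `S_0, S_1, …, S_r`. -/
def conjugators {d r : ℕ} (S : Fin r → ℤˣ) (γ σ₁ : Perm (Fin d)) (τ : Fin r → Perm (Fin d)) :
    Fin (r + 1) → Perm (Fin d) :=
  Fin.induction γ (fun i c =>
    if S i = (Fin.cons 1 S : Fin (r + 1) → ℤˣ) i.castSucc then c
    else c * partialProduct σ₁ τ i.castSucc)

/-- `γ` is an involution (possibly the identity) and `γ_i ∘ P_i ∘ γ_i = P_i⁻¹` for `0 ≤ i ≤ r`,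
where `P_i = τ_i ∘ ⋯ ∘ τ_1 ∘ σ₁`. For `i = 0` this reads `γ ∘ σ₁ ∘ γ = σ₁⁻¹`. -/
def IsRealStructure {d r : ℕ} (S : Fin r → ℤˣ) (γ σ₁ : Perm (Fin d))
    (τ : Fin r → Perm (Fin d)) : Prop :=
  γ * γ = 1 ∧ ∀ i : Fin (r + 1),
    conjugators S γ σ₁ τ i * partialProduct σ₁ τ i * conjugators S γ σ₁ τ i =
      (partialProduct σ₁ τ i)⁻¹

/-- The number of real monotone factorizations `(γ, σ₁, τ_1, …, τ_r, σ₂)` of type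
`(g, lam, mu; S)`. -/
noncomputable def realMonotoneOfSigns {d : ℕ} (g : ℕ) (lam mu : d.Partition)
    (S : Fin (numSimple g lam mu) → ℤˣ) : ℕ :=
  Set.ncard {t : Perm (Fin d) × Perm (Fin d) ×
      (Fin (numSimple g lam mu) → Perm (Fin d)) × Perm (Fin d) |
    IsFactorization g lam mu t.2.1 t.2.2.1 t.2.2.2 ∧ IsMonotoneSeq t.2.2.1 ∧
      IsRealStructure S t.1 t.2.1 t.2.2.1}

/-- The simple sequence of signs: `s` entries `+1` followed by `r - s` entries `-1`. -/
def simpleSigns (r s : ℕ) : Fin r → ℤˣ :=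
  fun i => if (i : ℕ) < s then 1 else -1

/-- The real monotone double Hurwitz number relative to simple splittings: the minimum over
`0 ≤ s ≤ r` of the numbers for the simple sequence of signs with `s` positive entries. -/
noncomputable def realMonotone {d : ℕ} (g : ℕ) (lam mu : d.Partition) : ℕ :=
  ⨅ s : Fin (numSimple g lam mu + 1),
    realMonotoneOfSigns g lam mu (simpleSigns (numSimple g lam mu) s)

/-- `h^ℝ_{g,lam,mu}(m)`, the real number for `(lam, 2, 1^{2m})` and `(mu, 2, 1^{2m})`. -/
noncomputable def hReal {d : ℕ} (g : ℕ) (lam mu : d.Partition) (m : ℕ) : ℕ :=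
  realMonotone g (addTwoOnes lam m) (addTwoOnes mu m)

/-- `h^ℂ_{g,lam,mu}(m)`, the complex number for `(lam, 2, 1^{2m})` and `(mu, 2, 1^{2m})`. -/
noncomputable def hComplex {d : ℕ} (g : ℕ) (lam mu : d.Partition) (m : ℕ) : ℕ :=
  complexMonotone g (addTwoOnes lam m) (addTwoOnes mu m)

end RealMonotoneHurwitz

/-! Write D = d + 2 + 2m. Three estimates give both asymptotics: h^R(m + 3) ≥ (2m)! for large m, h^R
≤ D · h^C, and log h^C ≤ (2 + ε) m log m for every ε > 0 and large m.

Lower bound. The relation c P c = P⁻¹ says that P c is an involution. Writing σ₁ = ργ with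
involutions ρ and γ, a real structure for a simple sign sequence therefore amounts to two runs: the
first s transpositions multiply ρ, the others multiply γ, and every permutation met on the way is an
involution (`isRealStructure_toSeq`). Two kinds of runs are combined. On a fixed number of points
arranged along a path, a product of distinct edge transpositions has the connected components as its
cycles; toggling edges of a matching in a suitable order changes one cycle type into the other,
monotonically and with as few transpositions as possible (`exists_isPathRun`). Each remaining point
is a common fixed point and is attached by a transposition used twice in a row, which keeps an
involution fixing both endpoints an involution. The j-th such point can be attached to about j
smaller ones, which gives n! choices for n = 2m + O(1) (`factorial_le_realMonotone`). The minimum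
over s is handled by letting the sign change fall among these leaves: the path run comes after it
when s is small and before it when s is large.

Real against complex. For constant signs, two real structures on one factorization differ by an
element of the centralizer of a transitive group, so one value determines γ (`realMonotone_le`).

Upper bound. There are r = 4m + O(1) transpositions (a b), but the monotone sequence of the b's and
every a lying within distance K of b on its cycle have only exponentially many possibilities. Only
far steps cost a factor D. Among these, joins of cycles number l(α) + g - 1 = 2m + O(1). A far cut
splits a cycle into two pieces of length at least K, so it lowers the excess, the sum of max(0,
length/K - 1) over cycles, by at least 1. A join that also merges two orbits raises the excess by at
most what it removes from a multiple of the sum of square roots of orbit sizes, which is at most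
2D/√K overall; only g joins merge no orbits, and each raises the excess by at most 1 (`numFar_le`).
Hence there are at most (2 + 4/√K) m + O(1) far steps, and K is taken large
(`complexMonotone_le_of_card_far_le`, `exists_log_hComplex_le`). -/

namespace RealMonotoneHurwitz

open Equiv

/-! ### Class sizes of equivalence relations -/

section Classes

variable {V : Type*}

/-- The equivalence relation obtained from `r` by uniting the classes of `a` and `b`. -/
def mergeSetoid (r : Setoid V) (a b : V) : Setoid V where
  r x y := r x y ∨ ((r x a ∨ r x b) ∧ (r y a ∨ r y b))
  iseqv :=
    { refl := fun x => Or.inl (r.refl x)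
      symm := by
        rintro x y (h | h)
        · exact Or.inl (r.symm h)
        · exact Or.inr ⟨h.2, h.1⟩
      trans := by
        rintro x y z (h | h) (h' | h')
        · exact Or.inl (r.trans h h')
        · exact Or.inr ⟨h'.1.imp (r.trans h) (r.trans h), h'.2⟩
        · exact Or.inr ⟨h.1, h.2.imp (r.trans (r.symm h')) (r.trans (r.symm h'))⟩
        · exact Or.inr ⟨h.1, h'.2⟩ }

theorem mergeSetoid_apply (r : Setoid V) (a b x y : V) :
    mergeSetoid r a b x y ↔ r x y ∨ ((r x a ∨ r x b) ∧ (r y a ∨ r y b)) := Iff.rfl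

theorem le_mergeSetoid (r : Setoid V) (a b : V) : r ≤ mergeSetoid r a b := fun _ _ h => Or.inl h

theorem mergeSetoid_self_apply (r : Setoid V) (a b : V) : mergeSetoid r a b a b :=
  Or.inr ⟨Or.inl (r.refl a), Or.inr (r.refl b)⟩

theorem mergeSetoid_le {r s : Setoid V} {a b : V} (h : r ≤ s) (hab : s a b) :
    mergeSetoid r a b ≤ s := by
  rintro x y (h1 | ⟨h1, h2⟩)
  · exact h h1
  · have hx : s x a := h1.elim (fun h1 => h h1) (fun h1 => s.trans (h h1) (s.symm hab))
    have hy : s y a := h2.elim (fun h1 => h h1) (fun h1 => s.trans (h h1) (s.symm hab))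
    exact s.trans hx (s.symm hy)

theorem mergeSetoid_eq_self {r : Setoid V} {a b : V} (hab : r a b) : mergeSetoid r a b = r :=
  le_antisymm (mergeSetoid_le le_rfl hab) (le_mergeSetoid r a b)

variable [Fintype V]

open Classical in
/-- The size of the class of `x`. -/
noncomputable def classCard (r : Setoid V) (x : V) : ℕ :=
  (Finset.univ.filter (fun y => r x y)).card

theorem classCard_pos (r : Setoid V) (x : V) : 0 < classCard r x := by
  classical
  exact Finset.card_pos.mpr ⟨x, by simp⟩

theorem classCard_congr {r : Setoid V} {x y : V} (h : r x y) : classCard r x = classCard r y := by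
  classical
  unfold classCard
  congr 1
  ext z
  simp only [Finset.mem_filter, Finset.mem_univ, true_and]
  exact ⟨fun h' => r.trans (r.symm h) h', fun h' => r.trans h h'⟩

theorem classCard_mono {r s : Setoid V} (h : r ≤ s) (x : V) : classCard r x ≤ classCard s x := by
  classical
  exact Finset.card_le_card (Finset.monotone_filter_right _ fun y _ hy => h hy)

/-- The sum over all classes of `F` of the size of the class. -/
noncomputable def classSum (r : Setoid V) (F : ℕ → ℝ) : ℝ :=
  ∑ x, F (classCard r x) / classCard r x

/-- The weight 1 / size makes the members of a class contribute `F` exactly once in total, which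
lets sums over classes be handled without the quotient. -/
theorem sum_class (r : Setoid V) (F : ℕ → ℝ) (a : V) [DecidablePred fun x => r a x] :
    ∑ x ∈ Finset.univ.filter (fun x => r a x), F (classCard r x) / classCard r x =
      F (classCard r a) := by
  classical
  have h0 := classCard_pos r a
  have h1 : ∀ x ∈ Finset.univ.filter (fun x => r a x),
      F (classCard r x) / classCard r x = F (classCard r a) / classCard r a := by
    intro x hx
    rw [classCard_congr (Finset.mem_filter.mp hx).2]
  rw [Finset.sum_congr rfl h1, Finset.sum_const, nsmul_eq_mul]
  have h2 : (Finset.univ.filter (fun x => r a x)).card = classCard r a := by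
    unfold classCard; congr
  rw [h2]
  field_simp

theorem classCard_mergeSetoid_self {r : Setoid V} {a b : V} (hab : ¬ r a b) :
    classCard (mergeSetoid r a b) a = classCard r a + classCard r b := by
  classical
  unfold classCard
  rw [← Finset.card_union_of_disjoint]
  · congr 1
    ext y
    simp only [Finset.mem_filter, Finset.mem_univ, true_and, Finset.mem_union, mergeSetoid_apply]
    constructor
    · rintro (h | ⟨_, h | h⟩)
      · exact Or.inl h
      · exact Or.inl (r.symm h)
      · exact Or.inr (r.symm h)
    · rintro (h | h)
      · exact Or.inl h
      · exact Or.inr ⟨Or.inl (r.refl a), Or.inr (r.symm h)⟩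
  · rw [Finset.disjoint_filter]
    intro y _ h1 h2
    exact hab (r.trans h1 (r.symm h2))

/-- Only the classes of `a` and `b` change, and they become one class whose size is the sum. The
identity is stated additively so that `linarith` can use it in both directions, for joins and for
cuts. -/
theorem classSum_mergeSetoid {r : Setoid V} {a b : V} (hab : ¬ r a b) (F : ℕ → ℝ) :
    classSum (mergeSetoid r a b) F + F (classCard r a) + F (classCard r b) =
      classSum r F + F (classCard r a + classCard r b) := by
  classical
  set q := mergeSetoid r a b with hq
  have hsplit : ∀ G : V → ℝ, ∑ x, G x = ∑ x ∈ Finset.univ.filter (fun x => q a x), G x +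
      ∑ x ∈ Finset.univ.filter (fun x => ¬ q a x), G x := fun G =>
    (Finset.sum_filter_add_sum_filter_not _ _ _).symm
  have hunion : Finset.univ.filter (fun x => q a x) =
      Finset.univ.filter (fun x => r a x) ∪ Finset.univ.filter (fun x => r b x) := by
    ext y
    simp only [Finset.mem_filter, Finset.mem_univ, true_and, Finset.mem_union, mergeSetoid_apply]
    constructor
    · rintro (h | ⟨_, h | h⟩)
      · exact Or.inl h
      · exact Or.inl (r.symm h)
      · exact Or.inr (r.symm h)
    · rintro (h | h)
      · exact Or.inl h
      · exact Or.inr ⟨Or.inl (r.refl a), Or.inr (r.symm h)⟩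
  have hdisj : Disjoint (Finset.univ.filter (fun x => r a x))
      (Finset.univ.filter (fun x => r b x)) := by
    rw [Finset.disjoint_filter]
    intro y _ h1 h2
    exact hab (r.trans h1 (r.symm h2))
  have hout : ∑ x ∈ Finset.univ.filter (fun x => ¬ q a x), F (classCard q x) / classCard q x =
      ∑ x ∈ Finset.univ.filter (fun x => ¬ q a x), F (classCard r x) / classCard r x := by
    refine Finset.sum_congr rfl fun x hx => ?_
    have hx' : ¬ q a x := (Finset.mem_filter.mp hx).2
    have : classCard q x = classCard r x := by
      unfold classCard
      congr 1
      ext y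
      simp only [Finset.mem_filter, Finset.mem_univ, true_and]
      refine ⟨?_, fun h => Or.inl h⟩
      rintro (h | ⟨h, _⟩)
      · exact h
      · refine absurd ?_ hx'
        exact Or.inr ⟨Or.inl (r.refl a), h⟩
    rw [this]
  have h1 : classSum q F = F (classCard q a) +
      ∑ x ∈ Finset.univ.filter (fun x => ¬ q a x), F (classCard r x) / classCard r x := by
    unfold classSum
    rw [hsplit, sum_class, hout]
  have h2 : classSum r F = F (classCard r a) + F (classCard r b) +
      ∑ x ∈ Finset.univ.filter (fun x => ¬ q a x), F (classCard r x) / classCard r x := by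
    unfold classSum
    rw [hsplit, hunion, Finset.sum_union hdisj, sum_class, sum_class]
  rw [h1, h2, hq, classCard_mergeSetoid_self hab]
  ring

theorem classSum_top [Nonempty V] (F : ℕ → ℝ) :
    classSum (⊤ : Setoid V) F = F (Fintype.card V) := by
  have h : ∀ x, classCard (⊤ : Setoid V) x = Fintype.card V := by
    intro x
    classical
    unfold classCard
    rw [Finset.filter_true_of_mem (fun y _ => by trivial), Finset.card_univ]
  have h0 : (Fintype.card V : ℝ) ≠ 0 := by simp
  simp only [classSum, h, Finset.sum_const, Finset.card_univ, nsmul_eq_mul]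
  field_simp

end Classes

/-! ### Cycles of a permutation multiplied by a transposition -/

section Cycles

variable {V : Type*} [DecidableEq V]

/-- If `σ ^ j` is the first positive power that takes `b` to `a` or `b`, then `swap a b * σ`
agrees with `σ` along the orbit of `b` before. -/
theorem swap_mul_pow_apply {σ : Perm V} {a b : V} {j : ℕ}
    (h : ∀ i, 0 < i → i < j → (σ ^ i) b ≠ a ∧ (σ ^ i) b ≠ b) :
    ∀ i, i < j → ((swap a b * σ) ^ i) b = (σ ^ i) b := by
  intro i
  induction i with
  | zero => intro _; rfl
  | succ i ih =>
    intro hi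
    rw [pow_succ', Perm.mul_apply, ih (by omega), Perm.mul_apply, ← Perm.mul_apply σ, ← pow_succ']
    exact swap_apply_of_ne_of_ne (h _ (by omega) hi).1 (h _ (by omega) hi).2

theorem swap_mul_pow_succ_apply {σ : Perm V} {a b : V} {j : ℕ}
    (h : ∀ i, 0 < i → i < j + 1 → (σ ^ i) b ≠ a ∧ (σ ^ i) b ≠ b) :
    ((swap a b * σ) ^ (j + 1)) b = swap a b ((σ ^ (j + 1)) b) := by
  rw [pow_succ', Perm.mul_apply, swap_mul_pow_apply h j (by omega), Perm.mul_apply,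
    ← Perm.mul_apply σ, ← pow_succ']

variable [Fintype V]

/-- Up to the first return of `b` under `σ` the two permutations agree along the orbit of `b`; at
the return the transposition sends the orbit to `a` instead. -/
theorem sameCycle_swap_mul {σ : Perm V} {a b : V} (hab : ¬ σ.SameCycle a b) :
    (swap a b * σ).SameCycle a b := by
  have hex : ∃ n, 0 < n ∧ (σ ^ n) b = b :=
    ⟨orderOf σ, orderOf_pos σ, by rw [pow_orderOf_eq_one]; rfl⟩
  classical
  obtain ⟨hn, hnb⟩ := Nat.find_spec hex
  obtain ⟨n, hn'⟩ : ∃ n, Nat.find hex = n + 1 := ⟨Nat.find hex - 1, by omega⟩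
  have h := swap_mul_pow_succ_apply (σ := σ) (a := a) (b := b) (j := n) (fun i hi hin => by
    refine ⟨fun h1 => hab (Perm.SameCycle.symm ⟨(i : ℤ), ?_⟩), fun h1 => ?_⟩
    · rw [zpow_natCast, h1]
    · exact Nat.find_min hex (by omega) ⟨hi, h1⟩)
  rw [hn'] at hnb
  rw [hnb, swap_apply_right] at h
  exact Perm.SameCycle.symm ⟨(n + 1 : ℕ), by rw [zpow_natCast, h]⟩

/-- A transposition across two cycles joins them. Both inclusions are checked on a single
application of the permutation, since an equivalence relation containing all pairs (x, τ x) contains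
the cycles of τ. -/
theorem setoid_swap_mul {σ : Perm V} {a b : V} (hab : ¬ σ.SameCycle a b) :
    Perm.SameCycle.setoid (swap a b * σ) = mergeSetoid (Perm.SameCycle.setoid σ) a b := by
  have key : ∀ (τ : Perm V) (s : Setoid V), (∀ x, s x (τ x)) → Perm.SameCycle.setoid τ ≤ s := by
    rintro τ s h x y hxy
    obtain ⟨n, hn⟩ := Perm.SameCycle.exists_nat_pow_eq hxy
    rw [← hn]
    clear hn hxy
    induction n with
    | zero => exact s.refl x
    | succ n ih => rw [pow_succ', Perm.mul_apply]; exact s.trans ih (h _)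
  have h1 := sameCycle_swap_mul hab
  apply le_antisymm
  · apply key
    intro x
    have hx : (Perm.SameCycle.setoid σ) x (σ x) := ⟨1, by simp⟩
    rw [Perm.mul_apply]
    by_cases ha : σ x = a
    · rw [ha, swap_apply_left]
      rw [ha] at hx
      exact Or.inr ⟨Or.inl hx, Or.inr ((Perm.SameCycle.setoid σ).refl _)⟩
    by_cases hb : σ x = b
    · rw [hb, swap_apply_right]
      rw [hb] at hx
      exact Or.inr ⟨Or.inr hx, Or.inl ((Perm.SameCycle.setoid σ).refl _)⟩
    · rw [swap_apply_of_ne_of_ne ha hb]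
      exact Or.inl hx
  · refine mergeSetoid_le (key _ _ fun x => ?_) h1
    have hx : (swap a b * σ).SameCycle x (swap a b (σ x)) := ⟨1, by simp⟩
    by_cases ha : σ x = a
    · rw [ha, swap_apply_left] at hx
      rw [ha]
      exact hx.trans h1.symm
    by_cases hb : σ x = b
    · rw [hb, swap_apply_right] at hx
      rw [hb]
      exact hx.trans h1
    · rwa [swap_apply_of_ne_of_ne ha hb] at hx

theorem exists_first_pow_eq {σ : Perm V} {a b : V} (h : σ.SameCycle a b) (hne : a ≠ b) :
    ∃ j : ℕ, (σ ^ (j + 1)) b = a ∧ (∀ i, 0 < i → i < j + 1 → (σ ^ i) b ≠ a ∧ (σ ^ i) b ≠ b) := by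
  classical
  have hex : ∃ n, (σ ^ n) b = a := Perm.SameCycle.exists_nat_pow_eq h.symm
  obtain ⟨j, hj⟩ : ∃ n, Nat.find hex = n + 1 := by
    refine ⟨Nat.find hex - 1, ?_⟩
    have : Nat.find hex ≠ 0 := by
      intro h0
      have := Nat.find_spec hex
      rw [h0] at this
      exact hne this.symm
    omega
  refine ⟨j, by rw [← hj]; exact Nat.find_spec hex, fun i hi hij => ⟨?_, fun hb => ?_⟩⟩
  · exact Nat.find_min hex (by omega)
  -- A return to `b` at time `i` would make the orbit meet `a` already at time `j + 1 - i`.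
  · refine Nat.find_min hex (m := j + 1 - i) (by omega) ?_
    have := Nat.find_spec hex
    rw [hj, show j + 1 = (j + 1 - i) + i by omega, pow_add, Perm.mul_apply, hb] at this
    exact this

/-- At the moment the orbit of `b` would reach `a`, the transposition sends it back to `b`; the new
cycle of `b` consists of the points visited before and misses `a`. -/
theorem not_sameCycle_swap_mul {σ : Perm V} {a b : V} (h : σ.SameCycle a b) (hne : a ≠ b) :
    ¬ (swap a b * σ).SameCycle a b := by
  obtain ⟨j, hj, hmin⟩ := exists_first_pow_eq h hne
  have h1 := swap_mul_pow_succ_apply hmin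
  rw [hj, swap_apply_left] at h1
  intro hc
  obtain ⟨n, hn⟩ := Perm.SameCycle.exists_nat_pow_eq hc.symm
  rw [← Nat.mod_add_div n (j + 1), pow_add, Perm.mul_apply, pow_mul] at hn
  -- The point `b` now has period `j + 1`, so any exponent may be reduced modulo `j + 1` to a time
  -- at which the orbit agrees with that of `σ`.
  have h2 : (((swap a b * σ) ^ (j + 1)) ^ (n / (j + 1))) b = b := by
    generalize n / (j + 1) = q
    induction q with
    | zero => rfl
    | succ q ih => rw [pow_succ, Perm.mul_apply, h1, ih]
  have hlt := Nat.mod_lt n (Nat.succ_pos j)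
  rw [h2, swap_mul_pow_apply hmin _ hlt] at hn
  rcases Nat.eq_zero_or_pos (n % (j + 1)) with h0 | h0
  · rw [h0] at hn
    exact hne hn.symm
  · exact (hmin _ h0 hlt).1 hn

/-- A cut is a join read backwards, so the single formula for merged classes serves both kinds of
steps. -/
theorem setoid_eq_mergeSetoid_swap_mul {σ : Perm V} {a b : V} (h : σ.SameCycle a b)
    (hne : a ≠ b) :
    Perm.SameCycle.setoid σ = mergeSetoid (Perm.SameCycle.setoid (swap a b * σ)) a b := by
  rw [← setoid_swap_mul (not_sameCycle_swap_mul h hne), ← mul_assoc, swap_mul_self, one_mul]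

/-- If `a` lies far behind `b` in its cycle, multiplication by `swap a b` cuts off a long cycle. -/
theorem le_classCard_swap_mul {σ : Perm V} {a b : V} (h : σ.SameCycle a b) (hne : a ≠ b) {K : ℕ}
    (hK : ∀ j ≤ K, (σ ^ j) b ≠ a) :
    K ≤ classCard (Perm.SameCycle.setoid (swap a b * σ)) b := by
  classical
  obtain ⟨j, hj, hmin⟩ := exists_first_pow_eq h hne
  have hKj : K ≤ j := by
    by_contra hlt
    exact hK (j + 1) (by omega) hj
  have hpow := swap_mul_pow_apply hmin
  have hinj : Set.InjOn (fun i => ((swap a b * σ) ^ i) b) (Finset.range K) := by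
    have aux : ∀ i i', i < i' → i' < K →
        ((swap a b * σ) ^ i) b ≠ ((swap a b * σ) ^ i') b := by
      intro i i' h1 h2 heq
      rw [hpow i (by omega), hpow i' (by omega), show i' = i + (i' - i) by omega, pow_add,
        Perm.mul_apply] at heq
      exact (hmin (i' - i) (by omega) (by omega)).2 ((σ ^ i).injective heq).symm
    intro i hi i' hi' heq
    simp only [Finset.coe_range, Set.mem_Iio] at hi hi'
    rcases lt_trichotomy i i' with h1 | h1 | h1
    · exact absurd heq (aux i i' h1 hi')
    · exact h1
    · exact absurd heq.symm (aux i' i h1 hi)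
  calc K = ((Finset.range K).image (fun i => ((swap a b * σ) ^ i) b)).card := by
        rw [Finset.card_image_of_injOn hinj, Finset.card_range]
    _ ≤ _ := by
        refine Finset.card_le_card ?_
        intro y hy
        obtain ⟨i, -, rfl⟩ := Finset.mem_image.mp hy
        simp only [Finset.mem_filter, Finset.mem_univ, true_and]
        exact ⟨i, by rw [zpow_natCast]⟩

/-- The class sizes of all points, in terms of the cycle type. -/
theorem map_classCard_eq_bind (σ : Perm V) :
    Finset.univ.val.map (classCard (Perm.SameCycle.setoid σ)) =
      σ.partition.parts.bind (fun k => Multiset.replicate k k) := by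
  classical
  have hfix : ∀ x, σ x = x → classCard (Perm.SameCycle.setoid σ) x = 1 := by
    intro x hx
    unfold classCard
    rw [Finset.card_eq_one]
    refine ⟨x, ?_⟩
    ext y
    simp only [Finset.mem_filter, Finset.mem_univ, true_and, Finset.mem_singleton]
    constructor
    · rintro ⟨n, hn⟩
      rw [← hn]
      exact Perm.zpow_apply_eq_self_of_apply_eq_self hx n
    · rintro rfl
      exact (Perm.SameCycle.setoid σ).refl _
  have hsupp : ∀ x, σ x ≠ x → Finset.univ.filter (fun y => (Perm.SameCycle.setoid σ) x y) =
      (σ.cycleOf x).support := by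
    intro x hx
    ext y
    simp only [Finset.mem_filter, Finset.mem_univ, true_and]
    rw [Perm.mem_support_cycleOf_iff' hx]
    rfl
  have hcard : ∀ c ∈ σ.cycleFactorsFinset, ∀ x ∈ c.support,
      classCard (Perm.SameCycle.setoid σ) x = c.support.card := by
    intro c hc x hx
    have hx' : σ x ≠ x := by
      rw [← Perm.mem_support]
      exact Perm.mem_cycleFactorsFinset_support_le hc hx
    unfold classCard
    rw [hsupp x hx', ← Perm.cycle_is_cycleOf hx hc]
  have hunion : (σ.support : Finset V) = σ.cycleFactorsFinset.biUnion (fun c => c.support) := by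
    ext x
    simp only [Finset.mem_biUnion]
    constructor
    · intro hx
      exact ⟨σ.cycleOf x, Perm.cycleOf_mem_cycleFactorsFinset_iff.mpr hx, by
        rw [Perm.mem_support_cycleOf_iff' (Perm.mem_support.mp hx)]⟩
    · rintro ⟨c, hc, hx⟩
      exact Perm.mem_cycleFactorsFinset_support_le hc hx
  ext k
  rw [Multiset.count_map, Multiset.count_bind, Perm.parts_partition, Multiset.map_add,
    Multiset.sum_add, Perm.cycleType_def, Multiset.map_map]
  have e1 : (Multiset.filter (fun a => k = classCard (Perm.SameCycle.setoid σ) a)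
      Finset.univ.val).card = (Finset.univ.filter
        (fun x => k = classCard (Perm.SameCycle.setoid σ) x)).card := rfl
  rw [e1, Finset.card_filter,
    ← Finset.sum_add_sum_compl σ.support]
  congr 1
  · rw [hunion, Finset.sum_biUnion]
    · change _ = ∑ c ∈ σ.cycleFactorsFinset, _
      refine Finset.sum_congr rfl fun c hc => ?_
      rw [Finset.sum_congr rfl fun x hx => by rw [hcard c hc x hx], Finset.sum_const]
      simp only [Function.comp_apply, Multiset.count_replicate, smul_eq_mul]
      by_cases h : k = c.support.card
      · simp [h]
      · simp [h, Ne.symm h]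
    · intro c hc c' hc' hne
      exact (Perm.cycleFactorsFinset_pairwise_disjoint σ hc hc' hne).disjoint_support
  · rw [Finset.sum_congr rfl fun x hx => by
      rw [hfix x (Perm.notMem_support.mp (Finset.mem_compl.mp hx))], Finset.sum_const,
      Finset.card_compl]
    simp only [Multiset.map_replicate, Multiset.sum_replicate, Multiset.count_replicate, smul_eq_mul]
    by_cases h : k = 1
    · simp [h]
    · simp [h, Ne.symm h]

/-- This is the bridge from the potentials, which live on points, to the cycle types in the
statement: `F = 1` counts cycles and `F = excess K` gives the excess. -/
theorem classSum_setoid_eq (σ : Perm V) (F : ℕ → ℝ) :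
    classSum (Perm.SameCycle.setoid σ) F = (σ.partition.parts.map F).sum := by
  have h := congrArg (fun M : Multiset ℕ => (M.map (fun k => F k / k)).sum)
    (map_classCard_eq_bind σ)
  simp only [Multiset.map_map, Multiset.map_bind, Multiset.sum_bind, Multiset.map_replicate,
    Multiset.sum_replicate] at h
  change classSum _ F = _ at h
  rw [h]
  congr 1
  refine Multiset.map_congr rfl fun k hk => ?_
  have : (k : ℝ) ≠ 0 := by
    have := σ.partition.parts_pos hk
    positivity
  rw [nsmul_eq_mul]
  field_simp

/-- The cycle type is determined by the class sizes of all points. -/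
theorem partition_parts_eq_of_map_classCard {σ : Perm V} {M : Multiset ℕ} (hM : ∀ k ∈ M, 0 < k)
    (h : Finset.univ.val.map (classCard (Perm.SameCycle.setoid σ)) =
      M.bind (fun k => Multiset.replicate k k)) : σ.partition.parts = M := by
  have hcount : ∀ (N : Multiset ℕ) (k : ℕ),
      (N.bind (fun k => Multiset.replicate k k)).count k = k * N.count k := by
    intro N k
    induction N using Multiset.induction_on with
    | empty => simp
    | cons a N ih =>
      rw [Multiset.cons_bind, Multiset.count_add, ih, Multiset.count_replicate, Multiset.count_cons]
      by_cases hak : a = k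
      · subst hak; simp; ring
      · simp [hak, Ne.symm hak]
  ext k
  rw [map_classCard_eq_bind] at h
  have hk := congrArg (Multiset.count k) h
  rw [hcount, hcount] at hk
  rcases Nat.eq_zero_or_pos k with rfl | hpos
  · rw [Multiset.count_eq_zero_of_notMem fun h0 => lt_irrefl _ (σ.partition.parts_pos h0),
      Multiset.count_eq_zero_of_notMem fun h0 => lt_irrefl _ (hM _ h0)]
  · exact Nat.eq_of_mul_eq_mul_left hpos hk

end Cycles

end RealMonotoneHurwitz

namespace RealMonotoneHurwitz

open Equiv

/-! ### Products of the transpositions along a path -/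

section Path

/-- Positions `x` and `y` are joined by edges in `l`. -/
def Joined (l : List ℕ) (x y : ℕ) : Prop := ∀ k, (x ≤ k ∧ k < y ∨ y ≤ k ∧ k < x) → k ∈ l

/-- `x` is a partial sum of the blocks of `c`. -/
def IsPartialSum {n : ℕ} (c : Composition n) (x : ℕ) : Prop := ∃ i ≤ c.length, c.sizeUpTo i = x

/-- When the missing edges are exactly those at the cuts of the composition, two positions are
joined iff no cut separates them. -/
theorem joined_iff_index_eq {N : ℕ} {c : Composition N} {l : List ℕ}
    (hl : ∀ k, k + 1 < N → (k ∈ l ↔ ¬ IsPartialSum c (k + 1))) (x y : Fin N) :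
    Joined l x y ↔ c.index x = c.index y := by
  have key : ∀ x y : Fin N, (x : ℕ) ≤ y → (Joined l x y ↔ c.index x = c.index y) := by
    intro x y hxy
    constructor
    · intro h
      by_contra hne
      have hlt : (c.index x : ℕ) < c.index y := by
        rcases lt_trichotomy (c.index x : ℕ) (c.index y) with h1 | h1 | h1
        · exact h1
        · exact absurd (Fin.ext h1) hne
        · have h2 := c.lt_sizeUpTo_index_succ y
          have h3 := c.sizeUpTo_index_le x
          have h4 := c.monotone_sizeUpTo (show (c.index y).succ.val ≤ (c.index x : ℕ) by
            rw [Fin.val_succ]; omega)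
          omega
      have h1 := c.lt_sizeUpTo_index_succ x
      have h2 := c.sizeUpTo_index_le y
      have h3 := c.monotone_sizeUpTo (show (c.index x).succ.val ≤ (c.index y : ℕ) by simpa using hlt)
      obtain ⟨k, hk⟩ : ∃ k, c.sizeUpTo (c.index x).succ = k + 1 :=
        ⟨c.sizeUpTo (c.index x).succ - 1, by omega⟩
      have hy := y.2
      refine (hl k (by omega)).mp (h k (Or.inl (by omega))) ⟨(c.index x).succ, ?_, hk⟩
      simp
    · rintro h k (hk | hk)
      · rw [hl k (by have := y.2; omega)]
        rintro ⟨i, -, hi⟩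
        have h1 := c.lt_sizeUpTo_index_succ y
        have h2 := c.sizeUpTo_index_le x
        rw [h] at h2
        rcases Nat.lt_or_ge (c.index y : ℕ) i with h3 | h3
        · have h4 := c.monotone_sizeUpTo (show (c.index y).succ.val ≤ i by simpa using h3)
          omega
        · have h4 := c.monotone_sizeUpTo h3
          omega
      · omega
  rcases le_total (x : ℕ) y with h | h
  · exact key x y h
  · rw [show c.index x = c.index y ↔ c.index y = c.index x from eq_comm, ← key y x h]
    exact ⟨fun h k hk => h k hk.symm, fun h k hk => h k hk.symm⟩

theorem list_prod_apply_of_fixed {V : Type*} {l : List (Perm V)} {w : V} (h : ∀ τ ∈ l, τ w = w) :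
    l.prod w = w := by
  induction l with
  | nil => rfl
  | cons τ l ih =>
    rw [List.prod_cons, Perm.mul_apply, ih fun τ hτ => h τ (List.mem_cons_of_mem _ hτ),
      h τ List.mem_cons_self]

variable {V : Type*} [DecidableEq V] {v : ℕ → V} {N : ℕ}

/-- The transposition along the edge `k` of the path `v 0, v 1, …`. -/
def edgeSwap (v : ℕ → V) (k : ℕ) : Perm V := swap (v k) (v (k + 1))

theorem edgeSwap_apply_of_ne {k : ℕ} {w : V} (h0 : w ≠ v k) (h1 : w ≠ v (k + 1)) :
    edgeSwap v k w = w := swap_apply_of_ne_of_ne h0 h1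

theorem prod_edgeSwap_apply_of_notMem {l : List ℕ} (hlN : ∀ k ∈ l, k + 1 < N) {w : V}
    (hw : ∀ x < N, v x ≠ w) : (l.map (edgeSwap v)).prod w = w := by
  refine list_prod_apply_of_fixed fun τ hτ => ?_
  obtain ⟨k, hk, rfl⟩ := List.mem_map.mp hτ
  have := hlN k hk
  exact edgeSwap_apply_of_ne (hw k (by omega)).symm (hw (k + 1) this).symm

variable [Fintype V]

/-- The cycles of a product of distinct transpositions along a path are the connected
components of the graph formed by these edges. -/
theorem sameCycle_prod_edgeSwap (hv : Set.InjOn v (Set.Iio N)) {l : List ℕ} (hl : l.Nodup)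
    (hlN : ∀ k ∈ l, k + 1 < N) {x y : ℕ} (hx : x < N) (hy : y < N) :
    ((l.map (edgeSwap v)).prod).SameCycle (v x) (v y) ↔ Joined l x y := by
  induction l generalizing x y with
  | nil =>
    simp only [List.map_nil, List.prod_nil, Joined, List.not_mem_nil, imp_false]
    rw [Perm.sameCycle_one, hv.eq_iff hx hy]
    constructor
    · rintro rfl k hk
      omega
    · intro h
      by_contra hne
      rcases Nat.lt_or_gt_of_ne hne with h1 | h1
      · exact h x (Or.inl ⟨le_rfl, h1⟩)
      · exact h y (Or.inr ⟨le_rfl, h1⟩)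
  | cons k l ih =>
    have hk := hlN k List.mem_cons_self
    have hkl : k ∉ l := (List.nodup_cons.mp hl).1
    have ih' := fun {x y : ℕ} (hx : x < N) (hy : y < N) =>
      ih (List.nodup_cons.mp hl).2 (fun j hj => hlN j (List.mem_cons_of_mem _ hj)) hx hy
    -- Joining `k` to `k + 1` on a path requires the edge `k` itself, so each new edge is a join and
    -- never a cut; this is why the order of the transpositions is irrelevant for the cycles.
    have hab : ¬ ((l.map (edgeSwap v)).prod).SameCycle (v k) (v (k + 1)) := by
      rw [ih' (by omega) hk]
      exact fun h => hkl (h k (Or.inl ⟨le_rfl, Nat.lt_succ_self k⟩))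
    rw [List.map_cons, List.prod_cons]
    change Perm.SameCycle.setoid (swap (v k) (v (k + 1)) * _) (v x) (v y) ↔ _
    rw [setoid_swap_mul hab, mergeSetoid_apply]
    change _ ∨ ((Perm.SameCycle _ _ _ ∨ Perm.SameCycle _ _ _) ∧ (Perm.SameCycle _ _ _ ∨
      Perm.SameCycle _ _ _)) ↔ _
    have hk' : k < N := by omega
    change Perm.SameCycle _ _ _ ∨ _ ↔ _
    rw [ih' hx hy, ih' hx hk', ih' hx hk, ih' hy hk', ih' hy hk]
    constructor
    · intro h j hj
      rw [List.mem_cons]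
      by_cases hjk : j = k
      · exact Or.inl hjk
      right
      rcases h with h | ⟨h | h, h' | h'⟩
      · exact h j hj
      all_goals
        have h1 := h j
        have h2 := h' j
        by_contra hc
        simp only [hc, imp_false] at h1 h2
        omega
    · intro h
      have hsub : ∀ a b : ℕ, (∀ j, (a ≤ j ∧ j < b ∨ b ≤ j ∧ j < a) →
          j ≠ k ∧ (x ≤ j ∧ j < y ∨ y ≤ j ∧ j < x)) → Joined l a b := by
        intro a b hab j hj
        have := h j (hab j hj).2
        rw [List.mem_cons] at this
        exact this.resolve_left (hab j hj).1
      by_cases hb : x ≤ k ∧ k < y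
      · refine Or.inr ⟨Or.inl (hsub _ _ fun j hj => ?_), Or.inr (hsub _ _ fun j hj => ?_)⟩ <;> omega
      by_cases hb' : y ≤ k ∧ k < x
      · refine Or.inr ⟨Or.inr (hsub _ _ fun j hj => ?_), Or.inl (hsub _ _ fun j hj => ?_)⟩ <;> omega
      · refine Or.inl (hsub _ _ fun j hj => ?_)
        omega

/-- The cycle type of a product of distinct transpositions along a path, where the missing edges
are at the partial sums of a composition. -/
theorem partition_prod_edgeSwap (hv : Set.InjOn v (Set.Iio N)) {l : List ℕ} (hl : l.Nodup)
    (hlN : ∀ k ∈ l, k + 1 < N) (c : Composition N)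
    (hc : ∀ k, k + 1 < N → (k ∈ l ↔ ¬ IsPartialSum c (k + 1))) :
    ((l.map (edgeSwap v)).prod).partition.parts =
      (c.blocks : Multiset ℕ) + Multiset.replicate (Fintype.card V - N) 1 := by
  classical
  set σ := (l.map (edgeSwap v)).prod with hσ
  let e : Fin N ↪ V := ⟨fun x => v x, fun x y h => Fin.ext (hv x.2 y.2 h)⟩
  have hin : ∀ i (j : Fin (c.blocksFun i)),
      classCard (Perm.SameCycle.setoid σ) (e (c.embedding i j)) = c.blocksFun i := by
    intro i j
    have : Finset.univ.filter (fun y => (Perm.SameCycle.setoid σ) (e (c.embedding i j)) y) =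
        (Finset.univ : Finset (Fin (c.blocksFun i))).map
          ((c.embedding i).toEmbedding.trans e) := by
      ext w
      simp only [Finset.mem_filter, Finset.mem_univ, true_and, Finset.mem_map]
      by_cases hw : ∃ y < N, v y = w
      · obtain ⟨y, hy, rfl⟩ := hw
        change σ.SameCycle (v (c.embedding i j)) (v y) ↔ _
        rw [hσ, sameCycle_prod_edgeSwap hv hl hlN (c.embedding i j).2 hy]
        rw [joined_iff_index_eq (c := c) hc (c.embedding i j) ⟨y, hy⟩, c.index_embedding,
          ← c.mem_range_embedding_iff']
        constructor
        · rintro ⟨k, hk⟩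
          exact ⟨k, congrArg (fun z : Fin N => v z) hk⟩
        · rintro ⟨k, hk⟩
          refine ⟨k, Fin.ext ?_⟩
          exact hv (c.embedding i k).2 hy hk
      · push Not at hw
        constructor
        · rintro ⟨n, hn⟩
          have h1 : σ w = w := prod_edgeSwap_apply_of_notMem hlN hw
          have h2 := Perm.zpow_apply_eq_self_of_apply_eq_self h1 n
          exact absurd ((σ ^ n).injective (hn.trans h2.symm)) (hw _ (c.embedding i j).2)
        · rintro ⟨k, hk⟩
          exact absurd hk (hw _ (c.embedding i k).2)
    unfold classCard
    rw [this, Finset.card_map, Finset.card_univ, Fintype.card_fin]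
  have hout : ∀ w ∈ (Finset.univ.map e)ᶜ, classCard (Perm.SameCycle.setoid σ) w = 1 := by
    intro w hw
    have h1 : σ w = w := prod_edgeSwap_apply_of_notMem hlN fun x hx h => by
      rw [Finset.mem_compl] at hw
      exact hw (Finset.mem_map.mpr ⟨⟨x, hx⟩, Finset.mem_univ _, h⟩)
    unfold classCard
    rw [Finset.card_eq_one]
    refine ⟨w, ?_⟩
    ext y
    simp only [Finset.mem_filter, Finset.mem_univ, true_and, Finset.mem_singleton]
    constructor
    · rintro ⟨n, hn⟩
      rw [← hn]
      exact Perm.zpow_apply_eq_self_of_apply_eq_self h1 n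
    · rintro rfl
      exact (Perm.SameCycle.setoid σ).refl _
  refine partition_parts_eq_of_map_classCard ?_ ?_
  · intro k hk
    rcases Multiset.mem_add.mp hk with h | h
    · exact c.blocks_pos h
    · rw [Multiset.eq_of_mem_replicate h]
      exact Nat.one_pos
  · ext k
    rw [Multiset.count_map, Multiset.add_bind, Multiset.count_add]
    have e1 : (Multiset.filter (fun a => k = classCard (Perm.SameCycle.setoid σ) a)
        Finset.univ.val).card = (Finset.univ.filter
          (fun x => k = classCard (Perm.SameCycle.setoid σ) x)).card := rfl
    rw [e1, Finset.card_filter, ← Finset.sum_add_sum_compl (Finset.univ.map e)]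
    congr 1
    · rw [Finset.sum_map, ← c.blocksFinEquiv.sum_comp, Fintype.sum_sigma, Multiset.count_bind]
      have e2 : (c.blocks : Multiset ℕ) = Finset.univ.val.map c.blocksFun := by
        rw [← c.ofFn_blocksFun]
        simp [List.ofFn_eq_map]
      rw [e2, Multiset.map_map]
      change _ = ∑ i, _
      refine Finset.sum_congr rfl fun i _ => ?_
      rw [Finset.sum_congr rfl (g := fun _ => if k = c.blocksFun i then 1 else 0) fun j _ => ?_]
      · simp [Multiset.count_replicate, eq_comm]
      · change (if k = classCard _ (e (c.embedding i j)) then 1 else 0) = _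
        rw [hin]
    · rw [Finset.sum_congr rfl (g := fun _ => if k = 1 then 1 else 0) fun w hw => by rw [hout w hw]]
      rw [Finset.sum_const, Finset.card_compl, Finset.card_map, Finset.card_univ, Fintype.card_fin]
      simp [Multiset.count_bind, Multiset.count_replicate, eq_comm]

end Path

end RealMonotoneHurwitz

namespace RealMonotoneHurwitz

open Equiv

/-! ### Sequences of transpositions acting on involutions -/

section Run

variable {V : Type*}

/-- Every transposition of `l` twice in a row. -/
def doubled (l : List (V × V)) : List (V × V) := l.flatMap fun p => [p, p]

theorem mem_doubled {l : List (V × V)} {p : V × V} : p ∈ doubled l ↔ p ∈ l := by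
  simp [doubled]

theorem doubled_append (l l' : List (V × V)) : doubled (l ++ l') = doubled l ++ doubled l' :=
  List.flatMap_append

theorem length_doubled (l : List (V × V)) : (doubled l).length = 2 * l.length := by
  simp [doubled, List.length_flatMap, mul_comm]

theorem doubled_injective : Function.Injective (doubled : List (V × V) → List (V × V)) := by
  intro l
  induction l with
  | nil =>
    intro l' h
    cases l' with
    | nil => rfl
    | cons p l' => simp [doubled] at h
  | cons p l ih =>
    intro l' h
    cases l' with
    | nil => simp [doubled] at h
    | cons p' l' =>
      simp only [doubled, List.flatMap_cons, List.cons_append, List.nil_append,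
        List.cons.injEq] at h
      rw [h.1, ih h.2.2]

variable [DecidableEq V]

/-- The result of multiplying `ρ` successively from the left by the transpositions in `l`. -/
def run (ρ : Perm V) : List (V × V) → Perm V
  | [] => ρ
  | p :: l => run (swap p.1 p.2 * ρ) l

/-- All the permutations met by `run ρ l` are involutions. -/
def IsRun (ρ : Perm V) : List (V × V) → Prop
  | [] => ρ * ρ = 1
  | p :: l => ρ * ρ = 1 ∧ IsRun (swap p.1 p.2 * ρ) l

theorem run_mul (ρ π : Perm V) (l : List (V × V)) : run (ρ * π) l = run ρ l * π := by
  induction l generalizing ρ with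
  | nil => rfl
  | cons p l ih => rw [run, run, ← mul_assoc, ih]

theorem run_append (ρ : Perm V) (l l' : List (V × V)) : run ρ (l ++ l') = run (run ρ l) l' := by
  induction l generalizing ρ with
  | nil => rfl
  | cons p l ih => exact ih _

theorem IsRun.mul_self {ρ : Perm V} {l : List (V × V)} (h : IsRun ρ l) : ρ * ρ = 1 := by
  cases l with
  | nil => exact h
  | cons p l => exact h.1

theorem IsRun.append {ρ : Perm V} {l l' : List (V × V)} (h : IsRun ρ l)
    (h' : IsRun (run ρ l) l') : IsRun ρ (l ++ l') := by
  induction l generalizing ρ with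
  | nil => exact h'
  | cons p l ih => exact ⟨h.1, ih h.2 h'⟩

theorem IsRun.run_take_mul_self {ρ : Perm V} {l : List (V × V)} (h : IsRun ρ l) (i : ℕ) :
    run ρ (l.take i) * run ρ (l.take i) = 1 := by
  induction l generalizing ρ i with
  | nil =>
    rw [List.take_nil]
    exact h
  | cons p l ih =>
    cases i with
    | zero => exact h.1
    | succ i => exact ih h.2 i

/-- An involution `δ` that fixes every point of the list commutes with all its transpositions, hence
can be carried along the whole run. -/
theorem IsRun.mul_left {ρ δ : Perm V} {l : List (V × V)} (h : IsRun ρ l) (hδ : δ * δ = 1)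
    (hc : Commute δ ρ) (hl : ∀ p ∈ l, δ p.1 = p.1 ∧ δ p.2 = p.2) : IsRun (δ * ρ) l := by
  have hsq : (δ * ρ) * (δ * ρ) = 1 := by
    rw [mul_assoc, ← mul_assoc ρ, ← hc.eq, mul_assoc, h.mul_self, mul_one, hδ]
  induction l generalizing ρ with
  | nil => exact hsq
  | cons p l ih =>
    refine ⟨hsq, ?_⟩
    have h1 : Commute δ (swap p.1 p.2) := by
      have := hl p List.mem_cons_self
      change δ * _ = _
      rw [mul_swap_eq_swap_mul, this.1, this.2]
    have h2 : Commute δ (swap p.1 p.2 * ρ) := h1.mul_right hc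
    rw [← mul_assoc, ← h1.eq, mul_assoc]
    refine ih h.2 h2 (fun q hq => hl q (List.mem_cons_of_mem _ hq)) ?_
    rw [mul_assoc, ← mul_assoc (swap p.1 p.2 * ρ) δ, ← h2.eq, mul_assoc, h.2.mul_self, mul_one, hδ]

theorem run_doubled (ρ : Perm V) (l : List (V × V)) : run ρ (doubled l) = ρ := by
  induction l with
  | nil => rfl
  | cons p l ih =>
    change run (swap p.1 p.2 * (swap p.1 p.2 * ρ)) (doubled l) = ρ
    rw [swap_mul_self_mul, ih]

/-- If `ρ` fixes both endpoints it commutes with the transposition, so the intermediate product is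
again an involution; the second copy then restores `ρ`. These pairs change no cycle type, but they
provide connectivity, genus and the free choices. -/
theorem isRun_doubled {ρ : Perm V} {l : List (V × V)} (hρ : ρ * ρ = 1)
    (h : ∀ p ∈ l, ρ p.1 = p.1 ∧ ρ p.2 = p.2) : IsRun ρ (doubled l) := by
  induction l with
  | nil => exact hρ
  | cons p l ih =>
    have h1 : ρ * swap p.1 p.2 = swap p.1 p.2 * ρ := by
      have := h p List.mem_cons_self
      rw [mul_swap_eq_swap_mul, this.1, this.2]
    refine ⟨hρ, ?_, ?_⟩
    · rw [mul_assoc, ← mul_assoc ρ, h1, mul_assoc, hρ, mul_one, swap_mul_self]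
    · rw [swap_mul_self_mul]
      exact ih fun q hq => h q (List.mem_cons_of_mem _ hq)

theorem partition_inv_parts [Fintype V] (σ : Perm V) : σ⁻¹.partition.parts = σ.partition.parts := by
  rw [Perm.parts_partition, Perm.parts_partition, Perm.cycleType_inv, Perm.support_inv]

end Run

/-! ### Lists of transpositions whose larger points increase. -/

section MonotoneList

variable {V : Type*} [LinearOrder V]

/-- The transpositions `(a b)` in `l` are written with `a < b`, and the `b`'s increase. -/
def IsMonotoneList (l : List (V × V)) : Prop :=
  (∀ p ∈ l, p.1 < p.2) ∧ l.Pairwise fun p q => p.2 ≤ q.2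

theorem IsMonotoneList.append {l l' : List (V × V)} (h : IsMonotoneList l)
    (h' : IsMonotoneList l') (hl : ∀ p ∈ l, ∀ q ∈ l', p.2 ≤ q.2) : IsMonotoneList (l ++ l') := by
  refine ⟨fun p hp => ?_, List.pairwise_append.mpr ⟨h.2, h'.2, hl⟩⟩
  rcases List.mem_append.mp hp with hp | hp
  · exact h.1 p hp
  · exact h'.1 p hp

theorem IsMonotoneList.doubled {l : List (V × V)} (h : IsMonotoneList l) :
    IsMonotoneList (doubled l) := by
  refine ⟨fun p hp => h.1 p (mem_doubled.mp hp), ?_⟩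
  have h2 := h.2
  clear h
  induction l with
  | nil => exact List.Pairwise.nil
  | cons p l ih =>
    rw [List.pairwise_cons] at h2
    change (p :: p :: RealMonotoneHurwitz.doubled l).Pairwise _
    rw [List.pairwise_cons, List.pairwise_cons]
    refine ⟨fun q hq => ?_, fun q hq => h2.1 q (mem_doubled.mp hq), ih h2.2⟩
    rcases List.mem_cons.mp hq with rfl | hq
    · exact le_rfl
    · exact h2.1 q (mem_doubled.mp hq)

theorem swap_injective_of_lt {a b a' b' : V} (h : a < b) (h' : a' < b')
    (heq : swap a b = swap a' b') : a = a' ∧ b = b' := by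
  have h1 : swap a' b' a = b := by rw [← heq, swap_apply_left]
  rw [swap_apply_def] at h1
  split_ifs at h1 with h2 h3
  · exact ⟨h2, h1.symm⟩
  · rw [h3, ← h1] at h
    exact absurd h (lt_asymm h')
  · exact absurd h1 h.ne

end MonotoneList

/-! ### From lists of transpositions to real monotone factorizations. -/

section Factorization

variable {d r : ℕ}

/-- The transpositions in a list, as a sequence. -/
def toSeq (l : List (Fin d × Fin d)) (h : l.length = r) : Fin r → Perm (Fin d) :=
  fun i => swap (l.get (i.cast h.symm)).1 (l.get (i.cast h.symm)).2

theorem partialProduct_toSeq (σ₁ : Perm (Fin d)) {l : List (Fin d × Fin d)} (h : l.length = r)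
    (i : Fin (r + 1)) : partialProduct σ₁ (toSeq l h) i = run σ₁ (l.take i) := by
  induction i using Fin.induction with
  | zero => simp [partialProduct, run]
  | succ i ih =>
    have hstep : partialProduct σ₁ (toSeq l h) i.succ =
        toSeq l h i * partialProduct σ₁ (toSeq l h) i.castSucc := by
      simp [partialProduct]
    have hlt : (i : ℕ) < l.length := by rw [h]; exact i.2
    rw [hstep, ih, Fin.val_succ, List.take_add_one, run_append, List.getElem?_eq_getElem hlt]
    rfl

theorem toSeq_injective {l l' : List (Fin d × Fin d)} (h : l.length = r) (h' : l'.length = r)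
    (hl : IsMonotoneList l) (hl' : IsMonotoneList l') (heq : toSeq l h = toSeq l' h') : l = l' := by
  refine List.ext_getElem (h.trans h'.symm) fun i hi hi' => ?_
  have h1 := congrFun heq ⟨i, by omega⟩
  have h2 := swap_injective_of_lt (hl.1 _ (List.getElem_mem hi)) (hl'.1 _ (List.getElem_mem hi')) h1
  exact Prod.ext h2.1 h2.2

theorem isMonotoneSeq_toSeq {l : List (Fin d × Fin d)} (h : l.length = r)
    (hl : IsMonotoneList l) : IsMonotoneSeq (toSeq l h) := by
  refine ⟨fun i => (l.get (i.cast h.symm)).1, fun i => (l.get (i.cast h.symm)).2,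
    fun i => ⟨hl.1 _ (List.get_mem _ _), rfl⟩, fun i j hij => ?_⟩
  rcases hij.eq_or_lt with rfl | hij
  · exact le_rfl
  · exact List.pairwise_iff_get.mp hl.2 _ _ hij

/-- A simple sign sequence, preceded by S₀ = +1, changes sign at most once, namely at S_{s+1}; for
`s = 0` this change is against the conventional S₀. -/
theorem conjugators_simpleSigns (s : ℕ) (γ σ₁ : Perm (Fin d)) (τ : Fin r → Perm (Fin d))
    (P : ℕ → Perm (Fin d)) (hP : ∀ i : Fin (r + 1), partialProduct σ₁ τ i = P i)
    (i : Fin (r + 1)) :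
    conjugators (simpleSigns r s) γ σ₁ τ i = if (i : ℕ) ≤ s then γ else γ * P s := by
  induction i using Fin.induction with
  | zero => simp [conjugators]
  | succ i ih =>
    have hstep : conjugators (simpleSigns r s) γ σ₁ τ i.succ =
        if simpleSigns r s i = (Fin.cons 1 (simpleSigns r s) : Fin (r + 1) → ℤˣ) i.castSucc then
          conjugators (simpleSigns r s) γ σ₁ τ i.castSucc
        else conjugators (simpleSigns r s) γ σ₁ τ i.castSucc *
          partialProduct σ₁ τ i.castSucc := by
      simp [conjugators]
    have hprev : (Fin.cons 1 (simpleSigns r s) : Fin (r + 1) → ℤˣ) i.castSucc =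
        if (i : ℕ) ≤ s then 1 else -1 := by
      obtain ⟨i, hi⟩ := i
      cases i with
      | zero => simp
      | succ i =>
        change simpleSigns r s ⟨i, by omega⟩ = _
        simp [simpleSigns]
    rw [hstep, hprev, ih, hP, Fin.val_castSucc, Fin.val_succ]
    have hne : (-1 : ℤˣ) ≠ 1 := by decide
    have hi : simpleSigns r s i = if (i : ℕ) < s then 1 else -1 := rfl
    rcases lt_trichotomy (i : ℕ) s with h | h | h
    · rw [if_pos h] at hi
      rw [if_pos (hi.trans (if_pos h.le).symm), if_pos h.le, if_pos (by omega)]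
    · rw [if_neg (by omega)] at hi
      rw [if_neg (by rwa [hi, if_pos h.le]), if_pos h.le, if_neg (by omega), h]
    · rw [if_neg (by omega)] at hi
      rw [if_pos (hi.trans (if_neg (by omega)).symm), if_neg (by omega), if_neg (by omega)]

/-- Before the sign change, P_i γ is the run of `ρ` along `l₁`. Afterwards the conjugator is γ P_s,
and P_i γ P_s turns out to be the run of `γ` along `l₂`: the run restarts from `γ`, whatever
happened to `ρ`. -/
theorem isRealStructure_toSeq {ρ γ : Perm (Fin d)} {l₁ l₂ : List (Fin d × Fin d)}
    (h : (l₁ ++ l₂).length = r) (h₁ : IsRun ρ l₁) (h₂ : IsRun γ l₂) :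
    IsRealStructure (simpleSigns r l₁.length) γ (ρ * γ) (toSeq (l₁ ++ l₂) h) := by
  have hγ := h₂.mul_self
  refine ⟨hγ, fun i => ?_⟩
  rw [conjugators_simpleSigns _ _ _ _ (fun i => run (ρ * γ) ((l₁ ++ l₂).take i))
    (partialProduct_toSeq _ h), partialProduct_toSeq]
  have key : ∀ c P : Perm (Fin d), (P * c) * (P * c) = 1 → c * P * c = P⁻¹ := by
    intro c P h
    rw [eq_inv_iff_mul_eq_one]
    have h1 : P * (c * P * c) = 1 := by simpa only [mul_assoc] using h
    rw [← mul_eq_one_comm]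
    exact h1
  split_ifs with hi
  · apply key
    have e : run (ρ * γ) ((l₁ ++ l₂).take i) * γ = run ρ (l₁.take i) := by
      rw [run_mul, mul_assoc, hγ, mul_one, List.take_append_of_le_length hi]
    rw [e]
    exact h₁.run_take_mul_self i
  · apply key
    set Q := run ρ l₁ with hQ
    have hQQ : Q * Q = 1 := by
      have := h₁.run_take_mul_self l₁.length
      rwa [List.take_length] at this
    -- With P_s = Q γ and Q an involution, P_s (γ P_s) = Q γ γ Q γ = γ, which is the starting point
    -- of the second run.
    have e : run (ρ * γ) ((l₁ ++ l₂).take i) * (γ * run (ρ * γ) ((l₁ ++ l₂).take l₁.length)) =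
        run γ (l₂.take (i - l₁.length)) := by
      rw [List.take_left, List.take_append, List.take_of_length_le (l := l₁) (by omega), run_append,
        run_mul ρ γ l₁, ← hQ, ← run_mul]
      congr 1
      rw [mul_assoc, ← mul_assoc γ, hγ, one_mul, ← mul_assoc, hQQ, one_mul]
    rw [e]
    exact h₂.run_take_mul_self _

/-- A real monotone factorization given by lists of transpositions. -/
structure IsRealList {d : ℕ} (g : ℕ) (α β : d.Partition) (ρ γ : Perm (Fin d))
    (l₁ l₂ : List (Fin d × Fin d)) : Prop where
  length : (l₁ ++ l₂).length = numSimple g α β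
  monotone : IsMonotoneList (l₁ ++ l₂)
  isRun_left : IsRun ρ l₁
  isRun_right : IsRun γ l₂
  type_left : (ρ * γ).partition.parts = α.parts
  type_right : (run (ρ * γ) (l₁ ++ l₂)).partition.parts = β.parts
  connected : ∀ r : Setoid (Fin d), (∀ x, r x ((ρ * γ) x)) → (∀ p ∈ l₁ ++ l₂, r p.1 p.2) → r = ⊤

theorem IsRealList.isFactorization {g : ℕ} {α β : d.Partition} {ρ γ : Perm (Fin d)}
    {l₁ l₂ : List (Fin d × Fin d)} (h : IsRealList g α β ρ γ l₁ l₂) :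
    IsFactorization g α β (ρ * γ) (toSeq (l₁ ++ l₂) h.length) (run (ρ * γ) (l₁ ++ l₂))⁻¹ where
  prod_eq_one := by
    rw [partialProduct_toSeq, Fin.val_last, List.take_of_length_le h.length.le, inv_mul_cancel]
  type_left := h.type_left
  type_right := by rw [partition_inv_parts, h.type_right]
  isSwap := fun i => ⟨_, _, (h.monotone.1 _ (List.get_mem _ _)).ne, rfl⟩
  transitive := by
    set G := Subgroup.closure ({ρ * γ, (run (ρ * γ) (l₁ ++ l₂))⁻¹} ∪
      Set.range (toSeq (l₁ ++ l₂) h.length)) with hG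
    have htop := h.connected (MulAction.orbitRel G (Fin d)) (fun x => ?_) (fun p hp => ?_)
    · refine ⟨fun x y => ?_⟩
      have : MulAction.orbitRel G (Fin d) y x := by rw [htop]; trivial
      exact this
    · refine Setoid.symm' _ ?_
      exact ⟨⟨ρ * γ, Subgroup.subset_closure (by simp)⟩, rfl⟩
    · obtain ⟨i, hi⟩ := List.mem_iff_get.mp hp
      refine ⟨⟨swap p.1 p.2, Subgroup.subset_closure (Or.inr ⟨i.cast h.length, ?_⟩)⟩, ?_⟩
      · simp [toSeq, ← hi]
      · exact swap_apply_right _ _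

/-- The involutions `ρ` and `γ` stay fixed over the whole family, so distinct factorizations come
from distinct lists; monotonicity normalizes each transposition, which makes the list recoverable
from the sequence. -/
theorem card_le_realMonotoneOfSigns {g : ℕ} {α β : d.Partition} {s : ℕ} {ρ γ : Perm (Fin d)}
    {ι : Type*} [Fintype ι] (l₁ l₂ : ι → List (Fin d × Fin d)) (hs : ∀ i, (l₁ i).length = s)
    (h : ∀ i, IsRealList g α β ρ γ (l₁ i) (l₂ i))
    (hinj : Function.Injective fun i => l₁ i ++ l₂ i) :
    Fintype.card ι ≤ realMonotoneOfSigns g α β (simpleSigns _ s) := by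
  unfold realMonotoneOfSigns
  rw [← Nat.card_eq_fintype_card, ← Set.ncard_univ]
  refine Set.ncard_le_ncard_of_injOn
    (fun i => (γ, ρ * γ, toSeq (l₁ i ++ l₂ i) (h i).length, (run (ρ * γ) (l₁ i ++ l₂ i))⁻¹))
    (fun i _ => ⟨(h i).isFactorization, isMonotoneSeq_toSeq (h i).length (h i).monotone, ?_⟩)
    (fun i _ j _ hij => ?_) (Set.toFinite _)
  · rw [← hs i]
    exact isRealStructure_toSeq (h i).length (h i).isRun_left (h i).isRun_right
  · simp only [Prod.mk.injEq] at hij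
    exact hinj (toSeq_injective _ _ (h i).monotone (h j).monotone hij.2.2.1)

end Factorization

end RealMonotoneHurwitz

namespace RealMonotoneHurwitz

open Equiv

/-! ### Matchings of a path and the associated involutions -/

section Matching

variable {V : Type*} [DecidableEq V] {v : ℕ → V} {N : ℕ}

/-- `M` contains no two adjacent edges of the path, and only edges below `N`. -/
def IsPathMatching (N : ℕ) (M : Finset ℕ) : Prop := ∀ k ∈ M, k + 1 < N ∧ k + 1 ∉ M

/-- The product of the transpositions along the edges in `M`. -/
noncomputable def edgeProd (v : ℕ → V) (M : Finset ℕ) : Perm V := (M.toList.map (edgeSwap v)).prod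

theorem IsPathMatching.subset {M M' : Finset ℕ} (h : IsPathMatching N M) (h' : M' ⊆ M) :
    IsPathMatching N M' := fun k hk => ⟨(h k (h' hk)).1, fun hk' => (h k (h' hk)).2 (h' hk')⟩

theorem commute_edgeSwap (hv : Set.InjOn v (Set.Iio N)) {j k : ℕ} (hj : j + 1 < N)
    (hk : k + 1 < N) (h1 : j + 1 ≠ k) (h2 : k + 1 ≠ j) :
    Commute (edgeSwap v j) (edgeSwap v k) := by
  by_cases hjk : j = k
  · rw [hjk]
  have hne : ∀ {x y : ℕ}, x < N → y < N → x ≠ y → v x ≠ v y := fun hx hy hxy h =>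
    hxy (hv hx hy h)
  change _ * _ = _ * _
  unfold edgeSwap
  rw [mul_swap_eq_swap_mul, swap_apply_of_ne_of_ne, swap_apply_of_ne_of_ne]
  all_goals apply hne <;> omega

theorem IsPathMatching.pairwise_commute {M : Finset ℕ} (hv : Set.InjOn v (Set.Iio N))
    (h : IsPathMatching N M) : (M.toList.map (edgeSwap v)).Pairwise Commute := by
  refine List.pairwise_of_forall_mem_list ?_
  intro σ hσ τ hτ
  obtain ⟨j, hj, rfl⟩ := List.mem_map.mp hσ
  obtain ⟨k, hk, rfl⟩ := List.mem_map.mp hτ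
  rw [Finset.mem_toList] at hj hk
  refine commute_edgeSwap hv (h j hj).1 (h k hk).1 (fun e => ?_) (fun e => ?_)
  · exact (h j hj).2 (e ▸ hk)
  · exact (h k hk).2 (e ▸ hj)

theorem edgeProd_insert (hv : Set.InjOn v (Set.Iio N)) {M : Finset ℕ} {k : ℕ} (hk : k ∉ M)
    (h : IsPathMatching N (insert k M)) : edgeProd v (insert k M) = edgeSwap v k * edgeProd v M := by
  unfold edgeProd
  rw [← List.prod_cons, ← List.map_cons]
  exact List.Perm.prod_eq' ((Finset.toList_insert hk).map _) (h.pairwise_commute hv)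

theorem edgeProd_union (hv : Set.InjOn v (Set.Iio N)) {M M' : Finset ℕ} (hd : Disjoint M M')
    (h : IsPathMatching N (M ∪ M')) : edgeProd v (M ∪ M') = edgeProd v M * edgeProd v M' := by
  induction M using Finset.induction_on with
  | empty => simp [edgeProd]
  | insert k M hk ih =>
    rw [Finset.disjoint_insert_left] at hd
    rw [Finset.insert_union] at h ⊢
    rw [edgeProd_insert hv (by simp [hk, hd.1]) h, ih hd.2 (h.subset (Finset.subset_insert _ _)),
      edgeProd_insert hv hk (h.subset (Finset.insert_subset_insert _ Finset.subset_union_left)),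
      mul_assoc]

theorem edgeProd_mul_self (hv : Set.InjOn v (Set.Iio N)) {M : Finset ℕ}
    (h : IsPathMatching N M) : edgeProd v M * edgeProd v M = 1 := by
  induction M using Finset.induction_on with
  | empty => simp [edgeProd]
  | insert k M hk ih =>
    have hc : Commute (edgeSwap v k) (edgeProd v M) := by
      unfold edgeProd
      refine Commute.list_prod_right _ _ fun τ hτ => ?_
      obtain ⟨j, hj, rfl⟩ := List.mem_map.mp hτ
      rw [Finset.mem_toList] at hj
      have hk' := h k (Finset.mem_insert_self _ _)
      have hj' := h j (Finset.mem_insert_of_mem hj)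
      refine commute_edgeSwap hv hk'.1 hj'.1 (fun e => ?_) (fun e => ?_)
      · exact hk'.2 (e ▸ Finset.mem_insert_of_mem hj)
      · exact hj'.2 (e ▸ Finset.mem_insert_self _ _)
    rw [edgeProd_insert hv hk h, mul_assoc, ← mul_assoc (edgeProd v M), ← hc.eq, mul_assoc,
      ih (h.subset (Finset.subset_insert _ _)), mul_one]
    exact swap_mul_self _ _

theorem edgeProd_apply_of_ne {M : Finset ℕ} {w : V} (h : ∀ k ∈ M, w ≠ v k ∧ w ≠ v (k + 1)) :
    edgeProd v M w = w := by
  refine list_prod_apply_of_fixed fun τ hτ => ?_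
  obtain ⟨k, hk, rfl⟩ := List.mem_map.mp hτ
  rw [Finset.mem_toList] at hk
  exact edgeSwap_apply_of_ne (h k hk).1 (h k hk).2

/-- The endpoints of the edge `k`, ordered according to the parity of `k`. -/
def edgePair (v : ℕ → V) (k : ℕ) : V × V := if Even k then (v k, v (k + 1)) else (v (k + 1), v k)

theorem swap_edgePair (v : ℕ → V) (k : ℕ) :
    swap (edgePair v k).1 (edgePair v k).2 = edgeSwap v k := by
  unfold edgePair edgeSwap
  split_ifs
  · rfl
  · exact swap_comm _ _

/-- Multiplication by an edge transposition toggles the membership of that edge in the matching.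
Edge products of matchings are involutions, so it suffices to see that the sets before and after the
toggle are matchings. -/
theorem isRun_edgePair (hv : Set.InjOn v (Set.Iio N)) {M M' : Finset ℕ} {k : ℕ} {c : Prop}
    [Decidable c] (h : IsPathMatching N M) (h' : IsPathMatching N M')
    (hne : ∀ x, x ≠ k → (x ∈ M' ↔ x ∈ M)) (hk : k ∈ M' ↔ (c ↔ k ∉ M)) :
    IsRun (edgeProd v M) (if c then [edgePair v k] else []) ∧
      run (edgeProd v M) (if c then [edgePair v k] else []) = edgeProd v M' := by
  by_cases hc : c
  · have hrun : edgeSwap v k * edgeProd v M = edgeProd v M' := by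
      by_cases hkM : k ∈ M
      · have hM : M = insert k M' := by
          ext x
          by_cases hx : x = k
          · simp [hx, hkM]
          · simp [hx, hne x hx]
        have hkM' : k ∉ M' := by simpa [hc, hkM] using hk
        rw [hM] at h ⊢
        rw [edgeProd_insert hv hkM' h]
        exact swap_mul_self_mul _ _ _
      · have hM : M' = insert k M := by
          ext x
          by_cases hx : x = k
          · simp [hx, hkM, hk, hc]
          · simp [hx, hne x hx]
        rw [hM] at h' ⊢
        rw [edgeProd_insert hv hkM h']
    rw [if_pos hc]
    refine ⟨⟨edgeProd_mul_self hv h, ?_⟩, ?_⟩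
    · rw [swap_edgePair, hrun]
      exact edgeProd_mul_self hv h'
    · rw [run, swap_edgePair, hrun, run]
  · have hM : M' = M := by
      ext x
      by_cases hx : x = k
      · rw [hx, hk]
        simp [hc]
      · exact hne x hx
    rw [if_neg hc, hM]
    exact ⟨edgeProd_mul_self hv h, rfl⟩

end Matching

/-! ### Deforming one composition of a path into another -/

section Deform

open Classical in
/-- The edges below `N` such that the even ones before `i` are not in `β`, the even ones from `i`
on are not in `α`, and the odd ones are in `α` and not before `j`. -/
noncomputable def stage (N : ℕ) (α β : ℕ → Prop) (i j : ℕ) : Finset ℕ :=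
  (Finset.range (N - 1)).filter fun k =>
    (Even k ∧ k < i ∧ ¬ β k) ∨ (Even k ∧ i ≤ k ∧ ¬ α k) ∨ (Odd k ∧ j ≤ k ∧ α k)

theorem mem_stage {N : ℕ} {α β : ℕ → Prop} {i j k : ℕ} : k ∈ stage N α β i j ↔ k + 1 < N ∧
    ((Even k ∧ k < i ∧ ¬ β k) ∨ (Even k ∧ i ≤ k ∧ ¬ α k) ∨ (Odd k ∧ j ≤ k ∧ α k)) := by
  classical
  unfold stage
  rw [Finset.mem_filter, Finset.mem_range, Nat.lt_sub_iff_add_lt]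

/-- An odd edge in the stage is a cut of `α`, and by hypothesis so are its two neighbours. Since `i`
is even and `i ≤ j`, these neighbours are not before `i`, and there the even edges of the stage
avoid the cuts of `α`. -/
theorem isPathMatching_stage {N : ℕ} {α β : ℕ → Prop} {i j : ℕ}
    (hα : ∀ k, Odd k → k + 1 < N → α k → α (k - 1) ∧ α (k + 1)) (hi : Even i) (hij : i ≤ j) :
    IsPathMatching N (stage N α β i j) := by
  intro k hk
  rw [mem_stage] at hk
  refine ⟨hk.1, fun hk' => ?_⟩
  rw [mem_stage] at hk'
  obtain ⟨hN, hk⟩ := hk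
  obtain ⟨hN', hk'⟩ := hk'
  rcases hk with ⟨he, h⟩ | ⟨he, h⟩ | ⟨he, h⟩ <;> rcases hk' with ⟨he', h'⟩ | ⟨he', h'⟩ | ⟨he', h'⟩
  · rw [Nat.even_add_one] at he'; exact he' he
  · rw [Nat.even_add_one] at he'; exact he' he
  · rw [show i = k + 1 by omega, Nat.even_add_one] at hi
    exact hi he
  · rw [Nat.even_add_one] at he'; exact he' he
  · rw [Nat.even_add_one] at he'; exact he' he
  · exact h.2 (hα (k + 1) he' hN' h'.2).1
  · omega
  · exact h'.2 (hα k he hN h.2).2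
  · rw [Nat.odd_add_one] at he'; exact he' he

variable {V : Type*} {v : ℕ → V} {N : ℕ} {α β : ℕ → Prop}

open Classical in
/-- The transpositions applied at the `j`-th even edge. -/
noncomputable def deformBlock (v : ℕ → V) (N : ℕ) (α β : ℕ → Prop) (j : ℕ) : List (V × V) :=
  (if 2 * j + 2 < N ∧ α (2 * j + 1) then [edgePair v (2 * j + 1)] else []) ++
    (if α (2 * j) then [edgePair v (2 * j)] else []) ++
      (if β (2 * j) then [edgePair v (2 * j)] else [])

/-- The transpositions that deform the composition with cuts `α` to the one with cuts `β`. -/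
noncomputable def deform (v : ℕ → V) (N : ℕ) (α β : ℕ → Prop) (n : ℕ) : List (V × V) :=
  (List.range n).flatMap (deformBlock v N α β)

theorem deform_succ (n : ℕ) :
    deform v N α β (n + 1) = deform v N α β n ++ deformBlock v N α β n := by
  simp [deform, List.range_succ]

theorem mem_deformBlock {j : ℕ} {p : V × V} (hp : p ∈ deformBlock v N α β j) :
    p = edgePair v (2 * j) ∨ (2 * j + 2 < N ∧ p = edgePair v (2 * j + 1)) := by
  unfold deformBlock at hp
  simp only [List.mem_append] at hp
  rcases hp with (hp | hp) | hp <;> split_ifs at hp with h <;> simp at hp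
  · exact Or.inr ⟨h.1, hp⟩
  · exact Or.inl hp
  · exact Or.inl hp

/-- In each block the odd edge on the right is removed first, the one on the left having gone in the
previous block. The even edge then has no neighbour in the matching, so it may be inserted if `α`
cuts it and removed again if `β` cuts it. -/
theorem isRun_deform [DecidableEq V] (hv : Set.InjOn v (Set.Iio N))
    (hα : ∀ k, Odd k → k + 1 < N → α k → α (k - 1) ∧ α (k + 1)) {n : ℕ} (hn : 2 * n ≤ N) :
    IsRun (edgeProd v (stage N α β 0 0)) (deform v N α β n) ∧
      run (edgeProd v (stage N α β 0 0)) (deform v N α β n) =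
        edgeProd v (stage N α β (2 * n) (2 * n)) := by
  classical
  induction n with
  | zero => exact ⟨edgeProd_mul_self hv (isPathMatching_stage hα (by simp) le_rfl), rfl⟩
  | succ n ih =>
    obtain ⟨ih1, ih2⟩ := ih (by omega)
    rw [deform_succ, run_append, ih2]
    have e2n : Even (2 * n) := even_two_mul n
    have o2n : Odd (2 * n + 1) := odd_two_mul_add_one n
    have hne : ¬ Even (2 * n + 1) := Nat.not_even_iff_odd.mpr o2n
    have hno : ¬ Odd (2 * n) := Nat.not_odd_iff_even.mpr e2n
    have hS0 := isPathMatching_stage (β := β) (i := 2 * n) (j := 2 * n) hα e2n (by omega)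
    have hS1 := isPathMatching_stage (β := β) (i := 2 * n) (j := 2 * n + 2) hα e2n (by omega)
    have hS3 := isPathMatching_stage (β := β) (i := 2 * n + 2) (j := 2 * n + 2) hα
      (e2n.add even_two) le_rfl
    -- The middle state of the block: the edge `2 * n` is present whether or not it is a cut,
    -- because both odd neighbours are already absent.
    have hS2 : IsPathMatching N (insert (2 * n) (stage N α β (2 * n) (2 * n + 2))) := by
      intro k hk
      rw [Finset.mem_insert] at hk
      rcases hk with rfl | hk
      · refine ⟨by omega, ?_⟩
        rw [Finset.mem_insert, mem_stage]
        rintro (h | ⟨_, h | h | h⟩)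
        · omega
        · exact hne h.1
        · exact hne h.1
        · omega
      · refine ⟨(hS1 k hk).1, ?_⟩
        rw [Finset.mem_insert]
        rintro (h | h)
        · rw [mem_stage] at hk
          rcases hk.2 with h' | h' | h'
          · rw [← h, Nat.even_add_one] at e2n; exact e2n h'.1
          · omega
          · omega
        · exact (hS1 k hk).2 h
    obtain ⟨a1, a2⟩ := isRun_edgePair (k := 2 * n + 1) (c := 2 * n + 2 < N ∧ α (2 * n + 1)) hv
      hS0 hS1 (fun x hx => by
        rw [mem_stage, mem_stage]
        by_cases hx' : x = 2 * n
        · subst hx'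
          simp only [hno, false_and, or_false]
        · have : 2 * n + 2 ≤ x ↔ 2 * n ≤ x := by omega
          rw [this]) (by
        rw [mem_stage, mem_stage]
        simp only [hne, false_and, o2n, true_and, false_or, not_and]
        have : ¬ 2 * n + 2 ≤ 2 * n + 1 := by omega
        have h2 : 2 * n ≤ 2 * n + 1 := by omega
        simp only [this, h2, false_and, and_false]
        tauto)
    obtain ⟨b1, b2⟩ := isRun_edgePair (k := 2 * n) (c := α (2 * n)) hv hS1 hS2
      (fun x hx => by simp [hx]) (by
        rw [mem_stage]
        have : 2 * n + 1 < N := by omega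
        simp [e2n, hno, this])
    obtain ⟨c1, c2⟩ := isRun_edgePair (k := 2 * n) (c := β (2 * n)) hv hS2 hS3
      (fun x hx => by
        rw [Finset.mem_insert, mem_stage, mem_stage]
        by_cases hx' : x = 2 * n + 1
        · subst hx'
          simp [hne]
        · have h1 : 2 * n + 2 ≤ x ↔ 2 * n ≤ x := by omega
          have h2 : x < 2 * n + 2 ↔ x < 2 * n := by omega
          simp only [h1, h2, hx, false_or]) (by
        rw [mem_stage]
        have : 2 * n + 1 < N := by omega
        simp [e2n, hno, this])
    have hrun : run (edgeProd v (stage N α β (2 * n) (2 * n))) (deformBlock v N α β n) =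
        edgeProd v (stage N α β (2 * (n + 1)) (2 * (n + 1))) := by
      unfold deformBlock
      rw [run_append, run_append, a2, b2, c2]
      rfl
    refine ⟨ih1.append ?_, hrun⟩
    rw [ih2]
    unfold deformBlock
    refine (a1.append ?_).append ?_
    · rw [a2]
      exact b1
    · rw [run_append, a2, b2]
      exact c1

theorem deform_mem {n : ℕ} {k : ℕ} (hk : k + 1 < N) (hn : N ≤ 2 * n) (h : α k) :
    edgePair v k ∈ deform v N α β n := by
  classical
  unfold deform
  rw [List.mem_flatMap]
  refine ⟨k / 2, List.mem_range.mpr (by omega), ?_⟩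
  unfold deformBlock
  rcases Nat.even_or_odd' k with ⟨j, rfl | rfl⟩
  · rw [Nat.mul_div_cancel_left _ (by norm_num)]
    simp [h]
  · rw [show (2 * j + 1) / 2 = j by omega]
    have : 2 * j + 2 < N := by omega
    simp [h, this]

theorem sum_range_two_mul (f : ℕ → ℕ) (n : ℕ) :
    ∑ k ∈ Finset.range (2 * n), f k = ∑ j ∈ Finset.range n, (f (2 * j) + f (2 * j + 1)) := by
  induction n with
  | zero => rfl
  | succ n ih => rw [Nat.mul_succ, Finset.sum_range_succ, Finset.sum_range_succ, ih,
      Finset.sum_range_succ, add_assoc]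

open Classical in
-- Each letter corresponds to one cut of `α` or of `β`. The target has no cuts at odd edges, and the
-- edge `N - 1` does not exist, hence the conditions on `β` and on `N - 1`.
theorem length_deform {n : ℕ} (hn : N = 2 * n) (hβ : ∀ k, Odd k → k + 1 < N → ¬ β k)
    (hN : ¬ α (N - 1)) (hN' : ¬ β (N - 1)) (hn0 : 0 < n) : (deform v N α β n).length =
      ((Finset.range (N - 1)).filter α).card + ((Finset.range (N - 1)).filter β).card := by
  have h1 : ∀ δ : ℕ → Prop, ¬ δ (N - 1) → ((Finset.range (N - 1)).filter δ).card =
      ∑ k ∈ Finset.range (2 * n), if δ k then 1 else 0 := by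
    intro δ hδ
    rw [Finset.card_filter, show 2 * n = N - 1 + 1 by omega, Finset.sum_range_succ, if_neg hδ,
      add_zero]
  rw [h1 α hN, h1 β hN', sum_range_two_mul, sum_range_two_mul, ← Finset.sum_add_distrib]
  unfold deform
  rw [List.length_flatMap, Finset.sum_eq_multiset_sum]
  change ((List.range n).map _).sum = ((List.range n).map _).sum
  congr 1
  refine List.map_congr_left fun j hj => ?_
  rw [List.mem_range] at hj
  unfold deformBlock
  rw [List.length_append, List.length_append]
  have hb : ¬ β (2 * j + 1) := by
    by_cases h : 2 * j + 1 + 1 < N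
    · exact hβ _ (odd_two_mul_add_one j) h
    · rwa [show 2 * j + 1 = N - 1 by omega]
  have ha : (2 * j + 2 < N ∧ α (2 * j + 1)) ↔ α (2 * j + 1) := by
    refine ⟨fun h => h.2, fun h => ⟨?_, h⟩⟩
    by_contra hlt
    rw [show 2 * j + 1 = N - 1 by omega] at h
    exact hN h
  rw [if_neg hb]
  simp only [ha]
  split_ifs <;> simp

end Deform

/-- The number of inner partial sums of a composition. -/
theorem card_filter_isPartialSum {N : ℕ} (hN : 0 < N) (c : Composition N)
    [DecidablePred fun k => IsPartialSum c (k + 1)] :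
    ((Finset.range (N - 1)).filter fun k => IsPartialSum c (k + 1)).card + 1 = c.length := by
  have hlen : 0 < c.length := c.length_pos_of_pos hN
  have : ((Finset.range (N - 1)).filter fun k => IsPartialSum c (k + 1)) =
      (Finset.Ico 1 c.length).image fun i => c.sizeUpTo i - 1 := by
    ext k
    simp only [Finset.mem_filter, Finset.mem_range, Finset.mem_image, Finset.mem_Ico]
    constructor
    · rintro ⟨hk, i, hi, hik⟩
      refine ⟨i, ⟨?_, ?_⟩, by omega⟩
      · by_contra h
        rw [show i = 0 by omega, c.sizeUpTo_zero] at hik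
        omega
      · refine lt_of_le_of_ne hi fun h => ?_
        rw [h, c.sizeUpTo_length] at hik
        omega
    · rintro ⟨i, ⟨h1, h2⟩, rfl⟩
      have h3 := c.sizeUpTo_strict_mono (i := i - 1) (by omega)
      rw [show i - 1 + 1 = i by omega] at h3
      have h4 := c.sizeUpTo_strict_mono h2
      have h5 := c.sizeUpTo_le (i + 1)
      exact ⟨by omega, i, h2.le, by omega⟩
  rw [this, Finset.card_image_of_injOn, Nat.card_Ico]
  · omega
  · have hmono : ∀ i j, 1 ≤ i → i < j → j < c.length → c.sizeUpTo i - 1 < c.sizeUpTo j - 1 := by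
      intro i j h1 h2 h3
      have h4 := c.sizeUpTo_strict_mono (i := i - 1) (by omega)
      rw [show i - 1 + 1 = i by omega] at h4
      have h5 := c.sizeUpTo_strict_mono (i := i) (by omega)
      have h6 := c.monotone_sizeUpTo (show i + 1 ≤ j by omega)
      omega
    intro i hi j hj hij
    simp only [Finset.coe_Ico, Set.mem_Ico] at hi hj
    rcases lt_trichotomy i j with h | h | h
    · exact absurd hij (hmono i j hi.1 h hj.2).ne
    · exact h
    · exact absurd hij (hmono j i hj.1 h hi.2).ne'

end RealMonotoneHurwitz

namespace RealMonotoneHurwitz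

open Equiv

/-! ### Real monotone factorizations supported on a path -/

/-- A sequence of transpositions among the points `v 0, …, v (N - 1)` that leads from the pair of
involutions `ρ, γ` with product of cycle type `A` to a pair with product of cycle type `B`. -/
structure IsPathRun {V : Type*} [Fintype V] [LinearOrder V] (v : ℕ → V) (N : ℕ) (A B : Multiset ℕ)
    (ρ γ : Perm V) (l : List (V × V)) : Prop where
  isRun : IsRun ρ l
  mul_self : γ * γ = 1
  monotone : IsMonotoneList l
  mem : ∀ p ∈ l, p.1 ∈ v '' Set.Iio N ∧ p.2 ∈ v '' Set.Iio N
  length : l.length + 2 = Multiset.card A + Multiset.card B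
  type_left : (ρ * γ).partition.parts = A + Multiset.replicate (Fintype.card V - N) 1
  type_right : (run ρ l * γ).partition.parts = B + Multiset.replicate (Fintype.card V - N) 1
  fixed : ∀ w ∉ v '' Set.Iio N, ρ w = w ∧ γ w = w
  exists_fixed_left : ∃ w ∈ v '' Set.Iio N, γ w = w
  exists_fixed_right : ∃ w ∈ v '' Set.Iio N, run ρ l w = w
  connected : ∀ r : Setoid V, (∀ x, r x ((ρ * γ) x)) → (∀ p ∈ l, r p.1 p.2) →
    ∀ w ∈ v '' Set.Iio N, r (v 0) w

section

variable {V : Type*} {v : ℕ → V} {N : ℕ}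

/-- All transpositions of a block share the vertex in odd position between its two edges. Once these
vertices carry the larger labels, monotonicity only asks that they increase along the path. -/
theorem deformBlock_snd {α β : ℕ → Prop} {j : ℕ} {p : V × V} (hp : p ∈ deformBlock v N α β j) :
    p.2 = v (2 * j + 1) := by
  rcases mem_deformBlock hp with rfl | ⟨-, rfl⟩ <;> simp [edgePair]

theorem isMonotoneList_deform [LinearOrder V] {α β : ℕ → Prop}
    (hlt : ∀ j, 2 * j + 1 < N → v (2 * j) < v (2 * j + 1))
    (hgt : ∀ j, 2 * j + 2 < N → v (2 * j + 2) < v (2 * j + 1))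
    (hmono : ∀ i j, i ≤ j → 2 * j + 1 < N → v (2 * i + 1) ≤ v (2 * j + 1)) {n : ℕ}
    (hn : 2 * n ≤ N) : IsMonotoneList (deform v N α β n) := by
  induction n with
  | zero => exact ⟨fun p hp => by simp [deform] at hp, List.Pairwise.nil⟩
  | succ n ih =>
    rw [deform_succ]
    refine (ih (by omega)).append ⟨fun p hp => ?_, ?_⟩ fun p hp q hq => ?_
    · rcases mem_deformBlock hp with rfl | ⟨h, rfl⟩
      · simpa [edgePair] using hlt n (by omega)
      · simpa [edgePair] using hgt n h
    · refine List.pairwise_of_forall_mem_list fun p hp q hq => ?_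
      rw [deformBlock_snd hp, deformBlock_snd hq]
    · unfold deform at hp
      obtain ⟨j, hj, hp⟩ := List.mem_flatMap.mp hp
      rw [List.mem_range] at hj
      rw [deformBlock_snd hp, deformBlock_snd hq]
      exact hmono j n hj.le (by omega)

theorem deform_subset {α β : ℕ → Prop} {n : ℕ} (hn : 2 * n ≤ N) {p : V × V}
    (hp : p ∈ deform v N α β n) : p.1 ∈ v '' Set.Iio N ∧ p.2 ∈ v '' Set.Iio N := by
  unfold deform at hp
  obtain ⟨j, hj, hp⟩ := List.mem_flatMap.mp hp
  rw [List.mem_range] at hj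
  have hm : ∀ x, x < N → v x ∈ v '' Set.Iio N := fun x hx => ⟨x, hx, rfl⟩
  rcases mem_deformBlock hp with rfl | ⟨h, rfl⟩
  · simp only [edgePair, even_two_mul, if_true]
    exact ⟨hm _ (by omega), hm _ (by omega)⟩
  · simp only [edgePair, Nat.not_even_bit1, if_false]
    exact ⟨hm _ h, hm _ (by omega)⟩

end

theorem setoid_le_of_forall {V : Type*} [Finite V] {σ : Perm V} {r : Setoid V}
    (h : ∀ x, r x (σ x)) : Perm.SameCycle.setoid σ ≤ r := by
  intro x y hxy
  obtain ⟨n, hn⟩ := Perm.SameCycle.exists_nat_pow_eq hxy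
  rw [← hn]
  clear hn hxy
  induction n with
  | zero => exact r.refl x
  | succ n ih => rw [pow_succ', Perm.mul_apply]; exact r.trans ih (h _)

/-- Take for `γ` the product of all odd edges, and for `ρ` the product of the even edges not cut by
`a` and the odd edges cut by `a`. The latter cancel in `ρ * γ`, which leaves exactly the uncut edges
of `a`. The deformation turns `ρ` into the product of the even edges not cut by `b`; as `b` cuts no
odd edge, the product with `γ` has type `b`. -/
theorem exists_isPathRun_of_composition {V : Type*} [Fintype V] [LinearOrder V] {v : ℕ → V}
    {N n : ℕ} (hN : N = 2 * n) (hn : 0 < n) (hv : Set.InjOn v (Set.Iio N))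
    (hlt : ∀ j, 2 * j + 1 < N → v (2 * j) < v (2 * j + 1))
    (hgt : ∀ j, 2 * j + 2 < N → v (2 * j + 2) < v (2 * j + 1))
    (hmono : ∀ i j, i ≤ j → 2 * j + 1 < N → v (2 * i + 1) ≤ v (2 * j + 1))
    (a b : Composition N) (hb1 : 1 < b.length)
    (ha : ∀ x, Even x → 0 < x → x < N → IsPartialSum a x →
      IsPartialSum a (x - 1) ∧ IsPartialSum a (x + 1))
    (hb : ∀ x, Even x → 0 < x → x < N → ¬ IsPartialSum b x) :
    ∃ ρ γ l, IsPathRun v N (a.blocks : Multiset ℕ) (b.blocks : Multiset ℕ) ρ γ l := by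
  classical
  let α : ℕ → Prop := fun k => k + 1 < N ∧ IsPartialSum a (k + 1)
  let β : ℕ → Prop := fun k => k + 1 < N ∧ IsPartialSum b (k + 1)
  have hα : ∀ k, Odd k → k + 1 < N → α k → α (k - 1) ∧ α (k + 1) := by
    rintro k hk hkN ⟨-, h⟩
    have h2 := ha (k + 1) (by simpa [Nat.even_add_one] using hk) (by omega) hkN h
    have h3 : k + 2 < N := by
      rcases hk with ⟨j, hj⟩
      omega
    refine ⟨⟨by omega, ?_⟩, h3, h2.2⟩
    rw [show k - 1 + 1 = k + 1 - 1 by have := hk.pos; omega]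
    exact h2.1
  have hβ : ∀ k, Odd k → k + 1 < N → ¬ β k := fun k hk hkN h =>
    hb (k + 1) (by simpa [Nat.even_add_one] using hk) (by omega) hkN h.2
  obtain ⟨r1, r2⟩ := isRun_deform (β := β) hv hα (n := n) hN.ge
  set O := (Finset.range (N - 1)).filter Odd with hO
  have hmemO : ∀ k, k ∈ O ↔ k + 1 < N ∧ Odd k := by
    intro k
    rw [hO, Finset.mem_filter, Finset.mem_range, Nat.lt_sub_iff_add_lt]
  have hOm : IsPathMatching N O := by
    intro k hk
    rw [hmemO] at hk
    refine ⟨hk.1, fun h => ?_⟩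
    rw [hmemO, Nat.odd_add_one] at h
    exact h.2 hk.2
  set γ := edgeProd v O with hγ
  set E := (stage N α β 0 0).filter Even with hE
  set C := (stage N α β 0 0).filter Odd with hC
  have hs0 : stage N α β 0 0 = E ∪ C := by
    rw [hE, hC, ← Finset.filter_or, Finset.filter_true_of_mem]
    exact fun k _ => Nat.even_or_odd k
  have hdEC : Disjoint E C := by
    rw [hE, hC, Finset.disjoint_filter]
    exact fun k _ h h' => Nat.not_even_iff_odd.mpr h' h
  have hm0 : IsPathMatching N (stage N α β 0 0) := isPathMatching_stage hα (by simp) le_rfl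
  have hCO : C ⊆ O := by
    intro k hk
    rw [hC, Finset.mem_filter, mem_stage] at hk
    exact (hmemO k).mpr ⟨hk.1.1, hk.2⟩
  have hγ' : γ = edgeProd v C * edgeProd v (O \ C) := by
    rw [← edgeProd_union hv Finset.disjoint_sdiff]
    · rw [Finset.union_sdiff_of_subset hCO]
    · rwa [Finset.union_sdiff_of_subset hCO]
  have hCm : IsPathMatching N C := hOm.subset hCO
  -- The cut odd edges `C` occur in both factors and cancel.
  have hP0 : edgeProd v (stage N α β 0 0) * γ =
      ((E.toList ++ (O \ C).toList).map (edgeSwap v)).prod := by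
    rw [hs0, edgeProd_union hv hdEC (by rwa [← hs0]), hγ', mul_assoc, ← mul_assoc (edgeProd v C),
      edgeProd_mul_self hv hCm, one_mul, List.map_append, List.prod_append]
    rfl
  have hmemE : ∀ k, k ∈ E.toList ++ (O \ C).toList ↔ k + 1 < N ∧ ¬ IsPartialSum a (k + 1) := by
    intro k
    rw [List.mem_append, Finset.mem_toList, Finset.mem_toList, Finset.mem_sdiff, hmemO, hE, hC,
      Finset.mem_filter, Finset.mem_filter, mem_stage]
    have hα' : k + 1 < N → (α k ↔ IsPartialSum a (k + 1)) := fun h => by simp [α, h]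
    rcases Nat.even_or_odd k with h | h
    · have h' := Nat.not_odd_iff_even.mpr h
      simp only [h, h', Nat.not_lt_zero, zero_le]
      constructor
      · rintro (h1 | h1)
        · refine ⟨h1.1.1, ?_⟩
          rw [← hα' h1.1.1]
          simpa using h1.1.2
        · exact absurd h1.1.2 id
      · rintro ⟨h1, h2⟩
        rw [← hα' h1] at h2
        simp [h1, h2]
    · have h' := Nat.not_even_iff_odd.mpr h
      simp only [h, h', Nat.not_lt_zero, zero_le]
      constructor
      · rintro (h1 | h1)
        · exact absurd h1.2 id
        · refine ⟨h1.1.1, ?_⟩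
          rw [← hα' h1.1.1]
          intro h2
          exact h1.2 ⟨⟨h1.1.1, by simp [h2]⟩, trivial⟩
      · rintro ⟨h1, h2⟩
        rw [← hα' h1] at h2
        simp [h1, h2]
  have hndE : (E.toList ++ (O \ C).toList).Nodup := by
    refine List.Nodup.append (Finset.nodup_toList _) (Finset.nodup_toList _) ?_
    intro k hk hk'
    rw [Finset.mem_toList] at hk hk'
    rw [hE, Finset.mem_filter] at hk
    rw [Finset.mem_sdiff, hmemO] at hk'
    exact Nat.not_even_iff_odd.mpr hk'.1.2 hk.2
  set F := stage N α β (2 * n) (2 * n) with hF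
  have hmemF : ∀ k, k ∈ F ↔ k + 1 < N ∧ Even k ∧ ¬ IsPartialSum b (k + 1) := by
    intro k
    rw [hF, mem_stage]
    constructor
    · rintro ⟨h, h1 | h1 | h1⟩
      · exact ⟨h, h1.1, fun h2 => h1.2.2 ⟨h, h2⟩⟩
      · omega
      · omega
    · rintro ⟨h, h1, h2⟩
      exact ⟨h, Or.inl ⟨h1, by omega, fun h3 => h2 h3.2⟩⟩
  have hP1 : edgeProd v F * γ = ((F.toList ++ O.toList).map (edgeSwap v)).prod := by
    rw [List.map_append, List.prod_append]
    rfl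
  have hmemFO : ∀ k, k ∈ F.toList ++ O.toList ↔ k + 1 < N ∧ ¬ IsPartialSum b (k + 1) := by
    intro k
    rw [List.mem_append, Finset.mem_toList, Finset.mem_toList, hmemF, hmemO]
    rcases Nat.even_or_odd k with h | h
    · have h' := Nat.not_odd_iff_even.mpr h
      tauto
    · have h' := Nat.not_even_iff_odd.mpr h
      have := fun hk => hb (k + 1) (by simpa [Nat.even_add_one] using h) (by omega) hk
      tauto
  have hndF : (F.toList ++ O.toList).Nodup := by
    refine List.Nodup.append (Finset.nodup_toList _) (Finset.nodup_toList _) ?_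
    intro k hk hk'
    rw [Finset.mem_toList] at hk hk'
    exact Nat.not_even_iff_odd.mpr ((hmemO k).mp hk').2 ((hmemF k).mp hk).2.1
  have hfix : ∀ M : Finset ℕ, IsPathMatching N M → ∀ w ∉ v '' Set.Iio N, edgeProd v M w = w := by
    intro M hM w hw
    refine edgeProd_apply_of_ne fun k hk => ?_
    have := (hM k hk).1
    exact ⟨fun h => hw ⟨k, by simp; omega, h.symm⟩, fun h => hw ⟨k + 1, this, h.symm⟩⟩
  have hne : ∀ {x y : ℕ}, x < N → y < N → x ≠ y → v x ≠ v y := fun hx hy hxy h =>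
    hxy (hv hx hy h)
  refine ⟨edgeProd v (stage N α β 0 0), γ, deform v N α β n, r1, edgeProd_mul_self hv hOm,
    isMonotoneList_deform hlt hgt hmono hN.ge, fun p hp => deform_subset hN.ge hp, ?_, ?_, ?_,
    fun w hw => ⟨hfix _ hm0 w hw, hfix _ hOm w hw⟩, ⟨v 0, ⟨0, by simp; omega, rfl⟩, ?_⟩, ?_, ?_⟩
  · have hN1 : ∀ c : Composition N, ¬ (N - 1 + 1 < N ∧ IsPartialSum c (N - 1 + 1)) :=
      fun c h => by omega
    rw [length_deform hN hβ (hN1 a) (hN1 b) hn]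
    have h3 : ∀ (c : Composition N) (inst : DecidablePred fun k => k + 1 < N ∧
        IsPartialSum c (k + 1)), (@Finset.filter _ (fun k => k + 1 < N ∧
          IsPartialSum c (k + 1)) inst (Finset.range (N - 1))).card + 1 = c.length := by
      intro c inst
      rw [← card_filter_isPartialSum (by omega) c]
      congr 2
      refine Finset.filter_congr fun k hk => ?_
      rw [Finset.mem_range] at hk
      exact and_iff_right (by omega)
    rw [Multiset.coe_card, Multiset.coe_card, a.blocks_length, b.blocks_length,
      ← h3 a fun k => Classical.propDecidable _, ← h3 b fun k => Classical.propDecidable _]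
    exact (by omega : ∀ x y : ℕ, x + y + 2 = x + 1 + (y + 1)) _ _
  · rw [hP0]
    exact partition_prod_edgeSwap hv hndE (fun k hk => ((hmemE k).mp hk).1) a
      (fun k hk => by rw [hmemE, and_iff_right hk])
  · rw [r2, hP1]
    exact partition_prod_edgeSwap hv hndF (fun k hk => ((hmemFO k).mp hk).1) b
      (fun k hk => by rw [hmemFO, and_iff_right hk])
  -- The start of the path lies only on the even edge `0`, so no odd edge moves it.
  · refine edgeProd_apply_of_ne fun k hk => ?_
    have hk' := (hmemO k).mp hk
    have := hk'.2.pos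
    exact ⟨hne (by omega) (by omega) (by omega), hne (by omega) (by omega) (by omega)⟩
  -- The fixed point sits just before the first cut of `b`. Its right edge is cut and its left edge
  -- is odd, so neither is in the final matching; `1 < b.length` provides this inner cut.
  · have h1 := b.sizeUpTo_strict_mono (i := 0) (by omega)
    have h2 := b.sizeUpTo_strict_mono (i := 1) hb1
    have h3 := b.sizeUpTo_le 2
    rw [b.sizeUpTo_zero] at h1
    norm_num at h1 h2
    obtain ⟨k, hk⟩ : ∃ k, b.sizeUpTo 1 = k + 1 := ⟨b.sizeUpTo 1 - 1, by omega⟩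
    have hkb : IsPartialSum b (k + 1) := ⟨1, hb1.le, hk⟩
    have hkN : k + 1 < N := by omega
    have hke : Even k := by
      by_contra h
      exact hb (k + 1) (by simpa [Nat.even_add_one] using h) (by omega) hkN hkb
    refine ⟨v k, ⟨k, by simp; omega, rfl⟩, ?_⟩
    rw [r2]
    refine edgeProd_apply_of_ne fun j hj => ?_
    have hj' := (hmemF j).mp hj
    refine ⟨hne (by omega) (by omega) ?_, hne (by omega) (by omega) ?_⟩
    · rintro rfl
      exact hj'.2.2 hkb
    · rintro rfl
      rw [Nat.even_add_one] at hke
      exact hke hj'.2.1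
  · intro r hr hl
    -- A cut edge of `a` occurs as a transposition of the deformation; an uncut one lies inside a
    -- cycle of `ρ * γ`.
    have hstep : ∀ k, k + 1 < N → r (v k) (v (k + 1)) := by
      intro k hk
      by_cases h : α k
      · have := hl _ (deform_mem (v := v) (β := β) hk hN.le h)
        unfold edgePair at this
        split_ifs at this
        · exact this
        · exact r.symm this
      · refine setoid_le_of_forall hr ?_
        rw [hP0]
        refine (sameCycle_prod_edgeSwap hv hndE (fun k hk => ((hmemE k).mp hk).1)
          (by omega) hk).mpr fun j hj => ?_
        rw [show j = k by omega, hmemE]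
        exact ⟨hk, fun h' => h ⟨hk, h'⟩⟩
    rintro w ⟨x, hx, rfl⟩
    simp only [Set.mem_Iio] at hx
    induction x with
    | zero => exact r.refl _
    | succ x ih => exact r.trans (ih (by omega)) (hstep x hx)

/-- The composition of `N` with the given blocks. -/
theorem exists_composition {N : ℕ} (L : List ℕ) (hL : ∀ k ∈ L, 0 < k) (hs : L.sum = N) :
    ∃ c : Composition N, c.blocks = L := ⟨⟨L, fun {i} hi => hL i hi, hs⟩, rfl⟩

theorem isPartialSum_iff {N : ℕ} (c : Composition N) (x : ℕ) :
    IsPartialSum c x ↔ ∃ i, (c.blocks.take i).sum = x := by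
  constructor
  · rintro ⟨i, -, h⟩
    exact ⟨i, h⟩
  · rintro ⟨i, h⟩
    rcases le_total i c.length with hi | hi
    · exact ⟨i, hi, h⟩
    · refine ⟨c.length, le_rfl, ?_⟩
      rw [← h, c.sizeUpTo_length, List.take_of_length_le hi, c.blocks_sum]

theorem even_sum_take {L : List ℕ} (h : ∀ k ∈ L, Even k) (i : ℕ) : Even (L.take i).sum := by
  induction L generalizing i with
  | nil => simp
  | cons k L ih =>
    cases i with
    | zero => simp
    | succ i =>
      rw [List.take_succ_cons, List.sum_cons]
      exact (h k List.mem_cons_self).add (ih (fun j hj => h j (List.mem_cons_of_mem _ hj)) i)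

/-- The even inner partial sums of an odd part, then `t` ones, even parts, and an odd part. -/
theorem isPartialSum_even {N p q t : ℕ} {E : List ℕ} (c : Composition N)
    (hc : c.blocks = p :: (List.replicate (2 * t) 1 ++ E ++ [q])) (hp : Odd p)
    (hE : ∀ k ∈ E, Even k) :
    (∀ j ≤ 2 * t, IsPartialSum c (p + j)) ∧
    (∀ x, Even x → 0 < x → x < N → IsPartialSum c x → ∃ j, Odd j ∧ j < 2 * t ∧ x = p + j) := by
  have hsum := c.blocks_sum
  constructor
  · intro j hj
    rw [isPartialSum_iff, hc]
    refine ⟨j + 1, ?_⟩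
    rw [List.take_succ_cons, List.sum_cons, List.append_assoc,
      List.take_append_of_le_length (by simpa using hj), List.take_replicate, List.sum_replicate,
      min_eq_left hj, smul_eq_mul, mul_one]
  · intro x hx hx0 hxN h
    rw [isPartialSum_iff, hc] at h
    obtain ⟨i, hi⟩ := h
    cases i with
    | zero => simp at hi; omega
    | succ i =>
      rw [List.take_succ_cons, List.sum_cons] at hi
      rcases Nat.lt_or_ge i (2 * t) with h | h
      · rw [List.append_assoc, List.take_append_of_le_length (by simpa using h.le),
          List.take_replicate, List.sum_replicate, min_eq_left h.le, smul_eq_mul, mul_one] at hi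
        refine ⟨i, ?_, h, hi.symm⟩
        rw [← hi, Nat.even_add] at hx
        by_contra hodd
        rw [Nat.not_odd_iff_even] at hodd
        exact Nat.not_even_iff_odd.mpr hp (hx.mpr hodd)
      · rw [List.append_assoc, List.take_append, List.take_of_length_le (by simpa using h),
          List.length_replicate, List.sum_append, List.sum_replicate, smul_eq_mul, mul_one] at hi
        rcases Nat.lt_or_ge E.length (i - 2 * t) with h' | h'
        · rw [List.take_of_length_le (by simp; omega)] at hi
          rw [hc, List.sum_cons, List.append_assoc, List.sum_append, List.sum_replicate, smul_eq_mul,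
            mul_one] at hsum
          omega
        · rw [List.take_append_of_le_length h'] at hi
          -- Past the ones, a partial sum is an odd number plus `2 * t` plus even parts, hence odd.
          have h1 := even_sum_take hE (i - 2 * t)
          have : Even p := by
            rw [← hi] at hx
            have h2 : Even (2 * t + (List.take (i - 2 * t) E).sum) := (even_two_mul t).add h1
            exact (Nat.even_add.mp hx).mpr h2
          exact absurd hp (Nat.not_odd_iff_even.mpr this)

/-- The order of the blocks is chosen to meet the parity conditions: an odd part at each end, the
ones directly after the first. On the source side even inner partial sums then occur only strictly
among the ones, where both neighbours are partial sums too; on the target side there are none. -/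
theorem exists_isPathRun {V : Type*} [Fintype V] [LinearOrder V] {v : ℕ → V}
    {N : ℕ} (hv : Set.InjOn v (Set.Iio N))
    (hlt : ∀ j, 2 * j + 1 < N → v (2 * j) < v (2 * j + 1))
    (hgt : ∀ j, 2 * j + 2 < N → v (2 * j + 2) < v (2 * j + 1))
    (hmono : ∀ i j, i ≤ j → 2 * j + 1 < N → v (2 * i + 1) ≤ v (2 * j + 1))
    {p₁ p₂ q₁ q₂ t : ℕ} {E F : Multiset ℕ} (hp₁ : Odd p₁) (hp₂ : Odd p₂) (hq₁ : Odd q₁)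
    (hq₂ : Odd q₂) (hE : ∀ k ∈ E, Even k ∧ 0 < k) (hF : ∀ k ∈ F, Even k ∧ 0 < k)
    (hsumA : p₁ + p₂ + 2 * t + E.sum = N) (hsumB : q₁ + q₂ + F.sum = N) :
    ∃ ρ γ l, IsPathRun v N ({p₁, p₂} + Multiset.replicate (2 * t) 1 + E) ({q₁, q₂} + F) ρ γ l := by
  have hLE : (E.toList : Multiset ℕ) = E := E.coe_toList
  have hLF : (F.toList : Multiset ℕ) = F := F.coe_toList
  have hE' : ∀ k ∈ E.toList, Even k ∧ 0 < k := fun k hk => hE k (Multiset.mem_toList.mp hk)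
  have hF' : ∀ k ∈ F.toList, Even k ∧ 0 < k := fun k hk => hF k (Multiset.mem_toList.mp hk)
  have hsE : E.toList.sum = E.sum := by rw [← Multiset.sum_coe, hLE]
  have hsF : F.toList.sum = F.sum := by rw [← Multiset.sum_coe, hLF]
  obtain ⟨a, ha⟩ := exists_composition (N := N)
    (p₁ :: (List.replicate (2 * t) 1 ++ E.toList ++ [p₂])) (by
      intro k hk
      simp only [List.mem_cons, List.mem_append, List.mem_replicate, List.not_mem_nil,
        or_false] at hk
      rcases hk with rfl | (⟨-, rfl⟩ | hk) | rfl
      · exact hp₁.pos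
      · exact Nat.one_pos
      · exact (hE' k hk).2
      · exact hp₂.pos) (by simp [hsE]; omega)
  obtain ⟨b, hb⟩ := exists_composition (N := N)
    (q₁ :: (List.replicate (2 * 0) 1 ++ F.toList ++ [q₂])) (by
      intro k hk
      simp only [mul_zero, List.replicate_zero, List.nil_append, List.mem_cons, List.mem_append,
        List.not_mem_nil, or_false] at hk
      rcases hk with rfl | hk | rfl
      · exact hq₁.pos
      · exact (hF' k hk).2
      · exact hq₂.pos) (by simp [hsF]; omega)
  have ha' := isPartialSum_even a ha hp₁ fun k hk => (hE' k hk).1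
  have hb' := isPartialSum_even b hb hq₁ fun k hk => (hF' k hk).1
  have hEven : Even N := by
    rw [← hsumB]
    have : Even F.sum := by
      rw [← hsF, ← List.take_length (l := F.toList)]
      exact even_sum_take (fun k hk => (hF' k hk).1) _
    exact (hq₁.add_odd hq₂).add this
  obtain ⟨n, hn⟩ := hEven
  have h0 := hq₁.pos
  obtain ⟨ρ, γ, l, h⟩ := exists_isPathRun_of_composition (n := n) (by omega) (by omega) hv hlt hgt
    hmono a b (by rw [← b.blocks_length, hb]; simp) (by
      intro x h1 h2 h3 h4
      -- Since `j` is odd and below `2 * t`, both `j - 1` and `j + 1` lie in `[0, 2 * t]`.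
      obtain ⟨j, ⟨i, hi⟩, hj', rfl⟩ := ha'.2 x h1 h2 h3 h4
      refine ⟨?_, ha'.1 (j + 1) hj'⟩
      rw [show p₁ + j - 1 = p₁ + (j - 1) by omega]
      exact ha'.1 _ (by omega)) (by
      intro x h1 h2 h3 h4
      obtain ⟨j, -, hj', -⟩ := hb'.2 x h1 h2 h3 h4
      omega)
  refine ⟨ρ, γ, l, ?_⟩
  have e1 : (a.blocks : Multiset ℕ) = {p₁, p₂} + Multiset.replicate (2 * t) 1 + E := by
    rw [ha, ← Multiset.cons_coe, ← Multiset.coe_add, ← Multiset.coe_add, Multiset.coe_replicate,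
      hLE]
    change p₁ ::ₘ (_ + _ + {p₂}) = (p₁ ::ₘ {p₂}) + _ + _
    rw [Multiset.cons_add, Multiset.cons_add]
    congr 1
    rw [add_comm, add_assoc]
  have e2 : (b.blocks : Multiset ℕ) = {q₁, q₂} + F := by
    rw [hb, mul_zero, List.replicate_zero, List.nil_append, ← Multiset.cons_coe,
      ← Multiset.coe_add, hLF]
    change q₁ ::ₘ (_ + {q₂}) = (q₁ ::ₘ {q₂}) + _
    rw [Multiset.cons_add]
    congr 1
    rw [add_comm]
  rwa [e1, e2] at h

end RealMonotoneHurwitz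

namespace RealMonotoneHurwitz

open Equiv

/-! ### Leaves attached by doubled transpositions -/

section Leaves

variable {V : Type*}

/-- The transpositions that join `ℓ j` to `ℓ (a j)` for the `k` indices `j` from `x` on. -/
def leaves (ℓ : ℕ → V) (a : ℕ → ℕ) (x k : ℕ) : List (V × V) :=
  (List.range' x k).map fun j => (ℓ (a j), ℓ j)

theorem mem_leaves {ℓ : ℕ → V} {a : ℕ → ℕ} {x k : ℕ} {p : V × V} :
    p ∈ leaves ℓ a x k ↔ ∃ j, (x ≤ j ∧ j < x + k) ∧ (ℓ (a j), ℓ j) = p := by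
  simp [leaves, List.mem_range'_1]

theorem leaves_append (ℓ : ℕ → V) (a : ℕ → ℕ) (x k k' : ℕ) :
    leaves ℓ a x k ++ leaves ℓ a (x + k) k' = leaves ℓ a x (k + k') := by
  unfold leaves
  rw [← List.map_append, List.range'_append_1]

theorem length_leaves (ℓ : ℕ → V) (a : ℕ → ℕ) (x k : ℕ) : (leaves ℓ a x k).length = k := by
  simp [leaves]

theorem eq_of_leaves_eq {ℓ : ℕ → V} {M : ℕ} (hℓ : Set.InjOn ℓ (Set.Iio M)) {a a' : ℕ → ℕ}
    {x k : ℕ} (ha : ∀ j, x ≤ j → j < x + k → a j < M) (ha' : ∀ j, x ≤ j → j < x + k → a' j < M)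
    (h : leaves ℓ a x k = leaves ℓ a' x k) {j : ℕ} (h1 : x ≤ j) (h2 : j < x + k) :
    a j = a' j := by
  unfold leaves at h
  rw [List.map_inj_left] at h
  exact hℓ (ha j h1 h2) (ha' j h1 h2)
    (Prod.ext_iff.mp (h j (List.mem_range'_1.mpr ⟨h1, h2⟩))).1

theorem isMonotoneList_leaves [LinearOrder V] {ℓ : ℕ → V} {M : ℕ}
    (hℓ : StrictMonoOn ℓ (Set.Iio M)) {a : ℕ → ℕ} {x k : ℕ}
    (ha : ∀ j, x ≤ j → j < x + k → a j < j) (hM : x + k ≤ M) :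
    IsMonotoneList (leaves ℓ a x k) := by
  constructor
  · intro p hp
    obtain ⟨j, ⟨h1, h2⟩, rfl⟩ := mem_leaves.mp hp
    have := ha j h1 h2
    exact hℓ (show a j < M by omega) (show j < M by omega) this
  · unfold leaves
    rw [List.pairwise_map]
    refine (List.pairwise_lt_range' (s := x) (n := k)).imp_of_mem fun {i j} hi hj hij => ?_
    rw [List.mem_range'_1] at hi hj
    exact (hℓ (show i < M by omega) (show j < M by omega) hij).le

theorem isMonotoneList_replicate [LinearOrder V] {p : V × V} (hp : p.1 < p.2) (k : ℕ) :
    IsMonotoneList (List.replicate k p) := by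
  refine ⟨fun q hq => ?_, List.pairwise_of_forall_mem_list fun q hq q' hq' => ?_⟩
  · rw [List.eq_of_mem_replicate hq]
    exact hp
  · rw [List.eq_of_mem_replicate hq, List.eq_of_mem_replicate hq']

variable [DecidableEq V]

theorem run_apply_of_fixed {ρ : Perm V} {l : List (V × V)} {w : V} (hw : ρ w = w)
    (hl : ∀ p ∈ l, w ≠ p.1 ∧ w ≠ p.2) : run ρ l w = w := by
  induction l generalizing ρ with
  | nil => exact hw
  | cons p l ih =>
    refine ih ?_ fun q hq => hl q (List.mem_cons_of_mem _ hq)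
    have := hl p List.mem_cons_self
    rw [Perm.mul_apply, hw, swap_apply_of_ne_of_ne this.1 this.2]

end Leaves

section Labels

/-- The point with label `x`. -/
def pt (D : ℕ) [NeZero D] (x : ℕ) : Fin D := Fin.ofNat D x

variable {D : ℕ} [NeZero D]

theorem val_pt {x : ℕ} (hx : x < D) : (pt D x : ℕ) = x := Nat.mod_eq_of_lt hx

theorem pt_lt_pt {x y : ℕ} (hxy : x < y) (hy : y < D) : pt D x < pt D y := by
  rw [Fin.lt_def, val_pt (hxy.trans hy), val_pt hy]
  exact hxy

theorem pt_val (x : Fin D) : pt D x = x := Fin.ext (val_pt x.2)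

theorem pt_ne_pt {x y : ℕ} (hx : x < D) (hy : y < D) (h : x ≠ y) : pt D x ≠ pt D y := by
  intro h'
  rw [Fin.ext_iff, val_pt hx, val_pt hy] at h'
  exact h h'

/-- The reordering `0, 2, 1, 4, 3, …, N - 1` of the labels along a path. -/
def zigzag (N x : ℕ) : ℕ := if x = 0 then 0 else if x = N - 1 then N - 1 else
  if x % 2 = 1 then x + 1 else x - 1

theorem zigzag_cases (N x : ℕ) : (x = 0 ∧ zigzag N x = 0) ∨ (x ≠ 0 ∧ x = N - 1 ∧ zigzag N x = x) ∨
    (x ≠ N - 1 ∧ x % 2 = 1 ∧ zigzag N x = x + 1) ∨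
      (x ≠ 0 ∧ x ≠ N - 1 ∧ x % 2 = 0 ∧ zigzag N x = x - 1) := by
  unfold zigzag
  by_cases h0 : x = 0
  · simp [h0]
  by_cases h1 : x = N - 1
  · simp [← h1, h0]
  rcases Nat.mod_two_eq_zero_or_one x with h2 | h2 <;> simp [h0, h1, h2]

theorem zigzag_lt {N x : ℕ} (hN : N % 2 = 0) (hx : x < N) : zigzag N x < N := by
  have := zigzag_cases N x
  omega

theorem zigzag_zigzag {N x : ℕ} (hN : N % 2 = 0) (hx : x < N) : zigzag N (zigzag N x) = x := by
  have h1 := zigzag_cases N x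
  have h2 := zigzag_cases N (zigzag N x)
  omega

theorem image_pt_zigzag {N o : ℕ} (hN : N % 2 = 0) (ho : o + N ≤ D) (y : Fin D) :
    y ∈ (fun x => pt D (o + zigzag N x)) '' Set.Iio N ↔ o ≤ y ∧ y < o + N := by
  constructor
  · rintro ⟨x, hx, rfl⟩
    have := zigzag_lt hN hx
    change o ≤ (pt D (o + zigzag N x) : ℕ) ∧ (pt D (o + zigzag N x) : ℕ) < o + N
    rw [val_pt (by omega)]
    omega
  · rintro ⟨h1, h2⟩
    refine ⟨zigzag N (y - o), zigzag_lt hN (by omega), ?_⟩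
    change pt D (o + zigzag N (zigzag N (y - o))) = y
    rw [zigzag_zigzag hN (by omega), show o + ((y : ℕ) - o) = y by omega, pt_val]

/-- In the order 0, 2, 1, 4, 3, … each odd position carries a larger label than its neighbours, and
these labels increase. The offset `o` allows the block to be placed after or before the leaves. -/
theorem exists_isPathRun_zigzag {N o : ℕ} (ho : o + N ≤ D)
    {p₁ p₂ q₁ q₂ t : ℕ} {E F : Multiset ℕ} (hp₁ : Odd p₁) (hp₂ : Odd p₂) (hq₁ : Odd q₁)
    (hq₂ : Odd q₂) (hE : ∀ k ∈ E, Even k ∧ 0 < k) (hF : ∀ k ∈ F, Even k ∧ 0 < k)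
    (hN : N % 2 = 0)
    (hsumA : p₁ + p₂ + 2 * t + E.sum = N) (hsumB : q₁ + q₂ + F.sum = N) :
    ∃ ρ γ l, IsPathRun (fun x => pt D (o + zigzag N x)) N
      ({p₁, p₂} + Multiset.replicate (2 * t) 1 + E) ({q₁, q₂} + F) ρ γ l := by
  have hlt : ∀ x y, x < N → y < N → zigzag N x < zigzag N y →
      pt D (o + zigzag N x) < pt D (o + zigzag N y) := by
    intro x y _ hy h
    have := zigzag_lt hN hy
    exact pt_lt_pt (by omega) (by omega)
  refine exists_isPathRun ?_ (fun j hj => ?_) (fun j hj => ?_) (fun i j hij hj => ?_)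
    hp₁ hp₂ hq₁ hq₂ hE hF hsumA hsumB
  · intro x hx y hy hxy
    have h1 := zigzag_lt hN hx
    have h2 := zigzag_lt hN hy
    have h3 : zigzag N x = zigzag N y := by
      by_contra hne
      exact pt_ne_pt (by omega) (by omega) (show o + zigzag N x ≠ o + zigzag N y by omega) hxy
    rw [← zigzag_zigzag hN hx, h3, zigzag_zigzag hN hy]
  · have h1 := zigzag_cases N (2 * j)
    have h2 := zigzag_cases N (2 * j + 1)
    exact hlt _ _ (by omega) hj (by omega)
  · have h1 := zigzag_cases N (2 * j + 2)
    have h2 := zigzag_cases N (2 * j + 1)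
    exact hlt _ _ hj (by omega) (by omega)
  · rcases hij.eq_or_lt with rfl | hij
    · exact le_rfl
    · have h1 := zigzag_cases N (2 * i + 1)
      have h2 := zigzag_cases N (2 * j + 1)
      exact (hlt _ _ (by omega) hj (by omega)).le

end Labels

/-! ### Splitting a doubled transposition -/

section Split

variable {V : Type*} [DecidableEq V]

/-- For an odd number of signs the doubled transposition `u` is split by the sign change. Putting
`swap u.1 u.2` into both involutions lets each half remove its own copy, so the run after the change
is again over an involution fixing the points of `u`, and later leaves may be attached to them
without restriction. -/
theorem isRun_locked_left {u : V × V} {δ π : Perm V} {l : List (V × V)} {T₁ T₂ : List (V × V)}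
    (hT : (δ = 1 ∧ T₁ = [] ∧ T₂ = [u, u]) ∨ (δ = swap u.1 u.2 ∧ T₁ = [u] ∧ T₂ = [u]))
    (hπ : π * π = 1) (hu : π u.1 = u.1 ∧ π u.2 = u.2)
    (hl : ∀ p ∈ l, (π p.1 = p.1 ∧ π p.2 = p.2) ∧ (p.1 ≠ u.1 ∧ p.1 ≠ u.2) ∧
      (p.2 ≠ u.1 ∧ p.2 ≠ u.2)) : IsRun (δ * π) (doubled l ++ T₁) := by
  have h1 : IsRun π (doubled l) := isRun_doubled hπ fun p hp => (hl p hp).1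
  rcases hT with ⟨rfl, rfl, -⟩ | ⟨rfl, rfl, -⟩
  · rw [one_mul, List.append_nil]
    exact h1
  · have hc : Commute (swap u.1 u.2) π := by
      refine Commute.symm ?_
      change _ * _ = _ * _
      rw [mul_swap_eq_swap_mul, hu.1, hu.2]
    have h2 := h1.mul_left (swap_mul_self u.1 u.2) hc fun p hp => by
      have := hl p (mem_doubled.mp hp)
      exact ⟨swap_apply_of_ne_of_ne this.2.1.1 this.2.1.2,
        swap_apply_of_ne_of_ne this.2.2.1 this.2.2.2⟩
    refine h2.append ?_
    rw [run_doubled]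
    refine ⟨h2.mul_self, ?_⟩
    rw [swap_mul_self_mul]
    exact hπ

theorem isRun_locked_right {u : V × V} {δ π : Perm V} {l : List (V × V)} {T₁ T₂ : List (V × V)}
    (hT : (δ = 1 ∧ T₁ = [] ∧ T₂ = [u, u]) ∨ (δ = swap u.1 u.2 ∧ T₁ = [u] ∧ T₂ = [u]))
    (hu : π u.1 = u.1 ∧ π u.2 = u.2) (hl : IsRun π l) : IsRun (δ * π) (T₂ ++ l) := by
  have hπ := hl.mul_self
  have h2 : (swap u.1 u.2 * π) * (swap u.1 u.2 * π) = 1 := by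
    rw [mul_assoc, ← mul_assoc π, mul_swap_eq_swap_mul, hu.1, hu.2, mul_assoc, hπ, mul_one,
      swap_mul_self]
  rcases hT with ⟨rfl, -, rfl⟩ | ⟨rfl, -, rfl⟩
  · rw [one_mul]
    refine ⟨hπ, h2, ?_⟩
    rw [swap_mul_self_mul]
    exact hl
  · refine ⟨h2, ?_⟩
    change IsRun _ l
    rw [swap_mul_self_mul]
    exact hl

/-- No correction of the involutions is made here: if the pair is split between the two runs, the
second one continues over `swap u.1 u.2 * π`. The later leaves must therefore avoid both points of
`u`. -/
theorem isRun_unlocked {u : V × V} {π : Perm V} {l : List (V × V)} {T₁ T₂ : List (V × V)}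
    (hT : T₁ ++ T₂ = [u, u])
    (hπ : π * π = 1) (hu : π u.1 = u.1 ∧ π u.2 = u.2)
    (hl : ∀ p ∈ l, (π p.1 = p.1 ∧ π p.2 = p.2) ∧ (p.1 ≠ u.1 ∧ p.1 ≠ u.2) ∧
      (p.2 ≠ u.1 ∧ p.2 ≠ u.2)) : IsRun π T₁ ∧ IsRun π (T₂ ++ doubled l) := by
  have h1 : IsRun π (doubled l) := isRun_doubled hπ fun p hp => (hl p hp).1
  have h2 : (swap u.1 u.2 * π) * (swap u.1 u.2 * π) = 1 := by
    rw [mul_assoc, ← mul_assoc π, mul_swap_eq_swap_mul, hu.1, hu.2, mul_assoc, hπ, mul_one,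
      swap_mul_self]
  have h3 : IsRun (swap u.1 u.2 * π) (doubled l) := by
    have := isRun_locked_left (Or.inr ⟨rfl, rfl, rfl⟩) hπ hu hl
    have h4 : ∀ (ρ : Perm V) (l l' : List (V × V)), IsRun ρ (l ++ l') → IsRun ρ l := by
      intro ρ l l' h
      induction l generalizing ρ with
      | nil => exact h.mul_self
      | cons p l ih => exact ⟨h.1, ih _ h.2⟩
    exact h4 _ _ _ this
  match T₁, hT with
  | [], hT =>
    obtain rfl : T₂ = [u, u] := hT
    refine ⟨hπ, hπ, h2, ?_⟩
    rw [swap_mul_self_mul]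
    exact h1
  | [x], hT =>
    simp only [List.cons_append, List.nil_append, List.cons.injEq] at hT
    obtain ⟨rfl, rfl⟩ := hT
    exact ⟨⟨hπ, h2⟩, hπ, h3⟩
  | [x, y], hT =>
    simp only [List.cons_append, List.nil_append, List.cons.injEq] at hT
    obtain ⟨rfl, rfl, rfl⟩ := hT
    refine ⟨⟨hπ, h2, ?_⟩, h1⟩
    rw [swap_mul_self_mul]
    exact hπ
  | x :: y :: z :: T, hT => simp at hT

end Split

end RealMonotoneHurwitz

namespace RealMonotoneHurwitz

open Equiv

/-! ### Real lists assembled from a path run and doubled leaves. -/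

theorem doubled_singleton {V : Type*} (u : V × V) : doubled [u] = [u, u] := rfl

theorem leaves_one {V : Type*} (ℓ : ℕ → V) (a : ℕ → ℕ) (x : ℕ) :
    leaves ℓ a x 1 = [(ℓ (a x), ℓ x)] := rfl

section

variable {D N n q g : ℕ} [NeZero D] {α β : D.Partition} {A B : Multiset ℕ} {ρ γ δ : Perm (Fin D)}
  {l T₁ T₂ : List (Fin D × Fin D)} {a : ℕ → ℕ} {w : Fin D}

/-- The transpositions joining the last point to a root, to a hub and to `w`. -/
def connector (D q g : ℕ) [NeZero D] (w : Fin D) : List (Fin D × Fin D) :=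
  [(pt D 0, pt D (D - 1)), (pt D (q + 1), pt D (D - 1))] ++
    List.replicate (1 + g) (w, pt D (D - 1))

theorem mem_connector {p : Fin D × Fin D} : p ∈ connector D q g w ↔
    (p.1 = pt D 0 ∨ p.1 = pt D (q + 1) ∨ p.1 = w) ∧ p.2 = pt D (D - 1) := by
  obtain ⟨x, y⟩ := p
  simp only [connector, List.cons_append, List.nil_append, List.mem_cons, List.mem_replicate,
    Prod.mk.injEq]
  have : 1 + g ≠ 0 := by omega
  tauto

/-- A factorization in which the signs change among the leaves, before the path run. -/
theorem isRealList_leaves_first (hD : D = n + 4 + N) (hN : N % 2 = 0) (hN0 : 0 < N)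
    (hα : α.parts = A + Multiset.replicate (n + 4) 1)
    (hβ : β.parts = B + Multiset.replicate (n + 4) 1)
    (h : IsPathRun (fun x => pt D (n + 3 + zigzag N x)) N A B ρ γ l) (hq : q ≤ n)
    (ha : ∀ j, 1 ≤ j → j < n + 3 → j ≠ q + 1 → a j < j) (haq : a (q + 2) = q + 1)
    (hT : (δ = 1 ∧ T₁ = [] ∧ T₂ = [(pt D (q + 1), pt D (q + 2)), (pt D (q + 1), pt D (q + 2))]) ∨
      (δ = swap (pt D (q + 1)) (pt D (q + 2)) ∧ T₁ = [(pt D (q + 1), pt D (q + 2))] ∧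
        T₂ = [(pt D (q + 1), pt D (q + 2))]))
    (hw : w ∈ (fun x => pt D (n + 3 + zigzag N x)) '' Set.Iio N) (hw' : run ρ l w = w) :
    IsRealList g α β (δ * (ρ * γ * ρ)) (δ * ρ) (doubled (leaves (pt D) a 1 q) ++ T₁)
      (T₂ ++ (doubled (leaves (pt D) a (q + 3) (n - q)) ++ (l ++ doubled (connector D q g w)))) ∧
    (doubled (leaves (pt D) a 1 q) ++ T₁) ++
      (T₂ ++ (doubled (leaves (pt D) a (q + 3) (n - q)) ++ (l ++ doubled (connector D q g w)))) =
        doubled (leaves (pt D) a 1 q ++ leaves (pt D) a (q + 2) (n - q + 1)) ++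
          (l ++ doubled (connector D q g w)) := by
  set u : Fin D × Fin D := (pt D (q + 1), pt D (q + 2)) with hu
  have himg := fun y => image_pt_zigzag (D := D) (o := n + 3) hN (by omega) y
  have hleaf : ∀ i < n + 3, pt D i ∉ (fun x => pt D (n + 3 + zigzag N x)) '' Set.Iio N := by
    intro i hi hmem
    rw [himg, val_pt (by omega)] at hmem
    omega
  have hlast : pt D (D - 1) ∉ (fun x => pt D (n + 3 + zigzag N x)) '' Set.Iio N := by
    intro hmem
    rw [himg, val_pt (by omega)] at hmem
    omega
  have hρρ := h.isRun.mul_self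
  have hρu : ρ u.1 = u.1 ∧ ρ u.2 = u.2 :=
    ⟨(h.fixed _ (hleaf _ (by omega))).1, (h.fixed _ (hleaf _ (by omega))).1⟩
  have hγu : γ u.1 = u.1 ∧ γ u.2 = u.2 :=
    ⟨(h.fixed _ (hleaf _ (by omega))).2, (h.fixed _ (hleaf _ (by omega))).2⟩
  have hcomm : ∀ π : Perm (Fin D), π u.1 = u.1 ∧ π u.2 = u.2 → δ * π = π * δ := by
    intro π hπ
    rcases hT with ⟨rfl, -⟩ | ⟨rfl, -⟩
    · rw [one_mul, mul_one]
    · rw [mul_swap_eq_swap_mul π]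
      rw [hu] at hπ
      rw [hπ.1, hπ.2]
  have hδδ : δ * δ = 1 := by
    rcases hT with ⟨rfl, -⟩ | ⟨rfl, -⟩
    · rw [one_mul]
    · exact swap_mul_self _ _
  have hT12 : T₁ ++ T₂ = [u, u] := by
    rcases hT with ⟨-, rfl, rfl⟩ | ⟨-, rfl, rfl⟩ <;> rfl
  have hu1 : leaves (pt D) a (q + 2) 1 = [u] := by rw [leaves_one, haq]
  have hlist : (doubled (leaves (pt D) a 1 q) ++ T₁) ++
      (T₂ ++ (doubled (leaves (pt D) a (q + 3) (n - q)) ++ (l ++ doubled (connector D q g w)))) =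
        doubled (leaves (pt D) a 1 q ++ leaves (pt D) a (q + 2) (n - q + 1)) ++
          (l ++ doubled (connector D q g w)) := by
    rw [show n - q + 1 = 1 + (n - q) by omega, ← leaves_append, hu1, doubled_append, doubled_append,
      doubled_singleton, ← hT12]
    simp only [List.append_assoc]
  -- The path run acts on `ρ` and comes after the sign change, so `ρ` has to be the right-hand
  -- involution. Conjugating `γ` by `ρ` on the left keeps the product `ρ * γ`, and the two copies of
  -- `δ` cancel because `δ` commutes with permutations fixing the points of `u`.
  have hσ : δ * (ρ * γ * ρ) * (δ * ρ) = ρ * γ := by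
    have h1 : δ * (ρ * γ * ρ) = ρ * γ * ρ * δ := by
      apply hcomm
      simp only [Perm.mul_apply, hρu, hγu, and_self]
    rw [h1, mul_assoc (ρ * γ * ρ), ← mul_assoc δ, hδδ, one_mul, mul_assoc, hρρ, mul_one]
  have hstrict : StrictMonoOn (pt D) (Set.Iio (n + 3)) := by
    intro x hx y hy hxy
    simp only [Set.mem_Iio] at hx hy
    exact pt_lt_pt hxy (by omega)
  refine ⟨⟨?_, ?_, ?_, ?_, ?_, ?_, ?_⟩, hlist⟩
  · rw [hlist]
    have := h.length
    simp only [List.length_append, length_doubled, length_leaves, connector, List.length_cons,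
      List.length_nil, List.length_replicate, numSimple, hα, hβ, Multiset.card_add,
      Multiset.card_replicate]
    omega
  · rw [hlist]
    have hm1 : IsMonotoneList (leaves (pt D) a 1 q ++ leaves (pt D) a (q + 2) (n - q + 1)) := by
      refine (isMonotoneList_leaves hstrict (fun j h1 h2 => ha j h1 (by omega) (by omega))
        (by omega)).append (isMonotoneList_leaves hstrict
          (fun j h1 h2 => ha j (by omega) (by omega) (by omega)) (by omega)) ?_
      intro p hp p' hp'
      obtain ⟨j, hj, rfl⟩ := mem_leaves.mp hp
      obtain ⟨j', hj', rfl⟩ := mem_leaves.mp hp'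
      exact (pt_lt_pt (by omega) (by omega)).le
    have hm2 : IsMonotoneList (connector D q g w) := by
      refine ⟨fun p hp => ?_, List.pairwise_of_forall_mem_list fun p hp p' hp' => ?_⟩
      · rw [mem_connector] at hp
        rcases hp with ⟨hp | hp | hp, hp2⟩ <;> rw [hp, hp2]
        · exact pt_lt_pt (by omega) (by omega)
        · exact pt_lt_pt (by omega) (by omega)
        · rw [himg] at hw
          rw [Fin.lt_def, val_pt (by omega)]
          omega
      · rw [(mem_connector.mp hp).2, (mem_connector.mp hp').2]
    refine hm1.doubled.append (h.monotone.append hm2.doubled ?_) ?_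
    · intro p hp p' hp'
      have h1 := (himg _).mp (h.mem p hp).2
      rw [mem_doubled, mem_connector] at hp'
      rw [hp'.2, Fin.le_def, val_pt (by omega)]
      omega
    · intro p hp p' hp'
      have h1 : (p.2 : ℕ) < n + 3 := by
        rw [mem_doubled, List.mem_append] at hp
        rcases hp with hp | hp
        · obtain ⟨j, hj, rfl⟩ := mem_leaves.mp hp
          rw [val_pt (by omega)]
          omega
        · obtain ⟨j, hj, rfl⟩ := mem_leaves.mp hp
          rw [val_pt (by omega)]
          omega
      rw [List.mem_append] at hp'
      rw [Fin.le_def]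
      rcases hp' with hp' | hp'
      · have := (himg _).mp (h.mem p' hp').2
        omega
      · rw [mem_doubled, mem_connector] at hp'
        rw [hp'.2, val_pt (by omega)]
        omega
  · have hfix : ∀ i < n + 3, (ρ * γ * ρ) (pt D i) = pt D i := by
      intro i hi
      have := h.fixed _ (hleaf i hi)
      simp only [Perm.mul_apply, this]
    refine isRun_locked_left (u := u) hT ?_ ⟨hfix _ (by omega), hfix _ (by omega)⟩ ?_
    · rw [show ρ * γ * ρ * (ρ * γ * ρ) = ρ * (γ * (ρ * ρ) * γ) * ρ by simp only [mul_assoc], hρρ,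
        mul_one, h.mul_self, mul_one, hρρ]
    · intro p hp
      obtain ⟨j, hj, rfl⟩ := mem_leaves.mp hp
      have := ha j hj.1 (by omega) (by omega)
      refine ⟨⟨hfix _ (by omega), hfix _ (by omega)⟩, ⟨?_, ?_⟩, ?_, ?_⟩
      all_goals exact pt_ne_pt (by omega) (by omega) (by omega)
  · refine isRun_locked_right hT hρu ?_
    refine (isRun_doubled hρρ fun p hp => ?_).append ?_
    · obtain ⟨j, hj, rfl⟩ := mem_leaves.mp hp
      have := ha j (by omega) (by omega) (by omega)
      exact ⟨(h.fixed _ (hleaf _ (by omega))).1, (h.fixed _ (hleaf _ (by omega))).1⟩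
    rw [run_doubled]
    refine h.isRun.append (isRun_doubled ?_ fun p hp => ?_)
    · have := h.isRun.run_take_mul_self l.length
      rwa [List.take_length] at this
    · have hfix : ∀ y ∉ (fun x => pt D (n + 3 + zigzag N x)) '' Set.Iio N, run ρ l y = y := by
        intro y hy
        refine run_apply_of_fixed (h.fixed y hy).1 fun p hp => ⟨?_, ?_⟩
        · rintro rfl
          exact hy (h.mem p hp).1
        · rintro rfl
          exact hy (h.mem p hp).2
      obtain ⟨hp1, hp2⟩ := mem_connector.mp hp
      rw [hp2]
      refine ⟨?_, hfix _ hlast⟩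
      rcases hp1 with hp1 | hp1 | hp1 <;> rw [hp1]
      · exact hfix _ (hleaf _ (by omega))
      · exact hfix _ (hleaf _ (by omega))
      · exact hw'
  · rw [hσ, h.type_left, hα, Fintype.card_fin]
    congr 2
    omega
  · rw [hσ, hlist, run_append, run_doubled, run_append, run_doubled, run_mul, h.type_right, hβ,
      Fintype.card_fin]
    congr 2
    omega
  · rw [hσ, hlist]
    intro r hr hl
    have hbase := h.connected r hr fun p hp => hl p (by simp [hp])
    have hconn : ∀ y, y = pt D 0 ∨ y = pt D (q + 1) ∨ y = w → r y (pt D (D - 1)) := by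
      intro y hy
      refine hl (y, pt D (D - 1)) ?_
      rw [List.mem_append, List.mem_append, mem_doubled, mem_doubled]
      exact Or.inr (Or.inr (mem_connector.mpr ⟨hy, rfl⟩))
    have hleaves : ∀ j, 1 ≤ j → j < n + 3 → j ≠ q + 1 → r (pt D (a j)) (pt D j) := by
      intro j h1 h2 h3
      refine hl (pt D (a j), pt D j) ?_
      rw [List.mem_append, mem_doubled, List.mem_append]
      left
      rcases Nat.lt_or_ge j (q + 1) with h4 | h4
      · exact Or.inl (mem_leaves.mpr ⟨j, by omega, rfl⟩)
      · exact Or.inr (mem_leaves.mpr ⟨j, by omega, rfl⟩)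
    -- Following parents strictly decreases the label and ends at `0` or at the hub `q + 1`, the
    -- only leaves without a parent; the connector ties both to the last point.
    have hall : ∀ j < n + 3, r (pt D j) (pt D (D - 1)) := by
      intro j
      induction j using Nat.strong_induction_on with
      | _ j ih =>
        intro hj
        by_cases h0 : j = 0
        · exact hconn _ (Or.inl (by rw [h0]))
        by_cases h1 : j = q + 1
        · exact hconn _ (Or.inr (Or.inl (by rw [h1])))
        have h2 := ha j (by omega) hj h1
        exact r.trans (r.symm (hleaves j (by omega) hj h1)) (ih _ h2 (by omega))
    have hpath : ∀ y ∈ (fun x => pt D (n + 3 + zigzag N x)) '' Set.Iio N, r y (pt D (D - 1)) :=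
      fun y hy => r.trans (r.symm (hbase y hy)) (r.trans (hbase w hw)
        (hconn w (Or.inr (Or.inr rfl))))
    have hevery : ∀ y, r y (pt D (D - 1)) := by
      intro y
      rcases Nat.lt_or_ge (y : ℕ) (n + 3) with h1 | h1
      · have := hall y h1
        rwa [pt_val] at this
      rcases Nat.lt_or_ge (y : ℕ) (n + 3 + N) with h2 | h2
      · exact hpath y ((himg y).mpr ⟨h1, h2⟩)
      · have : y = pt D (D - 1) := by
          rw [Fin.ext_iff, val_pt (by omega)]
          omega
        rw [this]
    exact (Setoid.eq_top_iff).mpr fun x y => r.trans (hevery x) (r.symm (hevery y))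

/-- A factorization in which the signs change among the leaves, after the path run. -/
theorem isRealList_leaves_last (hD : D = N + (n + 3)) (hN : N % 2 = 0)
    (hα : α.parts = A + Multiset.replicate (n + 3) 1)
    (hβ : β.parts = B + Multiset.replicate (n + 3) 1)
    (h : IsPathRun (fun x => pt D (0 + zigzag N x)) N A B ρ γ l) (hq : q ≤ n)
    (ha : ∀ j, 1 ≤ j → j < n + 3 → a j < j) (haq : a (q + 2) = 0)
    (ha' : ∀ j, q + 3 ≤ j → j < n + 3 → a j ≠ 0 ∧ a j ≠ q + 2)
    (hT : T₁ ++ T₂ = [(pt D N, pt D (N + (q + 2))), (pt D N, pt D (N + (q + 2)))])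
    (hw : w ∈ (fun x => pt D (0 + zigzag N x)) '' Set.Iio N) (hw' : run ρ l w = w) :
    IsRealList g α β ρ γ
      (l ++ (doubled (List.replicate (1 + g) (w, pt D N) ++
        leaves (fun j => pt D (N + j)) a 1 (q + 1)) ++ T₁))
      (T₂ ++ doubled (leaves (fun j => pt D (N + j)) a (q + 3) (n - q))) ∧
    (l ++ (doubled (List.replicate (1 + g) (w, pt D N) ++
        leaves (fun j => pt D (N + j)) a 1 (q + 1)) ++ T₁)) ++
      (T₂ ++ doubled (leaves (fun j => pt D (N + j)) a (q + 3) (n - q))) =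
      l ++ doubled (List.replicate (1 + g) (w, pt D N) ++
        leaves (fun j => pt D (N + j)) a 1 (n + 2)) := by
  set ℓ : ℕ → Fin D := fun j => pt D (N + j) with hℓ
  set u : Fin D × Fin D := (pt D N, pt D (N + (q + 2))) with hu
  have himg := fun y => image_pt_zigzag (D := D) (o := 0) hN (by omega) y
  have hleaf : ∀ i < n + 3, ℓ i ∉ (fun x => pt D (0 + zigzag N x)) '' Set.Iio N := by
    intro i hi hmem
    rw [himg, hℓ, val_pt (by omega)] at hmem
    omega
  have hu1 : leaves ℓ a (q + 2) 1 = [u] := by rw [leaves_one, haq]; rfl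
  have hlist : (l ++ (doubled (List.replicate (1 + g) (w, pt D N) ++
        leaves ℓ a 1 (q + 1)) ++ T₁)) ++ (T₂ ++ doubled (leaves ℓ a (q + 3) (n - q))) =
      l ++ doubled (List.replicate (1 + g) (w, pt D N) ++ leaves ℓ a 1 (n + 2)) := by
    have e1 : leaves ℓ a 1 (n + 2) =
        leaves ℓ a 1 (q + 1) ++ ([u] ++ leaves ℓ a (q + 3) (n - q)) := by
      rw [← hu1, leaves_append, show q + 2 = 1 + (q + 1) by omega, leaves_append]
      congr 1
      omega
    rw [e1, doubled_append, doubled_append, doubled_append, doubled_append, doubled_singleton, ← hT]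
    simp only [List.append_assoc]
  have hstrict : StrictMonoOn ℓ (Set.Iio (n + 3)) := by
    intro x hx y hy hxy
    simp only [Set.mem_Iio] at hx hy
    exact pt_lt_pt (by omega) (by omega)
  have hfix : ∀ i < n + 3, run ρ l (ℓ i) = ℓ i := by
    intro i hi
    refine run_apply_of_fixed (h.fixed _ (hleaf i hi)).1 fun p hp => ⟨?_, ?_⟩
    · intro he
      exact hleaf i hi (he ▸ (h.mem p hp).1)
    · intro he
      exact hleaf i hi (he ▸ (h.mem p hp).2)
  have hrr : run ρ l * run ρ l = 1 := by
    have := h.isRun.run_take_mul_self l.length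
    rwa [List.take_length] at this
  have hneu : ∀ i < n + 3, i ≠ 0 → i ≠ q + 2 → ℓ i ≠ u.1 ∧ ℓ i ≠ u.2 := by
    intro i hi h0 h1
    exact ⟨pt_ne_pt (by omega) (by omega) (by omega), pt_ne_pt (by omega) (by omega) (by omega)⟩
  refine ⟨⟨?_, ?_, ?_, ?_, ?_, ?_, ?_⟩, hlist⟩
  · rw [hlist]
    have := h.length
    simp only [List.length_append, length_doubled, length_leaves,
      List.length_replicate, numSimple, hα, hβ, Multiset.card_add, Multiset.card_replicate]
    omega
  · rw [hlist]
    have hwlt : w < pt D N := by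
      have := (himg w).mp hw
      rw [Fin.lt_def, val_pt (by omega)]
      omega
    refine h.monotone.append (IsMonotoneList.doubled ((isMonotoneList_replicate hwlt _).append
      (isMonotoneList_leaves hstrict (fun j h1 h2 => ha j h1 (by omega)) (by omega)) ?_)) ?_
    · intro p hp p' hp'
      rw [List.eq_of_mem_replicate hp]
      obtain ⟨j, hj, rfl⟩ := mem_leaves.mp hp'
      exact (pt_lt_pt (by omega) (by omega)).le
    · intro p hp p' hp'
      have h1 := (himg _).mp (h.mem p hp).2
      rw [mem_doubled, List.mem_append] at hp'
      rw [Fin.le_def]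
      rcases hp' with hp' | hp'
      · rw [List.eq_of_mem_replicate hp', val_pt (by omega)]
        omega
      · obtain ⟨j, hj, rfl⟩ := mem_leaves.mp hp'
        rw [hℓ, val_pt (by omega)]
        omega
  · refine h.isRun.append ((isRun_doubled hrr fun p hp => ?_).append ?_)
    · rw [List.mem_append] at hp
      rcases hp with hp | hp
      · rw [List.eq_of_mem_replicate hp]
        exact ⟨hw', hfix 0 (by omega)⟩
      · obtain ⟨j, hj, rfl⟩ := mem_leaves.mp hp
        have := ha j hj.1 (by omega)
        exact ⟨hfix _ (by omega), hfix _ (by omega)⟩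
    · rw [run_doubled]
      exact (isRun_unlocked (l := []) hT hrr ⟨hfix 0 (by omega), hfix (q + 2) (by omega)⟩
        (by simp)).1
  -- After the sign change the run starts afresh from `γ`, which fixes all leaves although the path
  -- run has altered `ρ`.
  · refine (isRun_unlocked hT h.mul_self ⟨(h.fixed _ (hleaf 0 (by omega))).2,
      (h.fixed _ (hleaf (q + 2) (by omega))).2⟩ fun p hp => ?_).2
    obtain ⟨j, hj, rfl⟩ := mem_leaves.mp hp
    have h1 := ha j (by omega) (by omega)
    have h2 := ha' j hj.1 (by omega)
    exact ⟨⟨(h.fixed _ (hleaf _ (by omega))).2, (h.fixed _ (hleaf _ (by omega))).2⟩,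
      hneu _ (by omega) h2.1 h2.2, hneu _ (by omega) (by omega) (by omega)⟩
  · rw [h.type_left, hα, Fintype.card_fin]
    congr 2
    omega
  · rw [hlist, run_append, run_doubled, run_mul, h.type_right, hβ, Fintype.card_fin]
    congr 2
    omega
  · rw [hlist]
    intro r hr hl
    have hbase := h.connected r hr fun p hp => hl p (by simp [hp])
    have hconn : r w (ℓ 0) := by
      refine hl (w, ℓ 0) ?_
      rw [List.mem_append, mem_doubled, List.mem_append]
      exact Or.inr (Or.inl (List.mem_replicate.mpr ⟨by omega, rfl⟩))
    have hleaves : ∀ j, 1 ≤ j → j < n + 3 → r (ℓ (a j)) (ℓ j) := by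
      intro j h1 h2
      refine hl (ℓ (a j), ℓ j) ?_
      rw [List.mem_append, mem_doubled, List.mem_append]
      exact Or.inr (Or.inr (mem_leaves.mpr ⟨j, by omega, rfl⟩))
    have hall : ∀ j < n + 3, r (ℓ j) (ℓ 0) := by
      intro j
      induction j using Nat.strong_induction_on with
      | _ j ih =>
        intro hj
        by_cases h0 : j = 0
        · rw [h0]
        have h2 := ha j (by omega) hj
        exact r.trans (r.symm (hleaves j (by omega) hj)) (ih _ h2 (by omega))
    have hevery : ∀ y, r y (ℓ 0) := by
      intro y
      rcases Nat.lt_or_ge (y : ℕ) N with h1 | h1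
      · have hy := (himg y).mpr ⟨Nat.zero_le _, by omega⟩
        exact r.trans (r.symm (hbase y hy)) (r.trans (hbase w hw) hconn)
      · have h2 := hall (y - N) (by omega)
        have e : ℓ (y - N) = y := by
          change pt D (N + (y - N)) = y
          rw [show N + ((y : ℕ) - N) = y by omega, pt_val]
        rwa [e] at h2
    exact (Setoid.eq_top_iff).mpr fun x y => r.trans (hevery x) (r.symm (hevery y))

end

end RealMonotoneHurwitz

namespace RealMonotoneHurwitz

open Equiv

/-! ### Counting real monotone factorizations from below -/

section

variable {D N n g : ℕ} [NeZero D] {α β : D.Partition}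

/-- A choice function for the leaves, extended by `0`. -/
def extendChoice {n : ℕ} (c : (j : Fin n) → Fin (j + 1)) (j : ℕ) : ℕ :=
  if h : j < n then c ⟨j, h⟩ else 0

theorem extendChoice_le {n : ℕ} (c : (j : Fin n) → Fin (j + 1)) (j : ℕ) : extendChoice c j ≤ j := by
  unfold extendChoice
  split_ifs with h
  · have := (c ⟨j, h⟩).2
    exact Nat.lt_succ_iff.mp this
  · exact Nat.zero_le _

theorem extendChoice_injective {n : ℕ} {c c' : (j : Fin n) → Fin (j + 1)}
    (h : ∀ j < n, extendChoice c j = extendChoice c' j) : c = c' := by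
  funext j
  have := h j j.2
  unfold extendChoice at this
  rw [dif_pos j.2, dif_pos j.2] at this
  exact Fin.ext this

theorem card_choice (n : ℕ) : Fintype.card ((j : Fin n) → Fin (j + 1)) = n.factorial := by
  rw [Fintype.card_pi]
  simp only [Fintype.card_fin]
  rw [Fin.prod_univ_eq_prod_range (fun j => j + 1) n, Finset.prod_range_add_one_eq_factorial]

variable {p₁ p₂ q₁ q₂ t : ℕ} {E F : Multiset ℕ}

/-- The sign change falls among the leaves, which carry the smallest labels; the path block lies
above them, and the largest label is the connecting point. -/
theorem factorial_le_of_small (hD : D = n + 4 + N) (hp₁ : Odd p₁) (hp₂ : Odd p₂) (hq₁ : Odd q₁)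
    (hq₂ : Odd q₂) (hE : ∀ k ∈ E, Even k ∧ 0 < k) (hF : ∀ k ∈ F, Even k ∧ 0 < k)
    (hN : N % 2 = 0)
    (hsumA : p₁ + p₂ + 2 * t + E.sum = N) (hsumB : q₁ + q₂ + F.sum = N)
    (hα : α.parts = {p₁, p₂} + Multiset.replicate (2 * t) 1 + E + Multiset.replicate (n + 4) 1)
    (hβ : β.parts = {q₁, q₂} + F + Multiset.replicate (n + 4) 1) {s : ℕ} (hs : s ≤ 2 * n + 1) :
    n.factorial ≤ realMonotoneOfSigns g α β (simpleSigns _ s) := by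
  obtain ⟨ρ, γ, l, h⟩ := exists_isPathRun_zigzag (D := D) (N := N) (o := n + 3) (by omega)
    hp₁ hp₂ hq₁ hq₂ hE hF hN hsumA hsumB
  have hN0 : 0 < N := by have := hp₁.pos; omega
  obtain ⟨w, hw, hw'⟩ := h.exists_fixed_right
  set q := s / 2 with hq
  set u : Fin D × Fin D := (pt D (q + 1), pt D (q + 2)) with hu
  -- Leaf `q + 2` is tied to the hub `q + 1`, which has no parent. The leaves `1, …, q` use choices
  -- `0, …, q - 1` and the leaves from `q + 3` on use choices `q, …, n - 1`, which explains the
  -- shifts by 1 and 3.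
  let a : ((j : Fin n) → Fin (j + 1)) → ℕ → ℕ := fun c j =>
    if j ≤ q then extendChoice c (j - 1) else
      if j = q + 2 then q + 1 else extendChoice c (j - 3)
  have ha : ∀ c j, 1 ≤ j → j ≠ q + 1 → a c j < j := by
    intro c j h1 h2
    have h3 := extendChoice_le c (j - 1)
    have h4 := extendChoice_le c (j - 3)
    simp only [a]
    split_ifs <;> omega
  have haq : ∀ c, a c (q + 2) = q + 1 := by
    intro c
    simp [a]
  -- For even `s` the sign change falls between two pairs; for odd `s` it splits the pair `u`.
  obtain ⟨δ, T₁, T₂, hT, hlen⟩ : ∃ (δ : Perm (Fin D)) (T₁ T₂ : List (Fin D × Fin D)),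
      ((δ = 1 ∧ T₁ = [] ∧ T₂ = [u, u]) ∨ (δ = swap u.1 u.2 ∧ T₁ = [u] ∧ T₂ = [u])) ∧
        T₁.length = s % 2 := by
    rcases Nat.mod_two_eq_zero_or_one s with h | h
    · exact ⟨1, [], [u, u], Or.inl ⟨rfl, rfl, rfl⟩, by rw [h]; rfl⟩
    · exact ⟨swap u.1 u.2, [u], [u], Or.inr ⟨rfl, rfl, rfl⟩, by rw [h]; rfl⟩
  have key := fun c => isRealList_leaves_first (g := g) hD hN hN0 hα hβ h (q := q) (by omega)
    (fun j h1 _ h3 => ha c j h1 h3) (haq c) hT hw hw'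
  rw [← card_choice]
  refine card_le_realMonotoneOfSigns _ _ (fun c => ?_) (fun c => (key c).1) ?_
  · rw [List.length_append, length_doubled, length_leaves, hlen]
    omega
  · intro c c' hcc
    simp only [(key _).2] at hcc
    have h1 := doubled_injective (List.append_cancel_right hcc)
    have hinj : Set.InjOn (pt D) (Set.Iio (n + 3)) := by
      intro x hx y hy hxy
      simp only [Set.mem_Iio] at hx hy
      by_contra hne
      exact pt_ne_pt (by omega) (by omega) hne hxy
    obtain ⟨h2, h3⟩ := List.append_inj h1 (by rw [length_leaves, length_leaves])
    refine extendChoice_injective fun j hj => ?_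
    rcases Nat.lt_or_ge j q with hjq | hjq
    · have := eq_of_leaves_eq hinj (fun i h4 h5 => by have := ha c i h4 (by omega); omega)
        (fun i h4 h5 => by have := ha c' i h4 (by omega); omega) h2 (j := j + 1) (by omega)
        (by omega)
      simpa [a, show j + 1 ≤ q by omega] using this
    · have := eq_of_leaves_eq hinj
        (fun i h4 h5 => by have := ha c i (by omega) (by omega); omega)
        (fun i h4 h5 => by have := ha c' i (by omega) (by omega); omega) h3 (j := j + 3) (by omega)
        (by omega)
      simpa [a, show ¬ j + 3 ≤ q by omega, show j + 3 ≠ q + 2 by omega] using this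

/-- Here the path block has the smallest labels and its run is finished before the sign change,
which again falls among the leaves. The lower bound on `s` covers the path run, the `1 + g`
connecting pairs and one leaf. -/
theorem factorial_le_of_large (hD : D = n + 4 + N) (hp₁ : Odd p₁) (hp₂ : Odd p₂) (hq₁ : Odd q₁)
    (hq₂ : Odd q₂) (hE : ∀ k ∈ E, Even k ∧ 0 < k) (hF : ∀ k ∈ F, Even k ∧ 0 < k)
    (hN : N % 2 = 0)
    (hsumA : p₁ + p₂ + 2 * t + E.sum = N) (hsumB : q₁ + q₂ + F.sum = N)
    (hα : α.parts = {p₁, p₂} + Multiset.replicate (2 * t) 1 + E + Multiset.replicate (n + 4) 1)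
    (hβ : β.parts = {q₁, q₂} + F + Multiset.replicate (n + 4) 1) {s : ℕ}
    (hs : s ≤ numSimple g α β)
    (hs' : 2 * t + Multiset.card E + Multiset.card F + 6 + 2 * g ≤ s) :
    n.factorial ≤ realMonotoneOfSigns g α β (simpleSigns _ s) := by
  obtain ⟨ρ, γ, l, h⟩ := exists_isPathRun_zigzag (D := D) (N := N) (o := 0) (by omega)
    hp₁ hp₂ hq₁ hq₂ hE hF hN hsumA hsumB
  have hN0 : 0 < N := by have := hp₁.pos; omega
  obtain ⟨w, hw, hw'⟩ := h.exists_fixed_right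
  have hlen : l.length = 2 * t + Multiset.card E + Multiset.card F + 2 := by
    have := h.length
    simp only [Multiset.card_add, Multiset.card_replicate, Multiset.card_pair] at this
    omega
  have hr : numSimple g α β = l.length + 2 * (n + 4 + g) := by
    rw [hlen, numSimple, hα, hβ]
    simp only [Multiset.card_add, Multiset.card_replicate, Multiset.card_pair]
    omega
  -- `q + 1` leaves precede the critical pair, and `k` of its two copies come before the sign
  -- change. The value `k = 2` is needed only for `s = r`, where no pair follows the change.
  obtain ⟨q, k, hq, hk, hqk⟩ : ∃ q k, q ≤ n + 1 ∧ k ≤ 2 ∧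
      s = l.length + 2 * (1 + g + (q + 1)) + k := by
    rcases Nat.lt_or_ge s (numSimple g α β) with h1 | h1
    · exact ⟨(s - l.length - 2 * (1 + g + 1)) / 2, (s - l.length) % 2, by omega, by omega,
        by omega⟩
    · exact ⟨n + 1, 2, le_rfl, le_rfl, by omega⟩
  set u : Fin D × Fin D := (pt D N, pt D (N + (q + 2))) with hu
  obtain ⟨T₁, T₂, hT, hTk⟩ : ∃ T₁ T₂ : List (Fin D × Fin D), T₁ ++ T₂ = [u, u] ∧ T₁.length = k :=
    ⟨[u, u].take k, [u, u].drop k, List.take_append_drop _ _, by simpa using hk⟩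
  -- Leaves `1` and `q + 2` are tied to `0`, and the other leaves never choose `0`. From `q + 3` on,
  -- the choices are relabelled increasingly so as to skip `q + 2` as well; leaf `j` keeps `j - 2`
  -- possibilities there.
  let a : ((j : Fin n) → Fin (j + 1)) → ℕ → ℕ := fun c j =>
    if j = 1 ∨ j = q + 2 then 0 else
      if j ≤ q + 1 then extendChoice c (j - 2) + 1 else
        if extendChoice c (j - 3) ≤ q then extendChoice c (j - 3) + 1 else
          extendChoice c (j - 3) + 2
  have ha : ∀ c j, 1 ≤ j → a c j < j := by
    intro c j h1
    have h3 := extendChoice_le c (j - 2)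
    have h4 := extendChoice_le c (j - 3)
    simp only [a]
    split_ifs <;> omega
  have haq : ∀ c, a c (q + 2) = 0 := by
    intro c
    simp [a]
  have ha' : ∀ c j, q + 3 ≤ j → a c j ≠ 0 ∧ a c j ≠ q + 2 := by
    intro c j h1
    simp only [a]
    split_ifs <;> omega
  have hrep : ∀ M : Multiset ℕ, M + Multiset.replicate (n + 4) 1 =
    M + Multiset.replicate (n + 1 + 3) 1 := fun M => by rw [show n + 4 = n + 1 + 3 by omega]
  have key := fun c => isRealList_leaves_last (n := n + 1) (g := g) (by omega) hN
    (hα.trans (hrep _)) (hβ.trans (hrep _)) h (q := q) hq (fun j h1 _ => ha c j h1) (haq c)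
    (fun j h1 _ => ha' c j h1) hT hw hw'
  rw [← card_choice]
  refine card_le_realMonotoneOfSigns _ _ (fun c => ?_) (fun c => (key c).1) ?_
  · rw [List.length_append, List.length_append, length_doubled, List.length_append, length_leaves,
      hTk, List.length_replicate, hqk]
    omega
  · intro c c' hcc
    simp only [(key _).2] at hcc
    have h1 := List.append_cancel_left (doubled_injective (List.append_cancel_left hcc))
    have hinj : Set.InjOn (fun j => pt D (N + j)) (Set.Iio (n + 4)) := by
      intro x hx y hy hxy
      simp only [Set.mem_Iio] at hx hy
      by_contra hne
      exact pt_ne_pt (show N + x < D by omega) (show N + y < D by omega) (by omega) hxy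
    have heq : ∀ j, 1 ≤ j → j < n + 4 → a c j = a c' j := fun j h2 h3 =>
      eq_of_leaves_eq hinj (fun i h4 h5 => by have := ha c i h4; omega)
        (fun i h4 h5 => by have := ha c' i h4; omega) h1 h2 (by omega)
    refine extendChoice_injective fun j hj => ?_
    rcases Nat.lt_or_ge j q with hjq | hjq
    · have := heq (j + 2) (by omega) (by omega)
      simp only [a, show ¬ (j + 2 = 1 ∨ j + 2 = q + 2) by omega, show j + 2 ≤ q + 1 by omega,
        if_true, if_false, Nat.add_sub_cancel] at this
      omega
    · have := heq (j + 3) (by omega) (by omega)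
      simp only [a, show ¬ (j + 3 = 1 ∨ j + 3 = q + 2) by omega, show ¬ j + 3 ≤ q + 1 by omega,
        if_false, Nat.add_sub_cancel] at this
      split_ifs at this <;> omega

end

/-- The lower bound for partitions with many common parts equal to `1`. -/
theorem factorial_le_realMonotone {D N n g : ℕ} {α β : D.Partition} {p₁ p₂ q₁ q₂ t : ℕ}
    {E F : Multiset ℕ} (hD : D = n + 4 + N) (hp₁ : Odd p₁) (hp₂ : Odd p₂) (hq₁ : Odd q₁)
    (hq₂ : Odd q₂) (hE : ∀ k ∈ E, Even k ∧ 0 < k) (hF : ∀ k ∈ F, Even k ∧ 0 < k)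
    (hsumA : p₁ + p₂ + 2 * t + E.sum = N) (hsumB : q₁ + q₂ + F.sum = N)
    (hα : α.parts = {p₁, p₂} + Multiset.replicate (2 * t) 1 + E + Multiset.replicate (n + 4) 1)
    (hβ : β.parts = {q₁, q₂} + F + Multiset.replicate (n + 4) 1)
    (hn : 2 * t + Multiset.card E + Multiset.card F + 4 + 2 * g ≤ 2 * n) :
    n.factorial ≤ realMonotone g α β := by
  have : NeZero D := ⟨by omega⟩
  have hN : N % 2 = 0 := by
    have h1 : Even F.sum := by
      rw [← Multiset.coe_toList F, Multiset.sum_coe, ← List.take_length (l := F.toList)]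
      exact even_sum_take (fun k hk => (hF k (Multiset.mem_toList.mp hk)).1) _
    rw [← hsumB]
    exact Nat.even_iff.mp ((hq₁.add_odd hq₂).add h1)
  -- The two constructions overlap: `hn` makes every `s ≥ 2 * n + 2` large enough for the second
  -- one.
  refine le_ciInf fun s => ?_
  rcases Nat.lt_or_ge (2 * n + 1) s with h | h
  · exact factorial_le_of_large hD hp₁ hp₂ hq₁ hq₂ hE hF hN hsumA hsumB hα hβ
      (Nat.lt_succ_iff.mp s.2) (by omega)
  · exact factorial_le_of_small hD hp₁ hp₂ hq₁ hq₂ hE hF hN hsumA hsumB hα hβ h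

end RealMonotoneHurwitz

namespace RealMonotoneHurwitz

open Equiv

/-! ### The lower bound for the sequence of real numbers -/

theorem even_pos_of_mem_evenParts {d : ℕ} (lam : d.Partition) {k : ℕ}
    (hk : k ∈ evenParts lam.parts + {2}) : Even k ∧ 0 < k := by
  rcases Multiset.mem_add.mp hk with h | h
  · unfold evenParts at h
    rw [Multiset.mem_filter] at h
    exact ⟨h.2, lam.parts_pos h.1⟩
  · rw [Multiset.mem_singleton.mp h]
    exact ⟨even_two, two_pos⟩

theorem odd_of_mem_unpairedOddParts {p : Multiset ℕ} {k : ℕ} (hk : k ∈ unpairedOddParts p) :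
    Odd k := by
  unfold unpairedOddParts at hk
  rw [Finset.mem_val, Finset.mem_filter] at hk
  exact hk.2.1

theorem factorial_le_hReal_of_parts {d g m n : ℕ} {lam mu : d.Partition} {p₁ p₂ q₁ q₂ t : ℕ}
    (hp₁ : Odd p₁) (hp₂ : Odd p₂) (hq₁ : Odd q₁) (hq₂ : Odd q₂)
    (hα : (addTwoOnes lam m).parts = {p₁, p₂} + Multiset.replicate (2 * t) 1 +
      (evenParts lam.parts + {2}) + Multiset.replicate (n + 4) 1)
    (hβ : (addTwoOnes mu m).parts = {q₁, q₂} + (evenParts mu.parts + {2}) +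
      Multiset.replicate (n + 4) 1)
    (hn : 2 * t + Multiset.card (evenParts lam.parts) + Multiset.card (evenParts mu.parts) + 6 +
      2 * g ≤ 2 * n) :
    n.factorial ≤ hReal g lam mu m := by
  have h1 := (addTwoOnes lam m).parts_sum
  have h2 := (addTwoOnes mu m).parts_sum
  rw [hα] at h1
  rw [hβ] at h2
  simp only [Multiset.insert_eq_cons, Multiset.sum_add, Multiset.sum_cons, Multiset.sum_singleton,
    Multiset.sum_replicate, smul_eq_mul, mul_one] at h1 h2
  refine factorial_le_realMonotone (N := q₁ + q₂ + (evenParts mu.parts + {2}).sum) (t := t) ?_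
    hp₁ hp₂ hq₁ hq₂ (fun k hk => even_pos_of_mem_evenParts lam hk)
    (fun k hk => even_pos_of_mem_evenParts mu hk) ?_ rfl hα hβ ?_
  · simp only [Multiset.sum_add, Multiset.sum_singleton]
    omega
  · simp only [Multiset.sum_add, Multiset.sum_singleton]
    omega
  · simp only [Multiset.card_add, Multiset.card_singleton]
    omega

/-- The four cases differ only in where the two odd end blocks on each side come from: unpaired odd
parts where available, ones otherwise. The surplus of ones on the first side becomes the `2 * t`
ones of the path block, and the ones common to both sides become leaves. -/
theorem exists_factorial_le_hReal (d g : ℕ) (lam mu : d.Partition)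
    (hmu : pairedOddParts mu.parts = 0)
    (hlam : 1 < Multiset.card (pairedOddParts lam.parts))
    (hones : ∀ k ∈ pairedOddParts lam.parts, k = 1)
    (hodd :
      (Multiset.card (unpairedOddParts lam.parts) = 1 ∧
        Multiset.card (unpairedOddParts mu.parts) = 1) ∨
      (Multiset.card (unpairedOddParts lam.parts) = 2 ∧
        Multiset.card (unpairedOddParts mu.parts) = 0) ∨
      (Multiset.card (unpairedOddParts lam.parts) = 0 ∧
        Multiset.card (unpairedOddParts mu.parts) = 2) ∨
      (Multiset.card (unpairedOddParts lam.parts) = 0 ∧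
        Multiset.card (unpairedOddParts mu.parts) = 0)) :
    ∃ m₀, ∀ m ≥ m₀, (2 * m).factorial ≤ hReal g lam mu (m + 3) := by
  set k := Multiset.card (pairedOddParts lam.parts) with hk
  have hpair : pairedOddParts lam.parts = Multiset.replicate k 1 :=
    Multiset.eq_replicate.mpr ⟨rfl, hones⟩
  have hlamd := tail_decomposition lam.parts
  have hmud := tail_decomposition mu.parts
  rw [hpair, Multiset.nsmul_replicate] at hlamd
  rw [hmu, smul_zero, add_zero] at hmud
  have hadd : ∀ a b : ℕ, Multiset.replicate (a + b) 1 =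
    Multiset.replicate a 1 + Multiset.replicate b 1 := fun a b => Multiset.replicate_add a b 1
  have h1 : Multiset.replicate 1 1 = ({1} : Multiset ℕ) := rfl
  have h2 : Multiset.replicate 2 1 = ({1} + {1} : Multiset ℕ) := rfl
  have hpr : ∀ a b : ℕ, ({a, b} : Multiset ℕ) = {a} + {b} := fun a b => rfl
  have hα : ∀ m, (addTwoOnes lam (m + 3)).parts = evenParts lam.parts +
      Multiset.replicate (2 * k) 1 + unpairedOddParts lam.parts + {2} +
        Multiset.replicate (2 * m + 6) 1 := by
    intro m
    change lam.parts + {2} + Multiset.replicate (2 * (m + 3)) 1 = _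
    rw [← hlamd]
    rfl
  have hβ : ∀ m, (addTwoOnes mu (m + 3)).parts = evenParts mu.parts +
      unpairedOddParts mu.parts + {2} + Multiset.replicate (2 * m + 6) 1 := by
    intro m
    change mu.parts + {2} + Multiset.replicate (2 * (m + 3)) 1 = _
    rw [← hmud]
    rfl
  have hol := fun j => odd_of_mem_unpairedOddParts (p := lam.parts) (k := j)
  have hom := fun j => odd_of_mem_unpairedOddParts (p := mu.parts) (k := j)
  refine ⟨k + Multiset.card (evenParts lam.parts) + Multiset.card (evenParts mu.parts) + 4 + g,
    fun m hm => ?_⟩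
  rcases hodd with ⟨hl, hr⟩ | ⟨hl, hr⟩ | ⟨hl, hr⟩ | ⟨hl, hr⟩
  · obtain ⟨p, hp⟩ := Multiset.card_eq_one.mp hl
    obtain ⟨q, hq⟩ := Multiset.card_eq_one.mp hr
    have hp' := hol p (by simp [hp])
    have hq' := hom q (by simp [hq])
    refine (Nat.factorial_le (show 2 * m ≤ 2 * m + 1 by omega)).trans
      (factorial_le_hReal_of_parts (p₁ := p) (p₂ := 1) (q₁ := q) (q₂ := 1) (t := k) hp' odd_one hq'
        odd_one ?_ ?_ (by omega))
    · rw [hα, hp, show 2 * m + 6 = 2 * m + 1 + 4 + 1 by omega, hadd _ 1, h1, hpr]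
      abel
    · rw [hβ, hq, show 2 * m + 6 = 2 * m + 1 + 4 + 1 by omega, hadd _ 1, h1, hpr]
      abel
  · obtain ⟨p₁, p₂, hp⟩ := Multiset.card_eq_two.mp hl
    have hq := Multiset.card_eq_zero.mp hr
    refine factorial_le_hReal_of_parts (p₁ := p₁) (p₂ := p₂) (q₁ := 1) (q₂ := 1) (t := k + 1)
        (hol _ (by simp [hp])) (hol _ (by simp [hp])) odd_one odd_one ?_ ?_ (by omega)
    · rw [hα, hp, show 2 * m + 6 = 2 * m + 4 + 2 by omega, hadd (2 * m + 4) 2, hpr,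
        show 2 * (k + 1) = 2 * k + 2 by omega, hadd (2 * k) 2, h2]
      abel
    · rw [hβ, hq, show 2 * m + 6 = 2 * m + 4 + 2 by omega, hadd _ 2, h2, hpr]
      abel
  · obtain ⟨q₁, q₂, hq⟩ := Multiset.card_eq_two.mp hr
    have hp := Multiset.card_eq_zero.mp hl
    -- Two of the paired ones of `lam` serve as end blocks, which leaves `t = k - 1` and spares all
    -- the added ones.
    refine (Nat.factorial_le (show 2 * m ≤ 2 * m + 2 by omega)).trans
      (factorial_le_hReal_of_parts (p₁ := 1) (p₂ := 1) (q₁ := q₁) (q₂ := q₂) (t := k - 1) odd_one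
        odd_one (hom _ (by simp [hq])) (hom _ (by simp [hq])) ?_ ?_ (by omega))
    · rw [hα, hp, show 2 * k = 2 * (k - 1) + 2 by omega, hadd _ 2, h2, hpr]
      abel
    · rw [hβ, hq, hpr]
      abel
  · have hp := Multiset.card_eq_zero.mp hl
    have hq := Multiset.card_eq_zero.mp hr
    refine factorial_le_hReal_of_parts (p₁ := 1) (p₂ := 1) (q₁ := 1) (q₂ := 1) (t := k)
        odd_one odd_one odd_one odd_one ?_ ?_ (by omega)
    · rw [hα, hp, show 2 * m + 6 = 2 * m + 4 + 2 by omega, hadd _ 2, h2, hpr]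
      abel
    · rw [hβ, hq, show 2 * m + 6 = 2 * m + 4 + 2 by omega, hadd _ 2, h2, hpr]
      abel

end RealMonotoneHurwitz

namespace RealMonotoneHurwitz

open Equiv

/-! ### Comparison of the real and the complex numbers -/

theorem partialProduct_zero {d r : ℕ} (σ₁ : Perm (Fin d)) (τ : Fin r → Perm (Fin d)) :
    partialProduct σ₁ τ 0 = σ₁ := by
  simp [partialProduct]

theorem partialProduct_succ {d r : ℕ} (σ₁ : Perm (Fin d)) (τ : Fin r → Perm (Fin d)) (i : Fin r) :
    partialProduct σ₁ τ i.succ = τ i * partialProduct σ₁ τ i.castSucc := by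
  simp [partialProduct]

/-- A real structure with constant signs is determined by one value. -/
theorem realStructure_unique {d g : ℕ} {α β : d.Partition} {σ₁ σ₂ : Perm (Fin d)}
    {τ : Fin (numSimple g α β) → Perm (Fin d)} (h : IsFactorization g α β σ₁ τ σ₂)
    {γ γ' : Perm (Fin d)} (hγ : IsRealStructure (simpleSigns _ (numSimple g α β)) γ σ₁ τ)
    (hγ' : IsRealStructure (simpleSigns _ (numSimple g α β)) γ' σ₁ τ) {x : Fin d}
    (hx : γ x = γ' x) : γ = γ' := by
  -- All signs are positive, so the conjugator never changes. The value `1` only extends the partial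
  -- products to all natural indices.
  have hconj : ∀ c i, conjugators (simpleSigns _ (numSimple g α β)) c σ₁ τ i = c := by
    intro c i
    rw [conjugators_simpleSigns _ _ _ _ (fun j => if h : j < numSimple g α β + 1 then
      partialProduct σ₁ τ ⟨j, h⟩ else 1) (fun i => by rw [dif_pos i.2]), if_pos (Nat.lt_succ_iff.mp i.2)]
  have h1 : ∀ c, IsRealStructure (simpleSigns _ (numSimple g α β)) c σ₁ τ →
      ∀ i, c * partialProduct σ₁ τ i = (partialProduct σ₁ τ i)⁻¹ * c := by
    intro c hc i
    have := hc.2 i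
    rw [hconj] at this
    rw [← this, mul_assoc _ c c, hc.1, mul_one]
  have hcomm : ∀ i, γ' * γ * partialProduct σ₁ τ i = partialProduct σ₁ τ i * (γ' * γ) := by
    intro i
    have h2 : γ' * (partialProduct σ₁ τ i)⁻¹ = partialProduct σ₁ τ i * γ' := by
      rw [mul_inv_eq_iff_eq_mul, mul_assoc, h1 γ' hγ' i, mul_inv_cancel_left]
    rw [mul_assoc, h1 γ hγ, ← mul_assoc, h2, mul_assoc]
  -- Both `γ` and `γ'` invert every partial product, so `γ' * γ` commutes with all of them, hence
  -- with the group they generate. By transitivity a fixed point of `γ' * γ` spreads to all points.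
  have hle : Subgroup.closure ({σ₁, σ₂} ∪ Set.range τ) ≤ Subgroup.centralizer {γ' * γ} := by
    have hP : ∀ i, partialProduct σ₁ τ i ∈ Subgroup.centralizer {γ' * γ} := by
      intro i
      rw [Subgroup.mem_centralizer_singleton_iff]
      exact (hcomm i).symm
    rw [Subgroup.closure_le]
    rintro π ((rfl | rfl) | ⟨i, rfl⟩)
    · rw [← partialProduct_zero π τ]
      exact hP 0
    · rw [eq_inv_of_mul_eq_one_left h.prod_eq_one]
      exact inv_mem (hP _)
    · have : τ i = partialProduct σ₁ τ i.succ * (partialProduct σ₁ τ i.castSucc)⁻¹ := by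
        rw [partialProduct_succ, mul_inv_cancel_right]
      rw [this]
      exact mul_mem (hP _) (inv_mem (hP _))
  have hfix : (γ' * γ) x = x := by
    rw [Perm.mul_apply, hx, ← Perm.mul_apply, hγ'.1, Perm.one_apply]
  have hone : γ' * γ = 1 := by
    ext1 y
    have := h.transitive
    obtain ⟨⟨π, hπ⟩, hπy⟩ := MulAction.exists_smul_eq
      (Subgroup.closure ({σ₁, σ₂} ∪ Set.range τ)) x y
    change π x = y at hπy
    have h3 := Subgroup.mem_centralizer_singleton_iff.mp (hle hπ)
    rw [← hπy, ← Perm.mul_apply, ← h3, Perm.mul_apply, hfix, Perm.one_apply]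
  calc γ = γ' * γ' * γ := by rw [hγ'.1, one_mul]
    _ = γ' := by rw [mul_assoc, hone, mul_one]

/-- The minimum is at most its value at the all-positive sequence `s = r`, where a real structure is
determined by its value at the first point, leaving `d` possibilities. -/
theorem realMonotone_le {d g : ℕ} (hd : 0 < d) (α β : d.Partition) :
    realMonotone g α β ≤ d * complexMonotone g α β := by
  refine (ciInf_le (OrderBot.bddBelow _) (Fin.last _)).trans ?_
  unfold realMonotoneOfSigns complexMonotone
  have hprod : ∀ S : Set (Perm (Fin d) × (Fin (numSimple g α β) → Perm (Fin d)) × Perm (Fin d)),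
      d * S.ncard = ((Set.univ : Set (Fin d)) ×ˢ S).ncard := fun S => by
    rw [Set.ncard_prod, Set.ncard_univ, Nat.card_eq_fintype_card, Fintype.card_fin]
  rw [hprod]
  refine Set.ncard_le_ncard_of_injOn (fun t => (t.1 ⟨0, hd⟩, t.2)) ?_ ?_ (Set.toFinite _)
  · rintro ⟨γ, σ₁, τ, σ₂⟩ ⟨h1, h2, -⟩
    exact ⟨trivial, h1, h2⟩
  · rintro ⟨γ, t⟩ ⟨h1, h2, h3⟩ ⟨γ', t'⟩ ⟨h1', h2', h3'⟩ heq
    simp only [Prod.mk.injEq] at heq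
    obtain ⟨hx, rfl⟩ := heq
    rw [Prod.mk.injEq]
    exact ⟨realStructure_unique h1 h3 h3' hx, rfl⟩

end RealMonotoneHurwitz

namespace RealMonotoneHurwitz

open Equiv

/-! ### The cut potential -/

/-- The function `max 0 (n / K - 1)`. -/
noncomputable def excess (K : ℕ) (n : ℕ) : ℝ := max 0 ((n : ℝ) / K - 1)

theorem excess_nonneg (K n : ℕ) : 0 ≤ excess K n := le_max_left _ _

/-- The positive part of x - 1 is increasing and 1-Lipschitz, which gives the bound A/K; it is also
subadditive up to 1. -/
theorem excess_add_le (K A B : ℕ) :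
    excess K (A + B) ≤ excess K A + excess K B + min 1 ((A : ℝ) / K) := by
  have hA : (0 : ℝ) ≤ (A : ℝ) / K := by positivity
  have hB : (0 : ℝ) ≤ (B : ℝ) / K := by positivity
  unfold excess
  push_cast
  rw [add_div]
  grind

/-- Superadditivity: x ↦ max(0, x - 1) is convex and vanishes at 0, so cuts never raise the excess.
-/
theorem excess_add_excess_le (K A B : ℕ) : excess K A + excess K B ≤ excess K (A + B) := by
  have hA : (0 : ℝ) ≤ (A : ℝ) / K := by positivity
  have hB : (0 : ℝ) ≤ (B : ℝ) / K := by positivity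
  unfold excess
  push_cast
  rw [add_div]
  grind

/-- Once both pieces have length at least `K`, no maximum is truncated and each piece loses its own
1; this is the payment for a far cut. -/
theorem excess_add_excess_add_one_le {K A B : ℕ} (hK : 0 < K) (hA : K ≤ A) (hB : K ≤ B) :
    excess K A + excess K B + 1 ≤ excess K (A + B) := by
  have hA : (1 : ℝ) ≤ (A : ℝ) / K := by
    rw [le_div_iff₀ (by exact_mod_cast hK), one_mul]
    exact_mod_cast hA
  have hB : (1 : ℝ) ≤ (B : ℝ) / K := by
    rw [le_div_iff₀ (by exact_mod_cast hK), one_mul]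
    exact_mod_cast hB
  unfold excess
  push_cast
  rw [add_div]
  grind

/-- Merging orbits lowers the sum of square roots by at least half the root of the smaller one. On
squaring, the claim reduces to √x √y ≥ x. -/
theorem sqrt_min_le {x y : ℝ} (hx : 0 ≤ x) (hxy : x ≤ y) :
    √x / 2 ≤ √x + √y - √(x + y) := by
  have h1 := Real.sq_sqrt hx
  have h2 := Real.sq_sqrt (hx.trans hxy)
  have h3 := Real.sqrt_le_sqrt hxy
  have h4 := Real.sqrt_nonneg x
  have : √(x + y) ≤ √x / 2 + √y := by
    rw [Real.sqrt_le_iff]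
    constructor
    · positivity
    · nlinarith
  linarith

theorem min_one_div_le {K : ℕ} (t : ℕ) : min 1 ((t : ℝ) / K) ≤ √t / √K := by
  rw [← Real.sqrt_div (by positivity)]
  have hu : (0 : ℝ) ≤ (t : ℝ) / K := by positivity
  rcases le_total 1 ((t : ℝ) / K) with h | h
  · exact (min_le_left _ _).trans (Real.one_le_sqrt.mpr h)
  · refine (min_le_right _ _).trans (Real.le_sqrt_of_sq_le ?_)
    nlinarith

/-- Amalgamating two cycles inside two distinct orbits raises the excess by at most what the sum of
the square roots of the orbit sizes pays for. -/
theorem excess_add_le_sqrt {K A B x y : ℕ} (hA : A ≤ x) (hB : B ≤ y) :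
    excess K (A + B) ≤ excess K A + excess K B + 2 / √K * (√x + √y - √(x + y : ℕ)) := by
  have key : ∀ {A B x y : ℕ}, A ≤ x → B ≤ y → x ≤ y →
      excess K (A + B) ≤ excess K A + excess K B + 2 / √K * (√x + √y - √(x + y : ℕ)) := by
    intro A B x y hA hB hxy
    have h1 := excess_add_le K A B
    have h2 := min_one_div_le (K := K) A
    have h3 : √(A : ℝ) / √K ≤ 2 / √K * (√x / 2) := by
      rw [div_mul_div_comm, mul_comm 2, mul_div_mul_right _ _ two_ne_zero]
      have : √(A : ℝ) ≤ √x := Real.sqrt_le_sqrt (by exact_mod_cast hA)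
      gcongr
    have h4 : 2 / √(K : ℝ) * (√x / 2) ≤ 2 / √K * (√x + √y - √(x + y : ℕ)) := by
      push_cast
      exact mul_le_mul_of_nonneg_left (sqrt_min_le (by positivity) (by exact_mod_cast hxy))
        (by positivity)
    linarith
  rcases le_total x y with h | h
  · exact key hA hB h
  · have := key hB hA h
    rw [add_comm A, add_comm x, add_comm (excess K A), add_comm √(x : ℝ)]
    exact this

variable {V : Type*} [DecidableEq V]

/-- The points `a` and `b` are at distance at most `K` on a cycle of `σ`. -/
def IsClose (K : ℕ) (σ : Perm V) (a b : V) : Prop :=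
  ∃ j ≤ K, (σ ^ j) b = a ∨ (σ ^ j) a = b

/-- The orbits of the group generated by `σ` and the transpositions `(a_j b_j)` with `j < i`. -/
noncomputable def orbitSetoid (σ : Perm V) (a b : ℕ → V) : ℕ → Setoid V
  | 0 => Perm.SameCycle.setoid σ
  | i + 1 => mergeSetoid (orbitSetoid σ a b i) (a i) (b i)

/-- The products `(a_{i-1} b_{i-1}) ⋯ (a_0 b_0) σ`. -/
def swapProduct (σ : Perm V) (a b : ℕ → V) : ℕ → Perm V
  | 0 => σ
  | i + 1 => swap (a i) (b i) * swapProduct σ a b i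

open Classical in
/-- The number of `i < n` for which `a_i`, `b_i` are not close on the cycles of the `i`-th
product. -/
noncomputable def numFar (K : ℕ) (σ : Perm V) (a b : ℕ → V) (n : ℕ) : ℕ :=
  ((Finset.range n).filter fun i => ¬ IsClose K (swapProduct σ a b i) (a i) (b i)).card

theorem numFar_succ_of_isClose {K : ℕ} {σ : Perm V} {a b : ℕ → V} {n : ℕ}
    (h : IsClose K (swapProduct σ a b n) (a n) (b n)) :
    numFar K σ a b (n + 1) = numFar K σ a b n := by
  rw [numFar, numFar, Finset.range_add_one, Finset.filter_insert, if_neg (not_not.mpr h)]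

theorem numFar_succ_le (K : ℕ) (σ : Perm V) (a b : ℕ → V) (n : ℕ) :
    numFar K σ a b (n + 1) ≤ numFar K σ a b n + 1 := by
  rw [numFar, numFar, Finset.range_add_one, Finset.filter_insert]
  split_ifs
  · omega
  · exact Finset.card_insert_le n _

variable [Fintype V]

/-- Cycles of the partial products lie inside orbits. Therefore a join either merges two orbits or
happens within one, and a cycle is never larger than its orbit. -/
theorem setoid_swapProduct_le (σ : Perm V) (a b : ℕ → V) (i : ℕ) :
    Perm.SameCycle.setoid (swapProduct σ a b i) ≤ orbitSetoid σ a b i := by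
  induction i with
  | zero => exact le_rfl
  | succ i ih =>
    refine setoid_le_of_forall fun x => ?_
    have h1 : orbitSetoid σ a b (i + 1) x (swapProduct σ a b i x) :=
      le_mergeSetoid _ _ _ (ih (Perm.sameCycle_apply_right.mpr (Perm.SameCycle.refl _ _)))
    refine (orbitSetoid σ a b (i + 1)).trans h1 ?_
    have h2 : orbitSetoid σ a b (i + 1) (a i) (b i) := mergeSetoid_self_apply _ _ _
    change orbitSetoid σ a b (i + 1) _ (swap (a i) (b i) (swapProduct σ a b i x))
    rw [swap_apply_def]
    split_ifs with h h'
    · rw [h]; exact h2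
    · rw [h']; exact (orbitSetoid σ a b (i + 1)).symm h2
    · exact (orbitSetoid σ a b (i + 1)).refl _

/-- The numbers of joins and of far cuts are controlled by the numbers of cycles and orbits, the
excess of the cycles, and the square roots of the orbit sizes. -/
theorem numFar_le {K : ℕ} (hK : 0 < K) (σ : Perm V) (a b : ℕ → V) (n : ℕ)
    (hne : ∀ i < n, a i ≠ b i) :
    (numFar K σ a b n : ℝ) ≤
      n + classSum (Perm.SameCycle.setoid σ) (fun _ => 1) -
        classSum (Perm.SameCycle.setoid (swapProduct σ a b n)) (fun _ => 1) -
      classSum (orbitSetoid σ a b 0) (fun _ => 1) + classSum (orbitSetoid σ a b n) (fun _ => 1) +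
      classSum (Perm.SameCycle.setoid σ) (excess K) -
      classSum (Perm.SameCycle.setoid (swapProduct σ a b n)) (excess K) +
      2 / √K * (classSum (orbitSetoid σ a b 0) (fun k => √k) -
        classSum (orbitSetoid σ a b n) (fun k => √k)) := by
  induction n with
  | zero => simp [numFar, swapProduct]
  | succ n ih =>
    specialize ih fun i hi => hne i (by omega)
    have hn := hne n (by omega)
    set P := swapProduct σ a b n with hP
    have hP' : swapProduct σ a b (n + 1) = swap (a n) (b n) * P := rfl
    have ho : orbitSetoid σ a b (n + 1) = mergeSetoid (orbitSetoid σ a b n) (a n) (b n) := rfl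
    have hle := setoid_swapProduct_le σ a b n
    have hfar : (numFar K σ a b (n + 1) : ℝ) ≤ numFar K σ a b n + 1 := by
      exact_mod_cast numFar_succ_le K σ a b n
    rw [hP']
    push_cast
    by_cases hs : P.SameCycle (a n) (b n)
    -- Cut: the new cycle cancels the new step on the right side, which then grows only by the drop
    -- of excess. That drop is at least 1 when the cut is far.
    · have ho' : orbitSetoid σ a b (n + 1) = orbitSetoid σ a b n := by
        rw [ho, mergeSetoid_eq_self (hle hs)]
      have hn' := not_sameCycle_swap_mul hs hn
      have h1 := classSum_mergeSetoid (r := Perm.SameCycle.setoid (swap (a n) (b n) * P)) hn'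
        (fun _ => 1)
      have h2 := classSum_mergeSetoid (r := Perm.SameCycle.setoid (swap (a n) (b n) * P)) hn'
        (excess K)
      rw [← setoid_eq_mergeSetoid_swap_mul hs hn] at h1 h2
      rw [ho']
      have h3 := excess_add_excess_le K
        (classCard (Perm.SameCycle.setoid (swap (a n) (b n) * P)) (a n))
        (classCard (Perm.SameCycle.setoid (swap (a n) (b n) * P)) (b n))
      by_cases hc : IsClose K P (a n) (b n)
      · rw [numFar_succ_of_isClose hc]
        linarith
      -- Far in both directions around the cycle means that both pieces have at least `K` points.
      · have hc1 := le_classCard_swap_mul hs hn (K := K) fun j hj h => hc ⟨j, hj, Or.inl h⟩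
        have hc2 := le_classCard_swap_mul hs.symm hn.symm (K := K)
          fun j hj h => hc ⟨j, hj, Or.inr h⟩
        rw [swap_comm] at hc2
        have h4 := excess_add_excess_add_one_le hK hc2 hc1
        linarith
    -- Join: the step and the lost cycle give 2 on the right side, of which 1 pays for the step
    -- being possibly far.
    · have h1 := classSum_mergeSetoid (r := Perm.SameCycle.setoid P) hs (fun _ => 1)
      have h2 := classSum_mergeSetoid (r := Perm.SameCycle.setoid P) hs (excess K)
      rw [← setoid_swap_mul hs] at h1 h2
      by_cases hr : orbitSetoid σ a b n (a n) (b n)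
      -- Within one orbit, the other 1 pays for the growth of the excess.
      · rw [ho, mergeSetoid_eq_self hr]
        have h3 := excess_add_le K (classCard (Perm.SameCycle.setoid P) (a n))
          (classCard (Perm.SameCycle.setoid P) (b n))
        have h4 := min_le_left 1 ((classCard (Perm.SameCycle.setoid P) (a n) : ℝ) / K)
        linarith
      -- When two orbits merge, the other 1 is taken by the lost orbit, and the growth of the excess
      -- is paid by the square roots.
      · have h3 := classSum_mergeSetoid hr (fun _ => 1)
        have h4 := classSum_mergeSetoid hr (fun k => √(k : ℝ))
        rw [← ho] at h3 h4
        have h5 := excess_add_le_sqrt (K := K) (classCard_mono hle (a n))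
          (classCard_mono hle (b n))
        have h6 : 2 / √(K : ℝ) * (classSum (orbitSetoid σ a b 0) (fun k => √(k : ℝ)) -
            classSum (orbitSetoid σ a b (n + 1)) (fun k => √(k : ℝ))) =
          2 / √(K : ℝ) * (classSum (orbitSetoid σ a b 0) (fun k => √(k : ℝ)) -
            classSum (orbitSetoid σ a b n) (fun k => √(k : ℝ))) +
          2 / √(K : ℝ) * (√(classCard (orbitSetoid σ a b n) (a n) : ℝ) +
            √(classCard (orbitSetoid σ a b n) (b n) : ℝ) -
            √((classCard (orbitSetoid σ a b n) (a n) + classCard (orbitSetoid σ a b n) (b n) :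
              ℕ) : ℝ)) := by
          rw [← mul_add]
          congr 1
          linarith
        rw [h6]
        linarith

end RealMonotoneHurwitz

namespace RealMonotoneHurwitz

open Equiv

/-! ### Far steps of a factorization -/

theorem classSum_sqrt_le {V : Type*} [Fintype V] (r : Setoid V) :
    classSum r (fun k => √k) ≤ Fintype.card V := by
  unfold classSum
  calc ∑ x, √(classCard r x : ℝ) / classCard r x ≤ ∑ _x : V, (1 : ℝ) := by
        refine Finset.sum_le_sum fun x _ => ?_
        have h : (1 : ℝ) ≤ classCard r x := by exact_mod_cast classCard_pos r x
        rw [div_le_one (by positivity), Real.sqrt_le_left (by positivity)]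
        nlinarith
    _ = Fintype.card V := by simp

theorem classSum_nonneg {V : Type*} [Fintype V] (r : Setoid V) {F : ℕ → ℝ} (hF : ∀ n, 0 ≤ F n) :
    0 ≤ classSum r F :=
  Finset.sum_nonneg fun _ _ => div_nonneg (hF _) (Nat.cast_nonneg _)

theorem setoid_apply_of_mem_closure {V : Type*} [Finite V] {r : Setoid V} {S : Set (Perm V)}
    (h : ∀ π ∈ S, ∀ x, r x (π x)) {π : Perm V} (hπ : π ∈ Subgroup.closure S) (x : V) :
    r x (π x) := by
  induction hπ using Subgroup.closure_induction generalizing x with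
  | mem π hπ => exact h π hπ x
  | one => exact r.refl x
  | mul π ρ _ _ h1 h2 => exact r.trans (h2 x) (h1 (ρ x))
  | inv π _ h1 =>
    have := h1 (π⁻¹ x)
    rw [show π (π⁻¹ x) = x from π.apply_symm_apply x] at this
    exact r.symm this

theorem card_parts_pos {D : ℕ} (hD : 0 < D) (α : D.Partition) : 0 < Multiset.card α.parts := by
  rw [Multiset.card_pos]
  intro h
  have := α.parts_sum
  rw [h, Multiset.sum_zero] at this
  omega

variable {D g : ℕ} {α β : D.Partition}

theorem cast_numSimple (hD : 0 < D) (g : ℕ) (α β : D.Partition) :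
    (numSimple g α β : ℝ) = Multiset.card α.parts + Multiset.card β.parts + 2 * g - 2 := by
  have h1 := card_parts_pos hD α
  have h2 := card_parts_pos hD β
  unfold numSimple
  rw [Nat.cast_sub (by omega)]
  push_cast
  ring

open Classical in
-- With r = l(α) + l(β) + 2g - 2 steps, from l(α) orbits to a single one, the combinatorial part of
-- the potential bound becomes l(α) + 2g - 1. The final excess is dropped, and the initial sum of
-- square roots is at most `D`.
theorem card_far_le (hD : 0 < D) {K : ℕ} (hK : 0 < K) {σ₁ σ₂ : Perm (Fin D)}
    {τ : Fin (numSimple g α β) → Perm (Fin D)} (h : IsFactorization g α β σ₁ τ σ₂)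
    {a b : Fin (numSimple g α β) → Fin D} (hne : ∀ i, a i ≠ b i)
    (hτ : ∀ i, τ i = swap (a i) (b i)) :
    ((Finset.univ.filter fun i =>
      ¬ IsClose K (partialProduct σ₁ τ i.castSucc) (a i) (b i)).card : ℝ) ≤
      Multiset.card α.parts + 2 * g - 1 + (α.parts.map (excess K)).sum + 2 / √K * D := by
  -- The extension beyond `r` is arbitrary; only indices below `r` enter the bound.
  let a' : ℕ → Fin D := fun i => if h : i < numSimple g α β then a ⟨i, h⟩ else ⟨0, hD⟩
  let b' : ℕ → Fin D := fun i => if h : i < numSimple g α β then b ⟨i, h⟩ else ⟨0, hD⟩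
  have ha' : ∀ i : Fin (numSimple g α β), a' i = a i := fun i => dif_pos i.2
  have hb' : ∀ i : Fin (numSimple g α β), b' i = b i := fun i => dif_pos i.2
  have hP : ∀ i : Fin (numSimple g α β + 1), swapProduct σ₁ a' b' i = partialProduct σ₁ τ i := by
    intro i
    induction i using Fin.induction with
    | zero => rw [partialProduct_zero]; rfl
    | succ i ih =>
      rw [partialProduct_succ, hτ, ← ih, ← ha', ← hb']
      rfl
  have hcount : (Finset.univ.filter fun i =>
      ¬ IsClose K (partialProduct σ₁ τ i.castSucc) (a i) (b i)).card ≤ numFar K σ₁ a' b' (numSimple g α β) := by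
    refine Finset.card_le_card_of_injOn (fun i => (i : ℕ)) ?_ Fin.val_injective.injOn
    intro i hi
    simp only [Finset.coe_filter, Finset.mem_univ, true_and, Set.mem_ofPred_eq] at hi
    simp only [Finset.coe_filter, Finset.mem_range, Set.mem_ofPred_eq]
    refine ⟨i.2, ?_⟩
    rw [ha', hb']
    have := hP i.castSucc
    rw [Fin.val_castSucc] at this
    rw [this]
    exact hi
  have hmain := numFar_le hK σ₁ a' b' (numSimple g α β) fun i hi => by
    have := hne ⟨i, hi⟩
    rw [← ha', ← hb'] at this
    exact this
  have hlast : swapProduct σ₁ a' b' (numSimple g α β) = σ₂⁻¹ := by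
    have := hP (Fin.last (numSimple g α β))
    rw [Fin.val_last] at this
    rw [this]
    exact eq_inv_of_mul_eq_one_right h.prod_eq_one
  have horbit : ∀ i ≤ (numSimple g α β), Perm.SameCycle.setoid σ₁ ≤ orbitSetoid σ₁ a' b' i ∧
      ∀ j < i, orbitSetoid σ₁ a' b' i (a' j) (b' j) := by
    intro i
    induction i with
    | zero => exact fun _ => ⟨le_rfl, fun j hj => absurd hj (Nat.not_lt_zero j)⟩
    | succ i ih =>
      intro hi
      obtain ⟨h1, h2⟩ := ih (by omega)
      refine ⟨h1.trans (le_mergeSetoid _ _ _), fun j hj => ?_⟩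
      rcases (Nat.lt_succ_iff_lt_or_eq.mp hj) with hj | rfl
      · exact le_mergeSetoid _ _ _ (h2 j hj)
      · exact mergeSetoid_self_apply _ _ _
  obtain ⟨ho1, ho2⟩ := horbit (numSimple g α β) le_rfl
  have hne' : Nonempty (Fin D) := ⟨⟨0, hD⟩⟩
  -- The permutation `σ₂` is the inverse of the last product, so its moves also stay inside the
  -- final orbits; transitivity then leaves a single orbit.
  have htop : orbitSetoid σ₁ a' b' (numSimple g α β) = ⊤ := by
    rw [Setoid.eq_top_iff]
    intro x y
    have := h.transitive
    obtain ⟨⟨π, hπ⟩, rfl⟩ := MulAction.exists_smul_eq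
      (Subgroup.closure ({σ₁, σ₂} ∪ Set.range τ)) x y
    refine setoid_apply_of_mem_closure ?_ hπ x
    rintro π ((rfl | rfl) | ⟨i, rfl⟩) x
    · exact ho1 (Perm.sameCycle_apply_right.mpr (Perm.SameCycle.refl _ _))
    · have h1 : orbitSetoid σ₁ a' b' (numSimple g α β) (π x) ((swapProduct σ₁ a' b' (numSimple g α β)) (π x)) :=
        setoid_swapProduct_le _ _ _ _
          (Perm.sameCycle_apply_right.mpr (Perm.SameCycle.refl _ _))
      rw [hlast, show π⁻¹ (π x) = x from π.symm_apply_apply x] at h1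
      exact (orbitSetoid σ₁ a' b' (numSimple g α β)).symm h1
    · have h2 := ho2 i i.2
      rw [ha', hb'] at h2
      rw [hτ, swap_apply_def]
      split_ifs with h3 h4
      · rw [h3]; exact h2
      · rw [h4]; exact (orbitSetoid σ₁ a' b' (numSimple g α β)).symm h2
      · exact (orbitSetoid σ₁ a' b' (numSimple g α β)).refl x
  rw [htop, classSum_top, hlast] at hmain
  have h1 : classSum (Perm.SameCycle.setoid σ₁) (fun _ => 1) = Multiset.card α.parts := by
    rw [classSum_setoid_eq, h.type_left]
    simp
  have h2 : classSum (Perm.SameCycle.setoid σ₂⁻¹) (fun _ => 1) = Multiset.card β.parts := by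
    rw [classSum_setoid_eq, partition_inv_parts, h.type_right]
    simp
  have h3 : classSum (Perm.SameCycle.setoid σ₁) (excess K) = (α.parts.map (excess K)).sum := by
    rw [classSum_setoid_eq, h.type_left]
  have h4 := classSum_nonneg (Perm.SameCycle.setoid σ₂⁻¹) (excess_nonneg K)
  have h5 := classSum_sqrt_le (orbitSetoid σ₁ a' b' 0)
  have h6 := classSum_nonneg (⊤ : Setoid (Fin D)) (F := fun k => √k) fun _ => Real.sqrt_nonneg _
  rw [Fintype.card_fin] at h5
  have h7 : classSum (orbitSetoid σ₁ a' b' 0) (fun _ => 1) = Multiset.card α.parts := h1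
  have h8 : 2 / √(K : ℝ) * (classSum (orbitSetoid σ₁ a' b' 0) (fun k => √(k : ℝ)) -
      classSum ⊤ (fun k => √(k : ℝ))) ≤ 2 / √K * D :=
    mul_le_mul_of_nonneg_left (by linarith) (by positivity)
  rw [h1, h2, h3, h7, cast_numSimple hD] at hmain
  have h9 : ((Finset.univ.filter fun i =>
      ¬ IsClose K (partialProduct σ₁ τ i.castSucc) (a i) (b i)).card : ℝ) ≤
      numFar K σ₁ a' b' (numSimple g α β) := by exact_mod_cast hcount
  linarith

end RealMonotoneHurwitz

namespace RealMonotoneHurwitz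

open Equiv

/-! ### Counting factorizations by codes -/

/-- The class has D! / (D - s)! elements divided further by a positive integer, where s is the sum
of the nontrivial parts. For the types considered s is bounded, so `σ₁` contributes only a
polynomial factor. -/
theorem card_cycleType_le {D : ℕ} (m : Multiset ℕ) :
    (Finset.univ.filter fun σ : Perm (Fin D) => σ.cycleType = m).card ≤ D ^ m.sum := by
  rw [Equiv.Perm.card_of_cycleType]
  split_ifs with hm
  · rw [Fintype.card_fin] at hm ⊢
    refine le_trans ?_ (Nat.descFactorial_le_pow D m.sum)
    rw [Nat.descFactorial_eq_div hm.1, mul_assoc]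
    refine Nat.div_le_div_left ?_ (Nat.factorial_pos _)
    refine Nat.le_mul_of_pos_right _ (Nat.mul_pos ?_ ?_)
    · exact Multiset.prod_pos fun a ha => zero_lt_two.trans_le (hm.2 a ha)
    · exact Finset.prod_pos fun n _ => Nat.factorial_pos _
  · exact Nat.zero_le _

theorem cycleType_eq_filter {D : ℕ} (σ : Perm (Fin D)) :
    σ.cycleType = σ.partition.parts.filter (2 ≤ ·) := by
  rw [Perm.parts_partition, Multiset.filter_add, Multiset.filter_eq_self.mpr
    (fun _ h => Perm.two_le_of_mem_cycleType h), Multiset.filter_eq_nil.mpr, add_zero]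
  intro a ha
  rw [Multiset.eq_of_mem_replicate ha]
  norm_num

theorem card_partition_le {D : ℕ} (α : D.Partition) :
    (Finset.univ.filter fun σ : Perm (Fin D) => σ.partition.parts = α.parts).card ≤
      D ^ (α.parts.filter (2 ≤ ·)).sum := by
  refine le_trans (Finset.card_le_card fun σ hσ => ?_) (card_cycleType_le _)
  rw [Finset.mem_filter] at hσ ⊢
  exact ⟨hσ.1, by rw [cycleType_eq_filter, hσ.2]⟩

open Classical in
-- Adding `i` to the `i`-th value makes a monotone sequence strictly increasing, and such a sequence
-- is determined by its range, a subset of `D + r` points. This is where monotonicity saves a factor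
-- D per step.
theorem card_monotone_le (r D : ℕ) :
    (Finset.univ.filter fun b : Fin r → Fin D => Monotone b).card ≤ 2 ^ (D + r) := by
  rw [← Fintype.card_fin (D + r), ← Fintype.card_finset, ← Finset.card_univ]
  let f : (Fin r → Fin D) → Fin r → Fin (D + r) := fun b i => ⟨b i + i, by omega⟩
  refine Finset.card_le_card_of_injOn (fun b => Finset.univ.image (f b))
    (fun _ _ => Finset.mem_coe.mpr (Finset.mem_univ _)) ?_
  have hf : ∀ b : Fin r → Fin D, Monotone b → StrictMono (f b) := by
    intro b hb i j hij
    have h1 : (b i : ℕ) ≤ b j := hb hij.le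
    have h2 : (i : ℕ) < j := hij
    change (b i : ℕ) + i < b j + j
    omega
  intro b hb c hc h
  simp only [Finset.coe_filter, Finset.mem_univ, true_and, Set.mem_ofPred_eq] at hb hc
  have h1 : Set.range (f b) = Set.range (f c) := by
    simpa using congrArg (fun s : Finset (Fin (D + r)) => (s : Set (Fin (D + r)))) h
  have h2 := (StrictMono.range_inj (hf b hb) (hf c hc)).mp h1
  funext i
  have h3 := congrArg Fin.val (congrFun h2 i)
  apply Fin.ext
  change (b i : ℕ) + i = c i + i at h3
  omega

open Classical in
-- The set of positions carrying a letter from `A` has at most 2 ^ r possibilities; afterwards each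
-- position has a fixed alphabet.
theorem card_code_le {A B : Type*} [Fintype A] [Fintype B] [Nonempty A] [Nonempty B] (r M : ℕ) :
    (Finset.univ.filter fun c : Fin r → A ⊕ B =>
      (Finset.univ.filter fun i => (c i).isLeft).card ≤ M).card ≤
      2 ^ r * (Fintype.card A ^ M * Fintype.card B ^ r) := by
  have hA : 0 < Fintype.card A := Fintype.card_pos
  have hB : 0 < Fintype.card B := Fintype.card_pos
  let T : Finset (Fin r) → Finset (Fin r → A ⊕ B) := fun S => Fintype.piFinset fun i =>
    if i ∈ S then Finset.univ.image Sum.inl else Finset.univ.image Sum.inr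
  have hT : ∀ S, (T S).card = Fintype.card A ^ S.card * Fintype.card B ^ (r - S.card) := by
    intro S
    rw [Fintype.card_piFinset]
    have : ∀ i, (if i ∈ S then (Finset.univ.image Sum.inl : Finset (A ⊕ B))
        else Finset.univ.image Sum.inr).card =
        if i ∈ S then Fintype.card A else Fintype.card B := by
      intro i
      split_ifs
      · rw [Finset.card_image_of_injective _ Sum.inl_injective, Finset.card_univ]
      · rw [Finset.card_image_of_injective _ Sum.inr_injective, Finset.card_univ]
    simp only [this]
    rw [Finset.prod_ite, Finset.prod_const, Finset.prod_const, Finset.filter_mem_eq_inter,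
      Finset.univ_inter, Finset.filter_not, Finset.filter_mem_eq_inter, Finset.univ_inter,
      ← Finset.compl_eq_univ_sdiff, Finset.card_compl, Fintype.card_fin]
  calc _ ≤ ((Finset.univ.filter fun S : Finset (Fin r) => S.card ≤ M).biUnion T).card := by
        refine Finset.card_le_card fun c hc => ?_
        rw [Finset.mem_filter] at hc
        rw [Finset.mem_biUnion]
        refine ⟨_, Finset.mem_filter.mpr ⟨Finset.mem_univ _, hc.2⟩, ?_⟩
        rw [Fintype.mem_piFinset]
        intro i
        rcases hi : c i with x | x <;> simp [hi]
    _ ≤ ∑ S ∈ Finset.univ.filter fun S : Finset (Fin r) => S.card ≤ M, (T S).card :=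
        Finset.card_biUnion_le
    _ ≤ ∑ S ∈ Finset.univ.filter fun S : Finset (Fin r) => S.card ≤ M,
          Fintype.card A ^ M * Fintype.card B ^ r := by
        refine Finset.sum_le_sum fun S hS => ?_
        rw [hT]
        exact Nat.mul_le_mul (Nat.pow_le_pow_right hA (Finset.mem_filter.mp hS).2)
          (Nat.pow_le_pow_right hB (Nat.sub_le _ _))
    _ ≤ _ := by
        rw [Finset.sum_const, smul_eq_mul]
        refine Nat.mul_le_mul_right _ ((Finset.card_le_univ _).trans ?_)
        rw [Fintype.card_finset, Fintype.card_fin]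

/-! ### Encoding the smaller points by their distance on a cycle. -/

section Code

variable {V : Type*}

/-- The point described by a code, relative to a permutation and a point: either the point is given
itself, or its position on the cycle of `b`. -/
def decode (K : ℕ) (σ : Perm V) (b : V) : V ⊕ (Fin (K + 1) × Bool) → V
  | Sum.inl a => a
  | Sum.inr (j, true) => (σ ^ (j : ℕ)) b
  | Sum.inr (j, false) => (σ ^ (j : ℕ))⁻¹ b

theorem exists_decode_eq (K : ℕ) (σ : Perm V) (a b : V) :
    ∃ c, decode K σ b c = a ∧ (c.isLeft → ¬ IsClose K σ a b) := by
  by_cases h : IsClose K σ a b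
  · obtain ⟨j, hj, h | h⟩ := h
    · exact ⟨Sum.inr (⟨j, by omega⟩, true), h, by simp⟩
    · exact ⟨Sum.inr (⟨j, by omega⟩, false), Perm.inv_eq_iff_eq.mpr h.symm, by simp⟩
  · exact ⟨Sum.inl a, rfl, fun _ => h⟩

end Code

variable {D r : ℕ}

/-- The products determined by `σ₁`, the points `b_i`, and the codes of the points `a_i`. -/
def codedProduct (K : ℕ) (σ₁ : Perm (Fin D)) (b : Fin r → Fin D)
    (c : Fin r → Fin D ⊕ (Fin (K + 1) × Bool)) : Fin (r + 1) → Perm (Fin D) :=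
  Fin.induction σ₁ fun i P => swap (decode K P (b i) (c i)) (b i) * P

/-- The factorization determined by `σ₁`, the points `b_i`, and the codes of the points `a_i`. -/
def decodeFactorization (K : ℕ)
    (t : Perm (Fin D) × (Fin r → Fin D) × (Fin r → Fin D ⊕ (Fin (K + 1) × Bool))) :
    Perm (Fin D) × (Fin r → Perm (Fin D)) × Perm (Fin D) :=
  (t.1, fun i => swap (decode K (codedProduct K t.1 t.2.1 t.2.2 i.castSucc) (t.2.1 i) (t.2.2 i))
    (t.2.1 i), (codedProduct K t.1 t.2.1 t.2.2 (Fin.last r))⁻¹)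

theorem codedProduct_eq {K : ℕ} {σ₁ : Perm (Fin D)} {τ : Fin r → Perm (Fin D)}
    {a b : Fin r → Fin D} (hτ : ∀ i, τ i = swap (a i) (b i))
    {c : Fin r → Fin D ⊕ (Fin (K + 1) × Bool)}
    (hc : ∀ i, decode K (partialProduct σ₁ τ i.castSucc) (b i) (c i) = a i) (i : Fin (r + 1)) :
    codedProduct K σ₁ b c i = partialProduct σ₁ τ i := by
  induction i using Fin.induction with
  | zero => simp [codedProduct, partialProduct]
  | succ i ih =>
    have : codedProduct K σ₁ b c i.succ =
        swap (decode K (codedProduct K σ₁ b c i.castSucc) (b i) (c i)) (b i) *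
          codedProduct K σ₁ b c i.castSucc := by
      simp [codedProduct]
    rw [this, ih, hc, partialProduct_succ, hτ]

open Classical in
-- A factorization is recovered from `σ₁`, the sequence `b` and the codes of the `a`'s, step by
-- step: each partial product is known before the next code is read. Only the at most `M` far steps
-- need the large alphabet.
theorem complexMonotone_le_of_card_far_le {g : ℕ} (hD : 0 < D) {α β : D.Partition} (K M : ℕ)
    (hM : ∀ (σ₁ σ₂ : Perm (Fin D)) (τ : Fin (numSimple g α β) → Perm (Fin D))
      (a b : Fin (numSimple g α β) → Fin D), IsFactorization g α β σ₁ τ σ₂ → (∀ i, a i ≠ b i) →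
      (∀ i, τ i = swap (a i) (b i)) → (Finset.univ.filter fun i =>
        ¬ IsClose K (partialProduct σ₁ τ i.castSucc) (a i) (b i)).card ≤ M) :
    complexMonotone g α β ≤ D ^ (α.parts.filter (2 ≤ ·)).sum * (2 ^ (D + numSimple g α β) *
      (2 ^ numSimple g α β * (D ^ M * (2 * (K + 1)) ^ numSimple g α β))) := by
  have hne : Nonempty (Fin D) := ⟨⟨0, hD⟩⟩
  have hcode := card_code_le (A := Fin D) (B := Fin (K + 1) × Bool) (numSimple g α β) M
  rw [Fintype.card_prod, Fintype.card_fin, Fintype.card_fin, Fintype.card_bool,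
    mul_comm (K + 1)] at hcode
  refine le_trans ?_ (Nat.mul_le_mul (card_partition_le α)
    (Nat.mul_le_mul (card_monotone_le (numSimple g α β) D) hcode))
  rw [← Finset.card_product, ← Finset.card_product]
  refine le_trans ?_ (Finset.card_image_le (f := decodeFactorization K))
  unfold complexMonotone
  rw [← Set.ncard_coe_finset]
  refine Set.ncard_le_ncard ?_ (Finset.finite_toSet _)
  rintro ⟨σ₁, τ, σ₂⟩ ⟨h, a, b, hab, hb⟩
  choose c hc hc' using fun i => exists_decode_eq K (partialProduct σ₁ τ i.castSucc) (a i) (b i)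
  have hP := codedProduct_eq (fun i => (hab i).2) hc
  rw [Finset.mem_coe, Finset.mem_image]
  refine ⟨(σ₁, b, c), ?_, ?_⟩
  · simp only [Finset.mem_product, Finset.mem_filter, Finset.mem_univ, true_and]
    refine ⟨h.type_left, fun i j hij => hb i j hij, le_trans (Finset.card_le_card ?_)
      (hM σ₁ σ₂ τ a b h (fun i => (hab i).1.ne) fun i => (hab i).2)⟩
    intro i hi
    rw [Finset.mem_filter] at hi ⊢
    exact ⟨hi.1, hc' i hi.2⟩
  · simp only [decodeFactorization, hP]
    refine Prod.ext rfl (Prod.ext (funext fun i => ?_) ?_)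
    · change swap _ _ = τ i
      rw [hc]
      exact (hab i).2.symm
    · exact (eq_inv_of_mul_eq_one_left h.prod_eq_one).symm

end RealMonotoneHurwitz

namespace RealMonotoneHurwitz

open Equiv Filter

/-! ### Asymptotics -/

theorem eventually_mul_le (C : ℝ) {ε : ℝ} (hε : 0 < ε) :
    ∀ᶠ m : ℕ in atTop, C * m ≤ ε * (m * Real.log m) := by
  have h : Tendsto (fun m : ℕ => Real.log m) atTop atTop :=
    Real.tendsto_log_atTop.comp tendsto_natCast_atTop_atTop
  filter_upwards [h.eventually_ge_atTop (C / ε)] with m hm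
  rw [div_le_iff₀ hε] at hm
  have h0 : (0 : ℝ) ≤ m := Nat.cast_nonneg m
  nlinarith

theorem isEquivalent_of_bounds {f : ℕ → ℝ}
    (h1 : ∀ ε > 0, ∀ᶠ m : ℕ in atTop, f m ≤ (2 + ε) * (m * Real.log m))
    (h2 : ∀ ε > 0, ∀ᶠ m : ℕ in atTop, (2 - ε) * (m * Real.log m) ≤ f m) :
    Asymptotics.IsEquivalent atTop f (fun m : ℕ => 2 * (m : ℝ) * Real.log m) := by
  rw [Asymptotics.IsEquivalent, Asymptotics.isLittleO_iff]
  intro ε hε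
  filter_upwards [h1 ε hε, h2 ε hε, eventually_ge_atTop 1] with m hm1 hm2 hm
  have h0 : 0 ≤ (m : ℝ) * Real.log m :=
    mul_nonneg (Nat.cast_nonneg m) (Real.log_natCast_nonneg m)
  rw [Pi.sub_apply, Real.norm_eq_abs, Real.norm_eq_abs, mul_assoc 2,
    abs_of_nonneg (by positivity : 0 ≤ 2 * ((m : ℝ) * Real.log m)), abs_le]
  constructor <;> nlinarith

theorem mul_log_sub_le_log_factorial {n : ℕ} (hn : 0 < n) :
    n * Real.log n - n ≤ Real.log n.factorial := by
  have h := Real.pow_div_factorial_le_exp (n : ℝ) (Nat.cast_nonneg n) n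
  have hn' : (0 : ℝ) < n := by exact_mod_cast hn
  have hf : (0 : ℝ) < n.factorial := by exact_mod_cast n.factorial_pos
  have h2 := Real.log_le_log (by positivity) h
  rw [Real.log_exp, Real.log_div (by positivity) hf.ne', Real.log_pow] at h2
  linarith

theorem log_add_two_mul_le (d : ℕ) {m : ℕ} (hm : 1 ≤ m) :
    Real.log ((d + 2 + 2 * m : ℕ) : ℝ) ≤ Real.log m + Real.log (d + 4) := by
  have hm' : (1 : ℝ) ≤ m := by exact_mod_cast hm
  rw [← Real.log_mul (by positivity) (by positivity)]
  refine Real.log_le_log (by positivity) ?_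
  push_cast
  have : (0 : ℝ) ≤ d := Nat.cast_nonneg d
  nlinarith

theorem excess_le (n : ℕ) {K : ℕ} (hK : 0 < K) : excess K n ≤ n := by
  have hK' : (1 : ℝ) ≤ K := by exact_mod_cast hK
  have hn : (0 : ℝ) ≤ n := Nat.cast_nonneg n
  refine max_le hn ?_
  have : (n : ℝ) / K ≤ n := div_le_self hn hK'
  linarith

theorem excess_one {K : ℕ} (hK : 0 < K) : excess K 1 = 0 := by
  have hK' : (1 : ℝ) ≤ K := by exact_mod_cast hK
  refine max_eq_left ?_
  have : ((1 : ℕ) : ℝ) / K ≤ 1 := by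
    rw [Nat.cast_one]
    exact div_le_one_of_le₀ hK' (by positivity)
  linarith

theorem sum_map_excess_le {d : ℕ} (lam : d.Partition) (m : ℕ) {K : ℕ} (hK : 0 < K) :
    ((addTwoOnes lam m).parts.map (excess K)).sum ≤ d + 2 := by
  have h1 : (lam.parts.map (excess K)).sum ≤ (lam.parts.map (Nat.cast : ℕ → ℝ)).sum :=
    Multiset.sum_map_le_sum_map _ _ fun n _ => excess_le n hK
  have h2 : (lam.parts.map (Nat.cast : ℕ → ℝ)).sum = d := by
    have := lam.parts_sum
    rw [← Nat.cast_multiset_sum, this]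
  have h3 := excess_le 2 hK
  change ((lam.parts + {2} + Multiset.replicate (2 * m) 1).map (excess K)).sum ≤ _
  rw [Multiset.map_add, Multiset.map_add, Multiset.map_replicate, excess_one hK,
    Multiset.sum_add, Multiset.sum_add, Multiset.map_singleton, Multiset.sum_singleton,
    Multiset.sum_replicate, smul_zero, add_zero, ← h2]
  push_cast at h3
  linarith

theorem sum_filter_addTwoOnes_le {d : ℕ} (lam : d.Partition) (m : ℕ) :
    ((addTwoOnes lam m).parts.filter (2 ≤ ·)).sum ≤ d + 2 := by
  change ((lam.parts + {2} + Multiset.replicate (2 * m) 1).filter (2 ≤ ·)).sum ≤ _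
  rw [Multiset.filter_add, Multiset.filter_add, Multiset.sum_add, Multiset.sum_add]
  have h1 : (lam.parts.filter (2 ≤ ·)).sum ≤ d := by
    have := congrArg Multiset.sum (Multiset.filter_add_not (2 ≤ ·) lam.parts)
    rw [Multiset.sum_add, lam.parts_sum] at this
    omega
  have h2 : ((Multiset.replicate (2 * m) 1).filter (2 ≤ ·)) = 0 := by
    rw [Multiset.filter_eq_nil]
    intro a ha
    rw [Multiset.eq_of_mem_replicate ha]
    norm_num
  rw [h2, Multiset.filter_singleton, if_pos le_rfl]
  simpa using h1

theorem card_parts_addTwoOnes {d : ℕ} (lam : d.Partition) (m : ℕ) :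
    Multiset.card (addTwoOnes lam m).parts = Multiset.card lam.parts + 1 + 2 * m := by
  simp [addTwoOnes]

open Classical in
theorem hComplex_le {d : ℕ} (g : ℕ) (lam mu : d.Partition) (m : ℕ) {K : ℕ} (hK : 0 < K) :
    ∃ M : ℕ, (M : ℝ) ≤ Multiset.card lam.parts + 2 * m + 2 * g + (d + 2) +
        2 / √K * (d + 2 + 2 * m) ∧
      hComplex g lam mu m ≤ (d + 2 + 2 * m) ^ (d + 2) *
        (2 ^ (d + 2 + 2 * m + (Multiset.card lam.parts + Multiset.card mu.parts + 4 * m + 2 * g)) *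
        (2 ^ (Multiset.card lam.parts + Multiset.card mu.parts + 4 * m + 2 * g) *
          ((d + 2 + 2 * m) ^ M *
            (2 * (K + 1)) ^ (Multiset.card lam.parts + Multiset.card mu.parts + 4 * m + 2 * g))))
    := by
  have hX : (0 : ℝ) ≤ Multiset.card lam.parts + 2 * m + 2 * g + (d + 2) +
      2 / √K * (d + 2 + 2 * m) := by positivity
  -- The far steps are bounded by a real number, and the exponent has to be a natural one.
  refine ⟨⌊_⌋₊, Nat.floor_le hX, ?_⟩
  have hr : numSimple g (addTwoOnes lam m) (addTwoOnes mu m) =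
      Multiset.card lam.parts + Multiset.card mu.parts + 4 * m + 2 * g := by
    unfold numSimple
    rw [card_parts_addTwoOnes, card_parts_addTwoOnes]
    omega
  have h := complexMonotone_le_of_card_far_le (g := g) (α := addTwoOnes lam m)
    (β := addTwoOnes mu m) (by omega) K ⌊(Multiset.card lam.parts + 2 * m + 2 * g + (d + 2) +
        2 / √K * (d + 2 + 2 * m) : ℝ)⌋₊ fun σ₁ σ₂ τ a b h hne hτ => by
      have h1 := card_far_le (by omega) hK h hne hτ
      have h2 := sum_map_excess_le lam m hK
      rw [card_parts_addTwoOnes] at h1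
      refine Nat.le_floor ?_
      push_cast at h1
      linarith
  rw [hr] at h
  refine h.trans (Nat.mul_le_mul_right _ ?_)
  exact Nat.pow_le_pow_right (by omega) (sum_filter_addTwoOnes_le lam m)

theorem exists_log_hComplex_le {d : ℕ} (g : ℕ) (lam mu : d.Partition) {K : ℕ} (hK : 0 < K) :
    ∃ C : ℝ, ∀ m ≥ 1, 0 < hComplex g lam mu m → Real.log (hComplex g lam mu m) ≤
      (2 + 4 / √K) * (m * Real.log m) + C * m := by
  set l : ℝ := ((Multiset.card lam.parts : ℕ) : ℝ) with hl
  set l' : ℝ := ((Multiset.card mu.parts : ℕ) : ℝ) with hl'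
  have hl0 : 0 ≤ l := Nat.cast_nonneg _
  have hl0' : 0 ≤ l' := Nat.cast_nonneg _
  -- `A + B * m` bounds the total exponent of `d + 2 + 2 * m`: the `M` far steps together with the
  -- `d + 2` from counting `σ₁`.
  set A : ℝ := l + 2 * g + (d + 2) + 2 / √K * (d + 2) + (d + 2) with hA
  set B : ℝ := 2 + 4 / √K with hB
  have hA0 : 0 ≤ A := by positivity
  have hB0 : 0 ≤ B := by positivity
  set c : ℝ := Real.log (d + 4) with hc
  have hc0 : 0 ≤ c := Real.log_nonneg (by have : (0 : ℝ) ≤ d := Nat.cast_nonneg d; linarith)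
  set R : ℝ := l + l' + 4 + 2 * g with hR
  have hR0 : 0 ≤ R := by positivity
  set e : ℝ := Real.log (2 * (K + 1)) with he
  have he0 : 0 ≤ e := Real.log_nonneg (by have : (0 : ℝ) ≤ K := Nat.cast_nonneg K; linarith)
  have ht0 : 0 ≤ Real.log 2 := Real.log_nonneg (by norm_num)
  refine ⟨A + A * c + B * c + (d + 4 + 2 * R) * Real.log 2 + R * e, fun m hm hpos => ?_⟩
  obtain ⟨M, hM, hle⟩ := hComplex_le g lam mu m hK
  have hm' : (1 : ℝ) ≤ m := by exact_mod_cast hm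
  have hd0 : (0 : ℝ) ≤ d := Nat.cast_nonneg d
  have hlogm : 0 ≤ Real.log m := Real.log_natCast_nonneg m
  have hlogm' : Real.log m ≤ m := (Real.log_le_sub_one_of_pos (by linarith)).trans (by linarith)
  have hD := log_add_two_mul_le d hm
  have hlog : Real.log (hComplex g lam mu m) ≤ (d + 2) * Real.log ((d + 2 + 2 * m : ℕ) : ℝ) +
      ((d + 2 + 2 * m + (l + l' + 4 * m + 2 * g)) * Real.log 2 +
      ((l + l' + 4 * m + 2 * g) * Real.log 2 +
        (M * Real.log ((d + 2 + 2 * m : ℕ) : ℝ) + (l + l' + 4 * m + 2 * g) * e))) := by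
    have h1 : (hComplex g lam mu m : ℝ) ≤ _ := Nat.cast_le.mpr hle
    have h2 := Real.log_le_log (by exact_mod_cast hpos) h1
    refine h2.trans (le_of_eq ?_)
    have hD0 : (((d + 2 + 2 * m : ℕ) : ℝ)) ≠ 0 := by positivity
    have hK0 : (2 * ((K : ℝ) + 1)) ≠ 0 := by positivity
    rw [Nat.cast_mul, Nat.cast_mul, Nat.cast_mul, Nat.cast_mul, Nat.cast_pow, Nat.cast_pow,
      Nat.cast_pow, Nat.cast_pow, Nat.cast_pow, Nat.cast_mul 2 (K + 1), Nat.cast_ofNat,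
      Nat.cast_add_one,
      Real.log_mul (by positivity) (by positivity), Real.log_mul (by positivity) (by positivity),
      Real.log_mul (by positivity) (by positivity), Real.log_mul (by positivity) (by positivity),
      Real.log_pow, Real.log_pow, Real.log_pow, Real.log_pow, Real.log_pow]
    push_cast
    ring
  have hr : l + l' + 4 * m + 2 * g ≤ R * m := by
    have : (0 : ℝ) ≤ g := Nat.cast_nonneg g
    nlinarith
  have hd : (d : ℝ) + 2 + 2 * m ≤ (d + 4) * m := by nlinarith
  have h1 : ((d : ℝ) + 2 + M) * Real.log ((d + 2 + 2 * m : ℕ) : ℝ) ≤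
      (A + B * m) * (Real.log m + c) := by
    refine mul_le_mul ?_ hD (Real.log_natCast_nonneg _) (by positivity)
    have : 2 / √(K : ℝ) * (d + 2 + 2 * m) = 2 / √K * (d + 2) + 4 / √K * m := by ring
    rw [this] at hM
    rw [hA, hB]
    linarith
  have h2 : (l + l' + 4 * m + 2 * g) * Real.log 2 ≤ R * m * Real.log 2 :=
    mul_le_mul_of_nonneg_right hr ht0
  have h3 : (l + l' + 4 * m + 2 * g) * e ≤ R * m * e := mul_le_mul_of_nonneg_right hr he0
  have h4 : ((d : ℝ) + 2 + 2 * m) * Real.log 2 ≤ (d + 4) * m * Real.log 2 :=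
    mul_le_mul_of_nonneg_right hd ht0
  have h5 : A * Real.log m ≤ A * m := mul_le_mul_of_nonneg_left hlogm' hA0
  have h6 : A * c ≤ A * c * m := le_mul_of_one_le_right (by positivity) hm'
  linarith

theorem eventually_log_hComplex_le {d : ℕ} (g : ℕ) (lam mu : d.Partition)
    (hpos : ∀ᶠ m in atTop, 0 < hComplex g lam mu m) {ε : ℝ} (hε : 0 < ε) :
    ∀ᶠ m : ℕ in atTop, Real.log (hComplex g lam mu m) ≤ (2 + ε) * (m * Real.log m) := by
  have hlim : Tendsto (fun K : ℕ => √(K : ℝ)) atTop atTop :=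
    Real.tendsto_sqrt_atTop.comp tendsto_natCast_atTop_atTop
  -- This choice makes the excess coefficient 4/√K at most ε/2; the other ε/2 absorbs the linear
  -- term, whose constant depends on `K`.
  obtain ⟨K, hK, hK0⟩ := ((hlim.eventually_ge_atTop (8 / ε)).and (eventually_gt_atTop 0)).exists
  have hsq : 0 < √(K : ℝ) := Real.sqrt_pos.mpr (by exact_mod_cast hK0)
  have h4 : 4 / √(K : ℝ) ≤ ε / 2 := by
    rw [div_le_iff₀ hε] at hK
    rw [div_le_iff₀ hsq]
    linarith
  obtain ⟨C, hC⟩ := exists_log_hComplex_le g lam mu hK0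
  filter_upwards [hpos, eventually_ge_atTop 1, eventually_mul_le C (half_pos hε)] with m h1 h2 h3
  have h0 : 0 ≤ (m : ℝ) * Real.log m :=
    mul_nonneg (Nat.cast_nonneg m) (Real.log_natCast_nonneg m)
  have := hC m h2 h1
  nlinarith [mul_le_mul_of_nonneg_right h4 h0]

theorem hReal_le {d : ℕ} (g : ℕ) (lam mu : d.Partition) (m : ℕ) :
    hReal g lam mu m ≤ (d + 2 + 2 * m) * hComplex g lam mu m :=
  realMonotone_le (by omega) _ _

theorem eventually_le_log_of_factorial_le {h : ℕ → ℕ}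
    (hh : ∃ m₀, ∀ m ≥ m₀, (2 * m).factorial ≤ h (m + 3)) {ε : ℝ} (hε : 0 < ε) :
    ∀ᶠ m : ℕ in atTop, (2 - ε) * (m * Real.log m) ≤ Real.log (h m) := by
  obtain ⟨m₀, hm₀⟩ := hh
  -- With m = n + 3, replacing 2n by 2m - 6 costs at most 6 log m ≤ 6m, and the linear term of the
  -- factorial bound costs at most 2m, hence the constant 8. The 6 in the threshold ensures `n + 3 ≤
  -- 2 * n`.
  filter_upwards [eventually_ge_atTop (m₀ + 6), eventually_mul_le 8 hε] with m hm h8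
  obtain ⟨n, rfl⟩ : ∃ n, m = n + 3 := ⟨m - 3, by omega⟩
  have h1 := hm₀ n (by omega)
  have h2 : Real.log ((2 * n).factorial : ℝ) ≤ Real.log (h (n + 3)) :=
    Real.log_le_log (by exact_mod_cast Nat.factorial_pos _) (by exact_mod_cast h1)
  have h3 := mul_log_sub_le_log_factorial (n := 2 * n) (by omega)
  have hm1 : (1 : ℝ) ≤ ((n + 3 : ℕ) : ℝ) := by exact_mod_cast (by omega : 1 ≤ n + 3)
  have h4 : Real.log ((n + 3 : ℕ) : ℝ) ≤ Real.log ((2 * n : ℕ) : ℝ) :=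
    Real.log_le_log (by linarith) (by exact_mod_cast (by omega : n + 3 ≤ 2 * n))
  have h5 : Real.log ((n + 3 : ℕ) : ℝ) ≤ ((n + 3 : ℕ) : ℝ) :=
    (Real.log_le_sub_one_of_pos (by linarith)).trans (by linarith)
  have h6 : ((2 * n : ℕ) : ℝ) * Real.log ((n + 3 : ℕ) : ℝ) ≤
      ((2 * n : ℕ) : ℝ) * Real.log ((2 * n : ℕ) : ℝ) :=
    mul_le_mul_of_nonneg_left h4 (Nat.cast_nonneg _)
  have h7 : ((2 * n : ℕ) : ℝ) = 2 * ((n + 3 : ℕ) : ℝ) - 6 := by push_cast; ring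
  rw [h7] at h6 h3
  linarith

end RealMonotoneHurwitz

theorem mainTheorem1 (d g : ℕ) (lam mu : d.Partition)
    (hmu : RealMonotoneHurwitz.pairedOddParts mu.parts = 0)
    (hlam : 1 < Multiset.card (RealMonotoneHurwitz.pairedOddParts lam.parts))
    (hones : ∀ k ∈ RealMonotoneHurwitz.pairedOddParts lam.parts, k = 1)
    (hodd :
      (Multiset.card (RealMonotoneHurwitz.unpairedOddParts lam.parts) = 1 ∧
        Multiset.card (RealMonotoneHurwitz.unpairedOddParts mu.parts) = 1 ∧
        (RealMonotoneHurwitz.unpairedOddParts mu.parts).sum <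
          RealMonotoneHurwitz.maxEvenPart lam.parts) ∨
      (Multiset.card (RealMonotoneHurwitz.unpairedOddParts lam.parts) = 2 ∧
        Multiset.card (RealMonotoneHurwitz.unpairedOddParts mu.parts) = 0 ∧
        (RealMonotoneHurwitz.unpairedOddParts lam.parts).sup <
          RealMonotoneHurwitz.maxEvenPart mu.parts) ∨
      (Multiset.card (RealMonotoneHurwitz.unpairedOddParts lam.parts) = 0 ∧
        Multiset.card (RealMonotoneHurwitz.unpairedOddParts mu.parts) = 2 ∧
        (RealMonotoneHurwitz.unpairedOddParts mu.parts).sup <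
          RealMonotoneHurwitz.maxEvenPart lam.parts) ∨
      (Multiset.card (RealMonotoneHurwitz.unpairedOddParts lam.parts) = 0 ∧
        Multiset.card (RealMonotoneHurwitz.unpairedOddParts mu.parts) = 0)) :
    Asymptotics.IsEquivalent Filter.atTop
      (fun m : ℕ => Real.log (RealMonotoneHurwitz.hReal g lam mu m : ℝ))
      (fun m : ℕ => 2 * (m : ℝ) * Real.log (m : ℝ)) ∧
    Asymptotics.IsEquivalent Filter.atTop
      (fun m : ℕ => 2 * (m : ℝ) * Real.log (m : ℝ))
      (fun m : ℕ => Real.log (RealMonotoneHurwitz.hComplex g lam mu m : ℝ)) ∧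
    Asymptotics.IsEquivalent Filter.atTop
      (fun m : ℕ => Real.log (RealMonotoneHurwitz.hReal g lam mu m : ℝ))
      (fun m : ℕ => Real.log (RealMonotoneHurwitz.hComplex g lam mu m : ℝ)) := by
  have hfac : ∃ m₀, ∀ m ≥ m₀, (2 * m).factorial ≤ RealMonotoneHurwitz.hReal g lam mu (m + 3) :=
    RealMonotoneHurwitz.exists_factorial_le_hReal d g lam mu hmu hlam hones
      (hodd.imp (fun h => ⟨h.1, h.2.1⟩) (Or.imp (fun h => ⟨h.1, h.2.1⟩)
        (Or.imp (fun h => ⟨h.1, h.2.1⟩) id)))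
  have hrpos : ∀ᶠ m in Filter.atTop, 0 < RealMonotoneHurwitz.hReal g lam mu m := by
    obtain ⟨m₀, hm₀⟩ := hfac
    filter_upwards [Filter.eventually_ge_atTop (m₀ + 3)] with m hm
    obtain ⟨n, rfl⟩ : ∃ n, m = n + 3 := ⟨m - 3, by omega⟩
    exact (Nat.factorial_pos _).trans_le (hm₀ n (by omega))
  have hcpos : ∀ᶠ m in Filter.atTop, 0 < RealMonotoneHurwitz.hComplex g lam mu m :=
    hrpos.mono fun m hm => Nat.pos_of_mul_pos_left
      (hm.trans_le (RealMonotoneHurwitz.hReal_le g lam mu m))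
  -- The factor D contributes only O(m) to the logarithm, so the upper bound passes from the complex
  -- to the real numbers and the lower bound in the opposite direction.
  have hlog : ∀ᶠ m : ℕ in Filter.atTop, Real.log (RealMonotoneHurwitz.hReal g lam mu m : ℝ) ≤
      (1 + Real.log (d + 4)) * m + Real.log (RealMonotoneHurwitz.hComplex g lam mu m : ℝ) := by
    filter_upwards [hrpos, hcpos, Filter.eventually_ge_atTop 1] with m hr hc hm
    have h1 : (RealMonotoneHurwitz.hReal g lam mu m : ℝ) ≤
        ((d + 2 + 2 * m : ℕ) : ℝ) * RealMonotoneHurwitz.hComplex g lam mu m := by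
      exact_mod_cast RealMonotoneHurwitz.hReal_le g lam mu m
    have h2 := Real.log_le_log (by exact_mod_cast hr) h1
    have hc' : (RealMonotoneHurwitz.hComplex g lam mu m : ℝ) ≠ 0 := by exact_mod_cast hc.ne'
    rw [Real.log_mul (by positivity) hc'] at h2
    have h3 := RealMonotoneHurwitz.log_add_two_mul_le d hm
    have hm' : (1 : ℝ) ≤ m := by exact_mod_cast hm
    have h4 := Real.log_le_sub_one_of_pos (show (0 : ℝ) < m by linarith)
    have hd : (0 : ℝ) ≤ d := Nat.cast_nonneg d
    have h5 : Real.log (d + 4) ≤ Real.log (d + 4) * m :=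
      le_mul_of_one_le_right (Real.log_nonneg (by linarith)) hm'
    linarith
  have hReq : Asymptotics.IsEquivalent Filter.atTop
      (fun m : ℕ => Real.log (RealMonotoneHurwitz.hReal g lam mu m : ℝ))
      (fun m : ℕ => 2 * (m : ℝ) * Real.log (m : ℝ)) := by
    refine RealMonotoneHurwitz.isEquivalent_of_bounds (fun ε hε => ?_) fun ε hε =>
      RealMonotoneHurwitz.eventually_le_log_of_factorial_le hfac hε
    filter_upwards [hlog, RealMonotoneHurwitz.eventually_mul_le (1 + Real.log (d + 4))
      (half_pos hε), RealMonotoneHurwitz.eventually_log_hComplex_le g lam mu hcpos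
      (half_pos hε)] with m h1 h2 h3
    linarith
  have hCeq : Asymptotics.IsEquivalent Filter.atTop
      (fun m : ℕ => Real.log (RealMonotoneHurwitz.hComplex g lam mu m : ℝ))
      (fun m : ℕ => 2 * (m : ℝ) * Real.log (m : ℝ)) := by
    refine RealMonotoneHurwitz.isEquivalent_of_bounds (fun ε hε =>
      RealMonotoneHurwitz.eventually_log_hComplex_le g lam mu hcpos hε) fun ε hε => ?_
    filter_upwards [hlog, RealMonotoneHurwitz.eventually_mul_le (1 + Real.log (d + 4))
      (half_pos hε), RealMonotoneHurwitz.eventually_le_log_of_factorial_le hfac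
      (half_pos hε)] with m h1 h2 h3
    linarith
  exact ⟨hReq, hCeq.symm, hReq.trans hCeq.symm⟩
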